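/- Let $n\ge 1$ and let $f$ be a homogeneous polynomial of degree $n$ on $\mathbb C^{n+1}$ whose holomorphic differential $\partial f=\sum_j \frac{\partial f}{\partial z_j}\,dz_j$ vanishes at no point other than the origin. Identify $\mathbb C^{n+1}$ with Euclidean $\mathbb R^{2n+2}$, put $u=\operatorname{Re} f$ and $C=f^{-1}(0)\setminus\{0\}$, and let $r=|x|$. Conventions. For a $2n$-dimensional minimal cone $C$ with link $\Sigma=C\cap S^{2n+1}$, let $\Delta^\perp$ be the Laplacian of the normal connection $\nabla^\perp$ on the normal bundle $NC$, $A$ the second fundamental form, $\tilde A(V)=\sum_{i,j}\langle A(E_i,E_j),V\rangle A(E_i,E_j)$ for an orthonormal frame $(E_i)$ of $TC$, and $L=\Delta^\perp+\tilde A$. A Jacobi field on $C$ is a smooth normal field $V$ on $C$ with $LV=0$; it has homogeneity $a$ if $V(tp)=t^aV(p)$ for all $t>0$, $p\in C$. Let $C_1=C\cap\{|x|\le 1\}$, and let $\mathcal T$ be the set of smooth normal fields on $C_1$ that have compact support in $C_1$ (so they vanish near $0$) and vanish on $\Sigma$. Integrals are taken with respect to the $2n$-dimensional Hausdorff measure.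 The cone $C$ is stable if $\int_{C_1}\big(|\nabla^\perp V|^2-\langle V,\tilde A(V)\rangle\big)\ge 0$ for all $V\in\mathcal T$, and strictly stable if $$\inf\left\{-\frac{\int_{C_1}\langle V,LV\rangle}{\int_{C_1}|V|^2r^{-2}} : V\in\mathcal T,\ V\not\equiv 0\right\}>0 .$$ Theorem. $C$ is a minimal cone of real dimension $2n$ over a smooth compact embedded $(2n-1)$-dimensional submanifold of the unit sphere $S^{2n+1}$. The vector field $|\nabla u|^{-2}\nabla u$, restricted to $C$, is a not identically zero Jacobi field on $C$ with homogeneity $1-n$. The cone $C$ is stable but not strictly stable. -/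

import Mathlib

open scoped ContDiff

noncomputable section

namespace ConeGeometry

variable {E : Type*} [NormedAddCommGroup E] [InnerProductSpace ℝ E]

/-- A subset `M` of `E` is a smooth embedded submanifold of dimension `d` (without boundary): around
each of its points there is a smooth diffeomorphism between open sets of `E` that flattens `M` to a
`d`-dimensional linear subspace. -/
def IsSmoothSubmanifold (d : ℕ) (M : Set E) : Prop :=
  ∀ p ∈ M, ∃ (Φ : OpenPartialHomeomorph E E) (W : Submodule ℝ E),
    p ∈ Φ.source ∧ ContDiffOn ℝ ∞ Φ Φ.source ∧ ContDiffOn ℝ ∞ Φ.symm Φ.target ∧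
      Module.finrank ℝ W = d ∧ ∀ q ∈ Φ.source, (q ∈ M ↔ Φ q ∈ W)

/-- A map defined on a subset `M` of `E` is smooth if, near each point of `M`, it is the restriction
of a smooth map on an open subset of `E`. Values of `V` off `M` are irrelevant. -/
def IsSmoothOn (M : Set E) (V : E → E) : Prop :=
  ∀ p ∈ M, ∃ (U : Set E) (F : E → E),
    IsOpen U ∧ p ∈ U ∧ ContDiffOn ℝ ∞ F U ∧ ∀ q ∈ U ∩ M, V q = F q

/-- The tangent space of `M` at `p`, as a linear subspace of `E`. (At a boundary point of a manifold
with boundary this is the whole tangent space, since the span is taken.) -/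
def tangentSpace (M : Set E) (p : E) : Submodule ℝ E :=
  Submodule.span ℝ (tangentConeAt ℝ M p)

variable [FiniteDimensional ℝ E]

/-- Orthogonal projection of `E` onto `T_p M`. -/
def tanProj (M : Set E) (p : E) : E →L[ℝ] E := (tangentSpace M p).starProjection

/-- Orthogonal projection of `E` onto the normal space `N_p M`. -/
def norProj (M : Set E) (p : E) : E →L[ℝ] E := (tangentSpace M p)ᗮ.starProjection

/-- The Levi-Civita connection `∇_X Y` at `p` of the induced metric: the tangential part of the
directional derivative (`X ∈ T_p M`, `Y` a tangent field on `M`). The derivative within `M` in a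
direction tangent to `M` depends only on the values of the field on `M`. -/
def tanConn (M : Set E) (Y : E → E) (p X : E) : E := tanProj M p (fderivWithin ℝ Y M p X)

/-- The normal connection `∇^⊥_X V` at `p` (`X ∈ T_p M`, `V` a normal field on `M`). -/
def norConn (M : Set E) (V : E → E) (p X : E) : E := norProj M p (fderivWithin ℝ V M p X)

/-- The tangent field `q ↦ (projection of Y to T_q M)`; for `Y ∈ T_p M` it extends `Y`. -/
def tanExt (M : Set E) (Y : E) : E → E := fun q => tanProj M q Y

/-- The second fundamental form `A(X, Y) = (D_X Y)^⊥` at `p`, for `X, Y ∈ T_p M`. -/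
def secondFF (M : Set E) (p X Y : E) : E := norProj M p (fderivWithin ℝ (tanExt M Y) M p X)

/-- An orthonormal basis of `T_p M`. All traces below are independent of this choice. -/
def tanBasis (M : Set E) (p : E) :
    OrthonormalBasis (Fin (Module.finrank ℝ (tangentSpace M p))) ℝ (tangentSpace M p) :=
  stdOrthonormalBasis ℝ (tangentSpace M p)

/-- The mean curvature vector, the trace of the second fundamental form. -/
def meanCurvature (M : Set E) (p : E) : E :=
  ∑ i, secondFF M p (tanBasis M p i) (tanBasis M p i)

/-- The second covariant derivative of a normal field,
`∇^⊥_X ∇^⊥_Y V - ∇^⊥_{∇_X Y} V` at `p`. This is tensorial in `X, Y ∈ T_p M`, so `Y` may be extended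
to any tangent field. -/
def norHessian (M : Set E) (V : E → E) (p X Y : E) : E :=
  norConn M (fun q => norConn M V q (tanExt M Y q)) p X
    - norConn M V p (tanConn M (tanExt M Y) p X)

/-- The normal Laplacian `Δ^⊥ V`, the trace of the second covariant derivative. -/
def norLaplacian (M : Set E) (V : E → E) (p : E) : E :=
  ∑ i, norHessian M V p (tanBasis M p i) (tanBasis M p i)

/-- Simons' operator `Ã(v) = ∑ i j, ⟨A(E_i, E_j), v⟩ A(E_i, E_j)` on `N_p M`. -/
def simonsOp (M : Set E) (p v : E) : E :=
  ∑ i, ∑ j, inner ℝ (secondFF M p (tanBasis M p i) (tanBasis M p j)) v •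
    secondFF M p (tanBasis M p i) (tanBasis M p j)

/-- The stability (Jacobi) operator `L V = Δ^⊥ V + Ã(V)`. -/
def jacobiOp (M : Set E) (V : E → E) (p : E) : E :=
  norLaplacian M V p + simonsOp M p (V p)

/-- `|∇^⊥ V|²` at `p`. -/
def norConnNormSq (M : Set E) (V : E → E) (p : E) : ℝ :=
  ∑ i, ‖norConn M V p (tanBasis M p i)‖ ^ 2

/-- `V ∈ Γ(NM)`: a smooth normal vector field on `M`. -/
def IsNormalField (M : Set E) (V : E → E) : Prop :=
  IsSmoothOn M V ∧ ∀ p ∈ M, V p ∈ (tangentSpace M p)ᗮ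

/-- `V` is a Jacobi field on `M`: a smooth normal field with `L V = 0`. -/
def IsJacobiField (M : Set E) (V : E → E) : Prop :=
  IsNormalField M V ∧ ∀ p ∈ M, jacobiOp M V p = 0

/-- `C` is a `d`-dimensional minimal cone (with its vertex `0` removed): the cone
`{r σ : σ ∈ S, r > 0}` over a smooth compact embedded `(d-1)`-dimensional submanifold `S` of the unit
sphere, whose mean curvature vanishes. -/
def IsMinimalCone (d : ℕ) (C : Set E) : Prop :=
  (∃ (S : Set E) (l : ℕ), l + 1 = d ∧ S ⊆ Metric.sphere 0 1 ∧ IsCompact S ∧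
    IsSmoothSubmanifold l S ∧ C = {x | ∃ σ ∈ S, ∃ r : ℝ, 0 < r ∧ x = r • σ}) ∧
  ∀ p ∈ C, meanCurvature C p = 0

/-- A vector field along the cone `C` is homogeneous of degree `a`. -/
def IsHomogeneousField (C : Set E) (a : ℝ) (V : E → E) : Prop :=
  ∀ p ∈ C, ∀ t : ℝ, 0 < t → V (t • p) = t ^ a • V p

/-- `C₁`, the intersection of the cone with the closed unit ball (the vertex is not in `C`). -/
def truncation (C : Set E) : Set E := C ∩ Metric.closedBall 0 1

/-- `V ∈ Γ_c(NC₁)` and `V = 0` on the link: a smooth normal field on `C₁`, with compact support in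
`C₁` (hence zero near the vertex), vanishing on the boundary `C ∩ sphere 0 1`. -/
def IsTestField (C : Set E) (V : E → E) : Prop :=
  IsNormalField (truncation C) V ∧
  (∃ K ⊆ truncation C, IsCompact K ∧ ∀ p ∈ truncation C \ K, V p = 0) ∧
  ∀ p ∈ C ∩ Metric.sphere 0 1, V p = 0

variable [MeasurableSpace E] [BorelSpace E]

/-- Integration over a `d`-dimensional subset with respect to `d`-dimensional Hausdorff measure,
normalised to agree with Lebesgue measure on `d`-dimensional subspaces. -/
def areaIntegral (d : ℕ) (M : Set E) (g : E → ℝ) : ℝ :=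
  ∫ p in M, g p ∂(MeasureTheory.Measure.euclideanHausdorffMeasure d)

/-- The second variation of area `Q(V, V) = ∫ (|∇^⊥ V|² - ⟨V, Ã(V)⟩)`. -/
def secondVariation (d : ℕ) (M : Set E) (V : E → E) : ℝ :=
  areaIntegral d M (fun p => norConnNormSq M V p - inner ℝ (V p) (simonsOp M p (V p)))

/-- Stability of a `d`-dimensional minimal cone. -/
def IsStable (d : ℕ) (C : Set E) : Prop :=
  ∀ V : E → E, IsTestField C V → 0 ≤ secondVariation d (truncation C) V

/-- The weighted Rayleigh quotient `-∫ ⟨V, L V⟩ / ∫ |V|² r⁻²` over `C₁`. -/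
def rayleighQuotient (d : ℕ) (C : Set E) (V : E → E) : ℝ :=
  -(areaIntegral d (truncation C) fun p => inner ℝ (V p) (jacobiOp (truncation C) V p)) /
    areaIntegral d (truncation C) fun p => ‖V p‖ ^ 2 * (‖p‖ ^ 2)⁻¹

/-- Strict stability of a `d`-dimensional minimal cone: the infimum (in the extended reals) of the
weighted Rayleigh quotient over nonzero test fields is positive. -/
def IsStrictlyStable (d : ℕ) (C : Set E) : Prop :=
  0 < ⨅ V ∈ {V : E → E | IsTestField C V ∧ ∃ p ∈ truncation C, V p ≠ 0},
    (rayleighQuotient d C V : EReal)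

end ConeGeometry

/-- The complex cone `f⁻¹(0)` in `ℂ^N`, with its vertex removed. -/
def complexCone {N : ℕ} (f : MvPolynomial (Fin N) ℂ) : Set (EuclideanSpace ℂ (Fin N)) :=
  {z | z ≠ 0 ∧ MvPolynomial.eval z.ofLp f = 0}

/-- The real part `u = Re f`, as a real function on `ℂ^N`. -/
def polyRe {N : ℕ} (f : MvPolynomial (Fin N) ℂ) : EuclideanSpace ℂ (Fin N) → ℝ :=
  fun z => (MvPolynomial.eval z.ofLp f).re

/-- The vector field `|∇u|⁻² ∇u` with `u = Re f`; the gradient is taken with respect to the real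
Euclidean inner product `Re ∑ j, z_j conj(w_j)` on `ℂ^N`. -/
def gradField {N : ℕ} (f : MvPolynomial (Fin N) ℂ) :
    EuclideanSpace ℂ (Fin N) → EuclideanSpace ℂ (Fin N) :=
  fun z => (‖gradient (polyRe f) z‖ ^ 2)⁻¹ • gradient (polyRe f) z

end

/-!
Write `F` for the function on `ℂ^N` defined by `f`, `J = ∇u / |∇u|²` for `u = Re F`, and `θ(v) =
D²F(v, J)`. The field `J` is a complex frame of the normal bundle of the cone, with `dF(J) = 1`.
Hence the second fundamental form is `-D²F(X, Y) J`, and the normal derivative of a section `Φ J`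
is `(dΦ - Φ θ) ⊗ J`. The forms occurring here are complex bilinear or complex linear on the complex
space `T = ker dF`, so their traces over a basis of pairs `e, i e` vanish. This gives minimality,
and together with the identity `IsRegular.sum_hess_fderiv_normalFrame` it gives the formula `L(Φ J)
= (tr D²Φ - 2 tr (dΦ ⊗ θ)) J` of `IsRegular.jacobiOp_eq`. With `Φ = 1` the field `J` is a Jacobi
field; its homogeneity `1 - n` is that of `1 / dF`. The link is flattened by the chart
`sphericalFlattening`, whose normal coordinates are `F` and `(|z|² - 1) / 2`.

*Stability.* A test field is `Φ J` for a smooth `Φ` on `ℂ^N`. Put `α = dΦ - Φ θ`, and let `X` be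
the tangent field dual to `v ↦ Im (conj Φ · α(i v))` (`rotField`). Its ambient divergence on the
cone is `∑ 2 Im (conj α(e) · α(i e))`, summed over a complex basis of `T`, minus the curvature term
of the second variation (`IsRegular.divergence_rotField`). Since `2 Im (conj a · b) ≤ |a|² + |b|²`,
the integrand of the second variation is at least `|J|² div X`, and it remains to see that `∫ |J|²
div X = 0` over the cone. The measure `|J|² dℋ` on the cone is the limit of Lebesgue measure on the
tubes `|F| < ε`, divided by a multiple of `ε²` (`IsRegular.tendsto_tubeIntegral`). This instance of
the coarea formula is proved by charts whose derivative at a point is the identity: they are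
bi-Lipschitz with constants close to `1`, hence change every Hausdorff measure by a factor close to
`1`, and reduce the claim to a hyperplane. As `X` is tangent to all level sets of `F`, integration
by parts in `ℂ^N` gives `∫ |J|² div X = 0` for compactly supported `X`
(`IsRegular.setIntegral_divergence_eq_zero`). The test field vanishes on the link, and `X` is
quadratic in `Φ`, so `X` can be cut off where `Φ` is small with uniformly bounded divergence, and
dominated convergence applies.

*Failure of strict stability.* For `Φ = k(log |z|²)` the formula for `L` reduces, by Euler's
relation `θ(z) = n - 1`, to `L(Φ J) = 4 k''(log |z|²) |z|⁻² J`. The measure `|J|² |z|⁻² dℋ` on the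
cone is invariant under dilations, so its image under `log |z|²` is a multiple of Lebesgue measure
(`IsHomogeneousFun.exists_radialMeasure_eq`). The Rayleigh quotient of `Φ J` is therefore `-4 ∫ k
k'' / ∫ k²`, which tends to zero when `k` is a bump function stretched along the negative half
line.
-/

noncomputable section

/-! ### Complex hyperplanes in `ℂ^N` as real Euclidean subspaces -/

namespace ComplexCone

/-- `ℂ^N` with its Hermitian norm; its real inner product is the Euclidean one of `ℝ^{2N}`. -/
abbrev CSpace (N : ℕ) := EuclideanSpace ℂ (Fin N)

variable {N : ℕ}

lemma inner_real_eq_re (x y : CSpace N) : inner ℝ x y = (inner ℂ x y).re := by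
  simp [PiLp.inner_apply]

lemma inner_smul_smul (c : ℂ) (x y : CSpace N) :
    inner ℝ (c • x) (c • y) = ‖c‖ ^ 2 * inner ℝ x y := by
  rw [inner_real_eq_re, inner_real_eq_re, inner_smul_left, inner_smul_right, ← mul_assoc,
    ← Complex.normSq_eq_conj_mul_self, Complex.re_ofReal_mul, Complex.normSq_eq_norm_sq]

lemma inner_smul_I_right (x y : CSpace N) :
    inner ℝ x (Complex.I • y) = - (inner ℂ x y).im := by
  rw [inner_real_eq_re, inner_smul_right]; simp

lemma real_smul_eq (r : ℝ) (x : CSpace N) : r • x = (r : ℂ) • x := by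
  rw [Complex.coe_smul]

/-- The Riesz representative of a real linear form, as a real linear map of the form. -/
def rieszReal : (CSpace N →L[ℝ] ℝ) →L[ℝ] CSpace N :=
  LinearMap.mkContinuous
    { toFun := fun l => (InnerProductSpace.toDual ℝ (CSpace N)).symm l
      map_add' := fun l m => map_add _ l m
      map_smul' := fun r l => by simp } 1 (fun l => by simp)

lemma inner_rieszReal (l : CSpace N →L[ℝ] ℝ) (w : CSpace N) :
    inner ℝ (rieszReal l) w = l w :=
  InnerProductSpace.toDual_symm_apply

/-- The real Riesz representative of the real part of a complex linear form. It depends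
conjugate linearly on the form; as a real linear map it can be differentiated. -/
def rieszRe : (CSpace N →L[ℂ] ℂ) →L[ℝ] CSpace N :=
  rieszReal ∘L (ContinuousLinearMap.compL ℝ (CSpace N) ℂ ℝ Complex.reCLM) ∘L
    (ContinuousLinearMap.restrictScalarsL ℂ (CSpace N) ℂ ℝ ℝ)

lemma inner_rieszRe (l : CSpace N →L[ℂ] ℂ) (w : CSpace N) :
    inner ℝ (rieszRe l) w = (l w).re := by
  simp [rieszRe, inner_rieszReal]

/-- A complex linear form applied to a representative is Hermitian in the two forms. -/
lemma apply_rieszRe (l m : CSpace N →L[ℂ] ℂ) :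
    l (rieszRe m) = (starRingEnd ℂ) (m (rieszRe l)) := by
  apply Complex.ext
  · rw [← inner_rieszRe, real_inner_comm, inner_rieszRe, Complex.conj_re]
  · have h1 : (l (rieszRe m)).im = - (l (Complex.I • rieszRe m)).re := by simp
    have h2 : (m (rieszRe l)).im = - (m (Complex.I • rieszRe l)).re := by simp
    rw [Complex.conj_im, h1, h2, ← inner_rieszRe, ← inner_rieszRe, inner_smul_I_right,
      inner_smul_I_right, ← inner_conj_symm (rieszRe l) (rieszRe m), Complex.conj_im]

lemma apply_rieszRe_self (l : CSpace N →L[ℂ] ℂ) :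
    l (rieszRe l) = ((‖rieszRe l‖ ^ 2 : ℝ) : ℂ) := by
  have h := (Complex.conj_eq_iff_re).1 (apply_rieszRe l l).symm
  rw [← h, ← inner_rieszRe, real_inner_self_eq_norm_sq]

lemma rieszRe_ne_zero {l : CSpace N →L[ℂ] ℂ} (hl : l ≠ 0) : rieszRe l ≠ 0 := by
  intro h
  apply hl
  ext w
  apply Complex.ext
  · rw [← inner_rieszRe, h]; simp
  · have h1 : (l w).im = - (l (Complex.I • w)).re := by simp
    rw [h1, ← inner_rieszRe, h]; simp

/-- The vector orthogonal to the kernel of `l` on which `l` takes the value `1`. -/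
def dualVec (l : CSpace N →L[ℂ] ℂ) : CSpace N := (‖rieszRe l‖ ^ 2)⁻¹ • rieszRe l

lemma apply_dualVec {l : CSpace N →L[ℂ] ℂ} (hl : l ≠ 0) : l (dualVec l) = 1 := by
  have h0 : (‖rieszRe l‖ ^ 2 : ℝ) ≠ 0 := by
    have := norm_ne_zero_iff.2 (rieszRe_ne_zero hl); positivity
  rw [dualVec, real_smul_eq, map_smul, apply_rieszRe_self, smul_eq_mul, ← Complex.ofReal_mul,
    inv_mul_cancel₀ h0, Complex.ofReal_one]

lemma norm_sq_dualVec (l : CSpace N →L[ℂ] ℂ) :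
    ‖dualVec l‖ ^ 2 = (‖rieszRe l‖ ^ 2)⁻¹ := by
  by_cases h0 : ‖rieszRe l‖ = 0
  · simp [dualVec, h0]
  · rw [dualVec, norm_smul, mul_pow, norm_inv, norm_pow, norm_norm]
    field_simp

lemma dualVec_ne_zero {l : CSpace N →L[ℂ] ℂ} (hl : l ≠ 0) : dualVec l ≠ 0 := by
  intro h
  simpa [h] using apply_dualVec hl

lemma norm_sq_dualVec_pos {l : CSpace N →L[ℂ] ℂ} (hl : l ≠ 0) : 0 < ‖dualVec l‖ ^ 2 := by
  have := norm_pos_iff.2 (dualVec_ne_zero hl)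
  positivity

lemma rieszRe_eq_smul_dualVec {l : CSpace N →L[ℂ] ℂ} (hl : l ≠ 0) :
    rieszRe l = (‖dualVec l‖ ^ 2)⁻¹ • dualVec l := by
  have h0 : (‖rieszRe l‖ ^ 2 : ℝ) ≠ 0 := by
    have := norm_ne_zero_iff.2 (rieszRe_ne_zero hl); positivity
  rw [norm_sq_dualVec, inv_inv, dualVec, smul_smul, mul_inv_cancel₀ h0, one_smul]

lemma inner_smul_dualVec (l : CSpace N →L[ℂ] ℂ) (c : ℂ) (w : CSpace N) :
    inner ℝ (c • dualVec l) w = ‖dualVec l‖ ^ 2 * ((starRingEnd ℂ) c * l w).re := by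
  have h1 : inner ℂ (rieszRe l) w = l w := by
    apply Complex.ext
    · rw [← inner_real_eq_re, inner_rieszRe]
    · have := inner_smul_I_right (rieszRe l) w
      rw [inner_rieszRe] at this
      have h2 : (l (Complex.I • w)).re = - (l w).im := by simp
      linarith
  rw [inner_real_eq_re, inner_smul_left, dualVec, real_smul_eq, inner_smul_left, h1,
    Complex.conj_ofReal, ← real_smul_eq, ← dualVec, norm_sq_dualVec]
  rw [← Complex.re_ofReal_mul]
  congr 1
  ring

/-- The kernel of a complex linear form, as a real subspace. -/
def kerReal (l : CSpace N →L[ℂ] ℂ) : Submodule ℝ (CSpace N) :=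
  (LinearMap.ker (l : CSpace N →ₗ[ℂ] ℂ)).restrictScalars ℝ

@[simp] lemma mem_kerReal {l : CSpace N →L[ℂ] ℂ} {w : CSpace N} : w ∈ kerReal l ↔ l w = 0 := by
  simp [kerReal]

lemma smul_dualVec_mem_orthogonal (l : CSpace N →L[ℂ] ℂ) (c : ℂ) :
    c • dualVec l ∈ (kerReal l)ᗮ := by
  rw [Submodule.mem_orthogonal']
  intro u hu
  rw [inner_smul_dualVec, mem_kerReal.1 hu]
  simp

lemma sub_smul_dualVec_mem {l : CSpace N →L[ℂ] ℂ} (hl : l ≠ 0) (w : CSpace N) :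
    w - l w • dualVec l ∈ kerReal l := by
  simp [apply_dualVec hl]

lemma starProjection_kerReal {l : CSpace N →L[ℂ] ℂ} (hl : l ≠ 0) (w : CSpace N) :
    (kerReal l).starProjection w = w - l w • dualVec l :=
  Submodule.eq_starProjection_of_mem_orthogonal' (sub_smul_dualVec_mem hl w)
    (smul_dualVec_mem_orthogonal l (l w)) (by simp)

lemma starProjection_kerReal_orthogonal {l : CSpace N →L[ℂ] ℂ} (hl : l ≠ 0) (w : CSpace N) :
    (kerReal l)ᗮ.starProjection w = l w • dualVec l := by
  rw [Submodule.starProjection_orthogonal]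
  simp [starProjection_kerReal hl]

lemma mem_kerReal_orthogonal_iff {l : CSpace N →L[ℂ] ℂ} (hl : l ≠ 0) {w : CSpace N} :
    w ∈ (kerReal l)ᗮ ↔ w = l w • dualVec l := by
  constructor
  · intro h
    rw [← starProjection_kerReal_orthogonal hl, Submodule.starProjection_eq_self_iff.2 h]
  · intro h
    rw [h]
    exact smul_dualVec_mem_orthogonal _ _

/-- The kernel of a complex linear form has a real orthonormal basis consisting of pairs
`e, i e`. -/
lemma exists_complex_orthonormalBasis (l : CSpace N →L[ℂ] ℂ) :
    ∃ (m : ℕ) (c : OrthonormalBasis (Fin m ⊕ Fin m) ℝ (kerReal l)),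
      ∀ k, (c (Sum.inr k) : CSpace N) = Complex.I • (c (Sum.inl k) : CSpace N) := by
  set S := LinearMap.ker (l : CSpace N →ₗ[ℂ] ℂ)
  let b := stdOrthonormalBasis ℂ S
  let v : Fin (Module.finrank ℂ S) ⊕ Fin (Module.finrank ℂ S) → kerReal l :=
    Sum.elim (fun k => ⟨(b k : CSpace N), (b k).2⟩)
      (fun k => ⟨Complex.I • (b k : CSpace N), S.smul_mem _ (b k).2⟩)
  have hb : ∀ j k, inner ℂ (b j : CSpace N) (b k : CSpace N) = if j = k then 1 else 0 := by
    intro j k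
    exact (orthonormal_iff_ite.1 b.orthonormal) j k
  have hv : Orthonormal ℝ v := by
    rw [orthonormal_iff_ite]
    rintro (j | j) (k | k)
    · have : inner ℝ (v (.inl j)) (v (.inl k)) = inner ℝ (b j : CSpace N) (b k : CSpace N) := rfl
      rw [this, inner_real_eq_re, hb]
      by_cases h : j = k <;> simp [h]
    · have : inner ℝ (v (.inl j)) (v (.inr k))
        = inner ℝ (b j : CSpace N) (Complex.I • (b k : CSpace N)) := rfl
      rw [this, inner_smul_I_right, hb]
      by_cases h : j = k <;> simp [h]
    · have : inner ℝ (v (.inr j)) (v (.inl k))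
        = inner ℝ (Complex.I • (b j : CSpace N)) (b k : CSpace N) := rfl
      rw [this, real_inner_comm, inner_smul_I_right, hb]
      by_cases h : k = j <;> simp [h]
    · have : inner ℝ (v (.inr j)) (v (.inr k))
        = inner ℝ (Complex.I • (b j : CSpace N)) (Complex.I • (b k : CSpace N)) := rfl
      rw [this, inner_smul_smul, inner_real_eq_re, hb]
      by_cases h : j = k <;> simp [h]
  have hspan : ⊤ ≤ Submodule.span ℝ (Set.range v) := by
    rintro ⟨w, hw⟩ -
    have hrepr : (⟨w, hw⟩ : kerReal l)
        = ∑ k, ((b.repr ⟨w, hw⟩ k).re • v (.inl k) + (b.repr ⟨w, hw⟩ k).im • v (.inr k)) := by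
      apply Subtype.ext
      have h1 := congrArg (fun x : S => (x : CSpace N)) (b.sum_repr ⟨w, hw⟩)
      simp only [Submodule.coe_sum, Submodule.coe_add, Submodule.coe_smul] at h1 ⊢
      refine h1.symm.trans ?_
      refine Finset.sum_congr rfl fun k _ => ?_
      change _ = (b.repr ⟨w, hw⟩ k).re • (b k : CSpace N)
        + (b.repr ⟨w, hw⟩ k).im • (Complex.I • (b k : CSpace N))
      rw [real_smul_eq, real_smul_eq, smul_smul, ← add_smul, Complex.re_add_im]
    rw [hrepr]
    exact Submodule.sum_mem _ fun k _ => Submodule.add_mem _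
      (Submodule.smul_mem _ _ (Submodule.subset_span ⟨_, rfl⟩))
      (Submodule.smul_mem _ _ (Submodule.subset_span ⟨_, rfl⟩))
  refine ⟨_, OrthonormalBasis.mk hv hspan, fun k => ?_⟩
  simp only [OrthonormalBasis.coe_mk]
  rfl

/-- The trace of a real bilinear map over a subspace, computed by projecting an orthonormal basis
of the whole space. -/
lemma sum_orthonormalBasis_eq_sum_starProjection {E V : Type*} [NormedAddCommGroup E]
    [InnerProductSpace ℝ E] [FiniteDimensional ℝ E] [AddCommGroup V] [Module ℝ V]
    {W : Submodule ℝ E} {ι κ : Type*} [Fintype ι] [Fintype κ] (b : OrthonormalBasis ι ℝ E)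
    (c : OrthonormalBasis κ ℝ W) (B : E →ₗ[ℝ] E →ₗ[ℝ] V) :
    ∑ k, B (c k) (c k) = ∑ i, B (W.starProjection (b i)) (W.starProjection (b i)) := by
  have hexp : ∀ i, W.starProjection (b i) = ∑ k, inner ℝ (c k : E) (b i) • (c k : E) := by
    intro i
    rw [Submodule.starProjection_apply, ← c.sum_repr' (W.orthogonalProjectionOnto (b i))]
    simp only [Submodule.coe_sum, Submodule.coe_smul]
    refine Finset.sum_congr rfl fun k _ => ?_
    rw [Submodule.coe_inner, ← Submodule.starProjection_apply,
      ← Submodule.inner_starProjection_left_eq_right,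
      Submodule.starProjection_eq_self_iff.2 (c k).2]
  have h1 : ∀ i, B (W.starProjection (b i)) (W.starProjection (b i))
      = ∑ k, ∑ l, (inner ℝ (c k : E) (b i) * inner ℝ (b i) (c l : E)) • B (c k) (c l) := by
    intro i
    rw [hexp i]
    simp only [map_sum, map_smul, LinearMap.sum_apply, LinearMap.smul_apply, Finset.smul_sum,
      smul_smul]
    rw [Finset.sum_comm]
    refine Finset.sum_congr rfl fun k _ => Finset.sum_congr rfl fun l _ => ?_
    rw [real_inner_comm (b i) (c l : E), mul_comm]
  simp_rw [h1]
  rw [Finset.sum_comm]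
  refine Finset.sum_congr rfl fun k _ => ?_
  rw [Finset.sum_comm]
  simp_rw [← Finset.sum_smul, b.sum_inner_mul_inner, ← Submodule.coe_inner]
  classical
  simp_rw [orthonormal_iff_ite.1 c.orthonormal]
  simp

/-- The trace of a real bilinear map over a subspace does not depend on the orthonormal basis. -/
lemma sum_orthonormalBasis_eq {E V : Type*} [NormedAddCommGroup E] [InnerProductSpace ℝ E]
    [FiniteDimensional ℝ E] [AddCommGroup V] [Module ℝ V] {W : Submodule ℝ E} {ι κ : Type*}
    [Fintype ι] [Fintype κ] (b : OrthonormalBasis ι ℝ W) (c : OrthonormalBasis κ ℝ W)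
    (B : E →ₗ[ℝ] E →ₗ[ℝ] V) : ∑ i, B (b i) (b i) = ∑ k, B (c k) (c k) :=
  (sum_orthonormalBasis_eq_sum_starProjection (stdOrthonormalBasis ℝ E) b B).trans
    (sum_orthonormalBasis_eq_sum_starProjection (stdOrthonormalBasis ℝ E) c B).symm

lemma finrank_kerReal {l : CSpace N →L[ℂ] ℂ} (hl : l ≠ 0) :
    Module.finrank ℝ (kerReal l) + 2 = 2 * N := by
  have h1 : Module.finrank ℂ (LinearMap.ker (l : CSpace N →ₗ[ℂ] ℂ)) + 1 = N := by
    have h2 := LinearMap.finrank_range_add_finrank_ker (l : CSpace N →ₗ[ℂ] ℂ)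
    have h3 : LinearMap.range (l : CSpace N →ₗ[ℂ] ℂ) = ⊤ := by
      rw [LinearMap.range_eq_top]
      exact LinearMap.surjective (fun h => hl (by ext w; exact congrArg (fun g => g w) h))
    rw [h3, finrank_top] at h2
    simp at h2
    omega
  have h4 : Module.finrank ℝ (kerReal l)
      = 2 * Module.finrank ℂ (LinearMap.ker (l : CSpace N →ₗ[ℂ] ℂ)) := by
    have := finrank_real_of_complex (LinearMap.ker (l : CSpace N →ₗ[ℂ] ℂ))
    rw [← this]
    rfl
  omega

end ComplexCone

/-! ### Charts with derivative the identity, and the tangent spaces of the cone -/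

namespace ComplexCone

open Set Filter Topology
open scoped NNReal

/-- A smooth map whose derivative at `p` is the identity restricts near `p` to a diffeomorphism
which is bi-Lipschitz with a constant as close to `1` as desired. -/
lemma exists_biLipschitz_chart {E : Type*} [NormedAddCommGroup E] [NormedSpace ℝ E]
    [FiniteDimensional ℝ E] {Θ : E → E} {p : E} (hΘ : ContDiff ℝ ∞ Θ)
    (hd : HasFDerivAt Θ (ContinuousLinearMap.id ℝ E) p) {K : ℝ≥0} (hK : 1 < K)
    {O : Set E} (hO : O ∈ 𝓝 p) :
    ∃ e : OpenPartialHomeomorph E E, p ∈ e.source ∧ e.source ⊆ O ∧ (∀ x, e x = Θ x) ∧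
      ContDiffOn ℝ ∞ e.symm e.target ∧ LipschitzOnWith K e e.source ∧
      LipschitzOnWith K e.symm e.target := by
  have : CompleteSpace E := FiniteDimensional.complete ℝ E
  have hd' : HasFDerivAt Θ ((ContinuousLinearEquiv.refl ℝ E : E ≃L[ℝ] E) : E →L[ℝ] E) p := hd
  have hs : HasStrictFDerivAt Θ ((ContinuousLinearEquiv.refl ℝ E : E ≃L[ℝ] E) : E →L[ℝ] E) p :=
    hΘ.contDiffAt.hasStrictFDerivAt' hd' (by simp)
  have hK0 : (0 : ℝ) < K := by
    have : (1 : ℝ) < K := by exact_mod_cast hK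
    linarith
  have hK1 : (1 : ℝ) < K := by exact_mod_cast hK
  -- with `c = 1 - 1/K` both `1 + c` and `1 / (1 - c)` are at most `K`
  have hc : 0 < 1 - K⁻¹ := by
    rw [tsub_pos_iff_lt]
    exact inv_lt_one_of_one_lt₀ hK
  obtain ⟨s, hsn, hsa⟩ := hs.approximates_deriv_on_nhds (c := 1 - K⁻¹) (Or.inr hc)
  have hcr : ((1 - K⁻¹ : ℝ≥0) : ℝ) = 1 - (K : ℝ)⁻¹ := by
    rw [NNReal.coe_sub (inv_le_one_of_one_le₀ hK.le)]; simp
  have hopen : IsOpen {z | IsUnit (fderiv ℝ Θ z)} :=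
    Units.isOpen.preimage (hΘ.continuous_fderiv (by simp))
  have hpu : p ∈ {z | IsUnit (fderiv ℝ Θ z)} := by
    simp only [mem_ofPred_eq, hd.fderiv]
    exact isUnit_one
  let e0 := hs.toOpenPartialHomeomorph Θ
  let W := interior s ∩ interior O ∩ {z | IsUnit (fderiv ℝ Θ z)}
  have hW : IsOpen W := (isOpen_interior.inter isOpen_interior).inter hopen
  let e := e0.restrOpen W hW
  have hsrc : e.source = e0.source ∩ W := rfl
  have he : ∀ x, e x = Θ x := fun x => rfl
  have hpe : p ∈ e.source := ⟨hs.mem_toOpenPartialHomeomorph_source,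
    ⟨mem_interior_iff_mem_nhds.2 hsn, mem_interior_iff_mem_nhds.2 hO⟩, hpu⟩
  have happ : ∀ x ∈ e.source, ∀ y ∈ e.source,
      ‖Θ x - Θ y - (x - y)‖ ≤ (1 - (K : ℝ)⁻¹) * ‖x - y‖ := by
    intro x hx y hy
    have := hsa _ (interior_subset hx.2.1.1) _ (interior_subset hy.2.1.1)
    simpa [hcr] using this
  refine ⟨e, hpe, fun x hx => interior_subset hx.2.1.2, he, ?_, ?_, ?_⟩
  · intro a ha
    have hx := e.map_target ha
    obtain ⟨u, hu⟩ := hx.2.2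
    apply ContDiffAt.contDiffWithinAt
    refine e.contDiffAt_symm (f₀' := ContinuousLinearEquiv.unitsEquiv ℝ E u) ha ?_
      hΘ.contDiffAt
    have h1 : HasFDerivAt Θ (fderiv ℝ Θ (e.symm a)) (e.symm a) :=
      (hΘ.differentiable (by simp) _).hasFDerivAt
    rw [← hu] at h1
    exact h1
  · refine LipschitzOnWith.of_dist_le_mul fun x hx y hy => ?_
    rw [dist_eq_norm, dist_eq_norm, he, he]
    have h1 := happ x hx y hy
    have h2 : ‖Θ x - Θ y‖ ≤ ‖Θ x - Θ y - (x - y)‖ + ‖x - y‖ := by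
      simpa using norm_add_le (Θ x - Θ y - (x - y)) (x - y)
    have h3 : 1 + (1 - (K : ℝ)⁻¹) ≤ K := by
      have h4 : (K : ℝ)⁻¹ * K = 1 := inv_mul_cancel₀ hK0.ne'
      have h5 : 0 < (K : ℝ)⁻¹ := inv_pos.2 hK0
      nlinarith [sq_nonneg ((K : ℝ) - 1)]
    nlinarith [norm_nonneg (x - y)]
  · refine LipschitzOnWith.of_dist_le_mul fun a ha b hb => ?_
    rw [dist_eq_norm, dist_eq_norm]
    have h1 := happ _ (e.map_target ha) _ (e.map_target hb)
    rw [← he, ← he, e.right_inv ha, e.right_inv hb] at h1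
    have h2 : ‖e.symm a - e.symm b‖ ≤ ‖a - b - (e.symm a - e.symm b)‖ + ‖a - b‖ := by
      have := norm_sub_le (a - b) (a - b - (e.symm a - e.symm b))
      simp only [sub_sub_cancel] at this
      linarith
    have h3 : (K : ℝ)⁻¹ * ‖e.symm a - e.symm b‖ ≤ ‖a - b‖ := by nlinarith
    rwa [inv_mul_le_iff₀ hK0] at h3

variable {N : ℕ}

/-- The zero set of a function on `ℂ^N`, with the origin removed. -/
def zeroCone (F : CSpace N → ℂ) : Set (CSpace N) := {z | z ≠ 0 ∧ F z = 0}

/-- The normal field `∇u / |∇u|²` for `u = Re F`, defined wherever `dF ≠ 0`: it is orthogonal to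
the level set of `F`, and `dF` takes the value `1` on it. -/
def normalFrame (F : CSpace N → ℂ) (z : CSpace N) : CSpace N := dualVec (fderiv ℂ F z)

/-- A function on `ℂ^N`, holomorphic and without critical points off the origin. -/
structure IsRegular (F : CSpace N → ℂ) : Prop where
  contDiff : ContDiff ℂ ∞ F
  fderiv_ne_zero : ∀ z, z ≠ 0 → fderiv ℂ F z ≠ 0

variable {F : CSpace N → ℂ}

lemma IsRegular.hasFDerivAt (hF : IsRegular F) (z : CSpace N) :
    HasFDerivAt F ((fderiv ℂ F z).restrictScalars ℝ) z :=
  (hF.contDiff.differentiable (by simp) z).hasFDerivAt.restrictScalars ℝ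

lemma IsRegular.contDiff_real (hF : IsRegular F) : ContDiff ℝ ∞ F :=
  hF.contDiff.restrict_scalars ℝ

/-- A map of `ℂ^N`, tangent to the identity at `p`, taking the level set of `F` through `p` to the
affine tangent space at `p`. -/
def flattening (F : CSpace N → ℂ) (p z : CSpace N) : CSpace N :=
  p + ((z - p) - fderiv ℂ F p (z - p) • normalFrame F p) + (F z - F p) • normalFrame F p

lemma IsRegular.contDiff_flattening (hF : IsRegular F) (p : CSpace N) :
    ContDiff ℝ ∞ (flattening F p) := by
  have h := hF.contDiff_real
  have h2 : ContDiff ℝ ∞ (fun z => fderiv ℂ F p (z - p)) :=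
    ((fderiv ℂ F p).restrictScalars ℝ).contDiff.comp (contDiff_id.sub contDiff_const)
  unfold flattening
  exact (contDiff_const.add ((contDiff_id.sub contDiff_const).sub
    (h2.smul contDiff_const))).add ((h.sub contDiff_const).smul contDiff_const)

lemma IsRegular.hasFDerivAt_flattening (hF : IsRegular F) (p : CSpace N) :
    HasFDerivAt (flattening F p) (ContinuousLinearMap.id ℝ (CSpace N)) p := by
  have h2 : HasFDerivAt (fun z => fderiv ℂ F p (z - p)) ((fderiv ℂ F p).restrictScalars ℝ) p :=
    (((fderiv ℂ F p).restrictScalars ℝ).hasFDerivAt).comp p ((hasFDerivAt_id p).sub_const p)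
  have h3 := ((((hasFDerivAt_id p).sub_const p).sub (h2.smul_const (normalFrame F p))).const_add
    p).add (((hF.hasFDerivAt p).sub_const (F p)).smul_const (normalFrame F p))
  refine h3.congr_fderiv ?_
  ext1 v
  simp

lemma flattening_self (p : CSpace N) : flattening F p p = p := by
  simp [flattening]

/-- Along the directions normal at `p`, the flattening records the increment of `F`. -/
lemma IsRegular.fderiv_flattening_sub (hF : IsRegular F) {p : CSpace N} (hp : p ≠ 0)
    (z : CSpace N) : fderiv ℂ F p (flattening F p z - p) = F z - F p := by
  have h := apply_dualVec (hF.fderiv_ne_zero p hp)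
  simp only [flattening, normalFrame, add_assoc, add_sub_cancel_left, map_add, map_sub, map_smul, h]
  simp

variable {M U : Set (CSpace N)} {p : CSpace N}

lemma nhdsWithin_eq_of_inter_eq (hU : IsOpen U) (hM : M ∩ U = zeroCone F ∩ U) (hp : p ∈ M ∩ U) :
    𝓝[M] p = 𝓝[zeroCone F] p := by
  have h : ∀ S : Set (CSpace N), 𝓝[S ∩ U] p = 𝓝[S] p := fun S =>
    nhdsWithin_inter_of_mem' (mem_nhdsWithin_of_mem_nhds (hU.mem_nhds hp.2))
  rw [← h M, hM, h]

/-- The tangent space of the cone is the kernel of `dF`. It is computed for any set `M` agreeing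
with the cone on an open set, so as to cover the truncated cone in the open unit ball. -/
lemma IsRegular.tangentSpace_eq (hF : IsRegular F) (hU : IsOpen U)
    (hM : M ∩ U = zeroCone F ∩ U) (hp : p ∈ M ∩ U) :
    ConeGeometry.tangentSpace M p = kerReal (fderiv ℂ F p) := by
  have hpC : p ∈ zeroCone F := (hM ▸ hp : p ∈ zeroCone F ∩ U).1
  have hl := hF.fderiv_ne_zero p hpC.1
  rw [ConeGeometry.tangentSpace, tangentConeAt_congr (nhdsWithin_eq_of_inter_eq hU hM hp)]
  apply le_antisymm
  · rw [Submodule.span_le]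
    intro X hX
    -- `F` vanishes on the cone, so `dF` and `0` are both derivatives of `F` within the cone
    have h1 : HasFDerivWithinAt F ((fderiv ℂ F p).restrictScalars ℝ) (zeroCone F) p :=
      (hF.hasFDerivAt p).hasFDerivWithinAt
    have h2 : HasFDerivWithinAt F (0 : CSpace N →L[ℝ] ℂ) (zeroCone F) p :=
      (hasFDerivWithinAt_const (0 : ℂ) p _).congr (fun y hy => hy.2) hpC.2
    simpa using h1.unique_on h2 hX
  · intro X hX
    apply Submodule.subset_span
    obtain ⟨e, hpe, hsub, he, hsymm, -, -⟩ := exists_biLipschitz_chart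
      (hF.contDiff_flattening p) (hF.hasFDerivAt_flattening p) (K := 2) (by norm_num)
      (isOpen_ne.mem_nhds hpC.1)
    have hep : e p = p := (he p).trans (flattening_self p)
    have hpt : p ∈ e.target := hep ▸ e.map_source hpe
    have hsp : e.symm p = p := by
      have := e.left_inv hpe
      rwa [hep] at this
    -- the inverse chart maps the affine tangent space into the cone
    let κ : kerReal (fderiv ℂ F p) → CSpace N := fun t => e.symm (p + t)
    have hκ : HasFDerivAt κ (kerReal (fderiv ℂ F p)).subtypeL 0 := by
      have h1 : HasFDerivAt e.symm (ContinuousLinearMap.id ℝ (CSpace N)) p := by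
        have h2 : HasFDerivAt e ((ContinuousLinearEquiv.refl ℝ (CSpace N) :
            CSpace N ≃L[ℝ] CSpace N) : CSpace N →L[ℝ] CSpace N) (e.symm p) := by
          rw [hsp]
          exact (hF.hasFDerivAt_flattening p).congr_of_eventuallyEq
            (Eventually.of_forall he)
        exact e.hasFDerivAt_symm hpt h2
      have h3 : HasFDerivAt (fun t : kerReal (fderiv ℂ F p) => p + (t : CSpace N))
          (kerReal (fderiv ℂ F p)).subtypeL 0 :=
        ((kerReal (fderiv ℂ F p)).subtypeL.hasFDerivAt).const_add p
      have h4 : HasFDerivAt e.symm (ContinuousLinearMap.id ℝ (CSpace N))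
          (p + ((0 : kerReal (fderiv ℂ F p)) : CSpace N)) := by simpa using h1
      exact h4.comp (0 : kerReal (fderiv ℂ F p)) h3
    let O : Set (kerReal (fderiv ℂ F p)) := {t | p + (t : CSpace N) ∈ e.target}
    have hO : O ∈ 𝓝 (0 : kerReal (fderiv ℂ F p)) := by
      have hc : Continuous (fun t : kerReal (fderiv ℂ F p) => p + (t : CSpace N)) := by fun_prop
      refine (e.open_target.preimage hc).mem_nhds ?_
      simpa using hpt
    have h5 := (hκ.hasFDerivWithinAt (s := O)).mapsTo_tangent_cone
    have h6 := h5 (x := ⟨X, hX⟩) (by rw [tangentConeAt_of_mem_nhds hO]; trivial)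
    have h7 : κ 0 = p := by simp [κ, hsp]
    rw [h7] at h6
    refine tangentConeAt_mono ?_ h6
    rintro _ ⟨t, ht, rfl⟩
    refine ⟨hsub (e.map_target ht), ?_⟩
    have h8 := hF.fderiv_flattening_sub hpC.1 (κ t)
    rw [← he, e.right_inv ht, hpC.2] at h8
    simpa using h8.symm.trans (by simpa using mem_kerReal.1 t.2)

lemma IsRegular.norProj_eq (hF : IsRegular F) (hU : IsOpen U)
    (hM : M ∩ U = zeroCone F ∩ U) (hp : p ∈ M ∩ U) (w : CSpace N) :
    ConeGeometry.norProj M p w = fderiv ℂ F p w • normalFrame F p := by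
  have hpC : p ∈ zeroCone F := (hM ▸ hp : p ∈ zeroCone F ∩ U).1
  simp only [ConeGeometry.norProj, hF.tangentSpace_eq hU hM hp]
  exact starProjection_kerReal_orthogonal (hF.fderiv_ne_zero p hpC.1) w

lemma IsRegular.tanProj_eq (hF : IsRegular F) (hU : IsOpen U)
    (hM : M ∩ U = zeroCone F ∩ U) (hp : p ∈ M ∩ U) (w : CSpace N) :
    ConeGeometry.tanProj M p w = w - fderiv ℂ F p w • normalFrame F p := by
  have hpC : p ∈ zeroCone F := (hM ▸ hp : p ∈ zeroCone F ∩ U).1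
  simp only [ConeGeometry.tanProj, hF.tangentSpace_eq hU hM hp]
  exact starProjection_kerReal (hF.fderiv_ne_zero p hpC.1) w

/-- The derivative within `M` in a tangent direction can be computed from any extension. -/
lemma fderivWithin_tangent {V : Type*} [NormedAddCommGroup V] [NormedSpace ℝ V]
    {M U : Set (CSpace N)} {p X : CSpace N} (hU : IsOpen U) (hp : p ∈ M ∩ U)
    {W W' : CSpace N → V} {L : CSpace N →L[ℝ] V} (hL : HasFDerivAt W' L p)
    (heq : ∀ q ∈ M ∩ U, W q = W' q) (hX : X ∈ ConeGeometry.tangentSpace M p) :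
    fderivWithin ℝ W M p X = L X := by
  have h1 : HasFDerivWithinAt W L M p := by
    refine hL.hasFDerivWithinAt.congr_of_eventuallyEq ?_ (heq p hp)
    filter_upwards [self_mem_nhdsWithin, mem_nhdsWithin_of_mem_nhds (hU.mem_nhds hp.2)]
      with q h2 h3 using heq q ⟨h2, h3⟩
  have h2 : HasFDerivWithinAt W (fderivWithin ℝ W M p) M p :=
    h1.differentiableWithinAt.hasFDerivWithinAt
  have h3 : ConeGeometry.tangentSpace M p ≤
      LinearMap.eqLocus (fderivWithin ℝ W M p : CSpace N →ₗ[ℝ] V) (L : CSpace N →ₗ[ℝ] V) := by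
    rw [ConeGeometry.tangentSpace, Submodule.span_le]
    intro Y hY
    exact h2.unique_on h1 hY
  exact h3 hX

end ComplexCone

/-! ### Second fundamental form, normal connection and stability operator of the cone -/

namespace ComplexCone

open Set Filter Topology
open scoped NNReal

variable {N : ℕ} {F : CSpace N → ℂ} {M U : Set (CSpace N)} {p : CSpace N}

/-- The complex Hessian of a function on `ℂ^N`. -/
def hess (F : CSpace N → ℂ) (z : CSpace N) : CSpace N →L[ℂ] CSpace N →L[ℂ] ℂ :=
  fderiv ℂ (fderiv ℂ F) z

/-- The complex linear form `θ` describing the normal connection in the frame `J = normalFrame F`: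
`∇^⊥ J = -θ ⊗ J`. -/
def connForm (F : CSpace N → ℂ) (z v : CSpace N) : ℂ := hess F z v (normalFrame F z)

lemma IsRegular.hess_comm (hF : IsRegular F) (z v w : CSpace N) : hess F z v w = hess F z w v :=
  (hF.contDiff.contDiffAt.isSymmSndFDerivAt
    (by
      rw [minSmoothness_of_isRCLikeNormedField]
      exact WithTop.coe_le_coe.2 (le_top : (2 : ℕ∞) ≤ ⊤))) v w

lemma IsRegular.contDiff_fderiv (hF : IsRegular F) : ContDiff ℂ ∞ (fderiv ℂ F) :=
  hF.contDiff.fderiv_right (by simp)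

lemma IsRegular.contDiff_hess (hF : IsRegular F) : ContDiff ℂ ∞ (hess F) :=
  hF.contDiff_fderiv.fderiv_right (by simp)

lemma IsRegular.hasFDerivAt_fderiv (hF : IsRegular F) (z : CSpace N) :
    HasFDerivAt (fderiv ℂ F) ((hess F z).restrictScalars ℝ) z :=
  (hF.contDiff_fderiv.differentiable (by simp) z).hasFDerivAt.restrictScalars ℝ

lemma IsRegular.hasFDerivAt_hess (hF : IsRegular F) (z : CSpace N) :
    HasFDerivAt (hess F) ((fderiv ℂ (hess F) z).restrictScalars ℝ) z :=
  (hF.contDiff_hess.differentiable (by simp) z).hasFDerivAt.restrictScalars ℝ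

/-- The product rule for the value of a varying complex linear map at a varying vector. -/
lemma exists_hasFDerivAt_apply {E G : Type*} [NormedAddCommGroup E] [NormedSpace ℝ E]
    [NormedAddCommGroup G] [NormedSpace ℂ G]
    {c : E → CSpace N →L[ℂ] G} {c' : E →L[ℝ] CSpace N →L[ℂ] G} {u : E → CSpace N}
    {u' : E →L[ℝ] CSpace N} {x : E} (hc : HasFDerivAt c c' x) (hu : HasFDerivAt u u' x) :
    ∃ L : E →L[ℝ] G, HasFDerivAt (fun y => c y (u y)) L x ∧
      ∀ v, L v = c' v (u x) + c x (u' v) := by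
  let R := ContinuousLinearMap.restrictScalarsL ℂ (CSpace N) G ℝ ℝ
  have h1 : HasFDerivAt (fun y => R (c y)) (R ∘L c') x := R.hasFDerivAt.comp x hc
  refine ⟨_, h1.clm_apply hu, fun v => ?_⟩
  simp [R, add_comm]

lemma IsRegular.apply_normalFrame (hF : IsRegular F) (hp : p ≠ 0) :
    fderiv ℂ F p (normalFrame F p) = 1 := apply_dualVec (hF.fderiv_ne_zero p hp)

lemma IsRegular.norm_sq_normalFrame_pos (hF : IsRegular F) (hp : p ≠ 0) :
    0 < ‖normalFrame F p‖ ^ 2 := norm_sq_dualVec_pos (hF.fderiv_ne_zero p hp)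

lemma IsRegular.norm_rieszRe_sq_ne_zero (hF : IsRegular F) (hp : p ≠ 0) :
    ‖rieszRe (fderiv ℂ F p)‖ ^ 2 ≠ 0 := by
  have := norm_ne_zero_iff.2 (rieszRe_ne_zero (hF.fderiv_ne_zero p hp))
  positivity

lemma IsRegular.contDiffAt_normalFrame (hF : IsRegular F) (hp : p ≠ 0) :
    ContDiffAt ℝ ∞ (normalFrame F) p := by
  have h1 : ContDiff ℝ ∞ (fun z => rieszRe (fderiv ℂ F z)) :=
    rieszRe.contDiff.comp (hF.contDiff_fderiv.restrict_scalars ℝ)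
  have h2 : ContDiffAt ℝ ∞ (fun z => (‖rieszRe (fderiv ℂ F z)‖ ^ 2)⁻¹) p :=
    (h1.norm_sq ℝ).contDiffAt.inv (hF.norm_rieszRe_sq_ne_zero hp)
  exact h2.smul h1.contDiffAt

lemma IsRegular.hasFDerivAt_normalFrame (hF : IsRegular F) (hp : p ≠ 0) :
    HasFDerivAt (normalFrame F) (fderiv ℝ (normalFrame F) p) p :=
  ((hF.contDiffAt_normalFrame hp).differentiableAt (by simp)).hasFDerivAt

/-- The derivative of the normal frame: its second summand is complex antilinear, as the gradient
of the real part of a holomorphic function is antiholomorphic. -/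
lemma IsRegular.fderiv_normalFrame (hF : IsRegular F) (hp : p ≠ 0) (v : CSpace N) :
    fderiv ℝ (normalFrame F) p v = -(2 * (connForm F p v).re) • normalFrame F p
      + ‖normalFrame F p‖ ^ 2 • rieszRe (hess F p v) := by
  have h1 : HasFDerivAt (fun z => rieszRe (fderiv ℂ F z))
      (rieszRe ∘L (hess F p).restrictScalars ℝ) p :=
    rieszRe.hasFDerivAt.comp p (hF.hasFDerivAt_fderiv p)
  have h0 := hF.norm_rieszRe_sq_ne_zero hp
  have h2 := (hasDerivAt_inv h0).comp_hasFDerivAt p h1.norm_sq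
  have h3 : HasFDerivAt (normalFrame F) _ p := h2.smul h1
  rw [h3.fderiv]
  have h4 : (inner ℝ (rieszRe (fderiv ℂ F p)) (rieszRe (hess F p v)) : ℝ)
      = ‖rieszRe (fderiv ℂ F p)‖ ^ 2 * (connForm F p v).re := by
    have h : rieszRe (fderiv ℂ F p) = (‖rieszRe (fderiv ℂ F p)‖ ^ 2) • normalFrame F p := by
      rw [normalFrame, dualVec, smul_smul, mul_inv_cancel₀ h0, one_smul]
    rw [real_inner_comm, inner_rieszRe]
    conv_lhs => rw [h]
    rw [real_smul_eq, map_smul, smul_eq_mul, Complex.re_ofReal_mul]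
    rfl
  have h5 : normalFrame F p = (‖rieszRe (fderiv ℂ F p)‖ ^ 2)⁻¹ • rieszRe (fderiv ℂ F p) := rfl
  have h6 : ‖normalFrame F p‖ ^ 2 = (‖rieszRe (fderiv ℂ F p)‖ ^ 2)⁻¹ := norm_sq_dualVec _
  simp only [add_apply, smul_apply,
    ContinuousLinearMap.comp_apply, ContinuousLinearMap.smulRight_apply, innerSL_apply_apply,
    ContinuousLinearMap.coe_restrictScalars', h4, h6, Function.comp]
  rw [h5, add_comm, smul_smul]
  congr 2
  simp only [smul_eq_mul, nsmul_eq_mul]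
  field_simp
  simp [mul_comm]

lemma IsRegular.apply_fderiv_normalFrame (hF : IsRegular F) (hp : p ≠ 0) (v : CSpace N) :
    fderiv ℂ F p (fderiv ℝ (normalFrame F) p v) = -connForm F p v := by
  have h1 : (‖normalFrame F p‖ ^ 2 : ℝ) • fderiv ℂ F p (rieszRe (hess F p v))
      = (starRingEnd ℂ) (connForm F p v) := by
    rw [apply_rieszRe, rieszRe_eq_smul_dualVec (hF.fderiv_ne_zero p hp)]
    have h0 := (hF.norm_sq_normalFrame_pos hp).ne'
    change _ • (starRingEnd ℂ) (hess F p v ((‖normalFrame F p‖ ^ 2)⁻¹ • normalFrame F p)) = _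
    rw [real_smul_eq, map_smul, smul_eq_mul, map_mul, Complex.conj_ofReal, Complex.real_smul,
      ← mul_assoc, ← Complex.ofReal_mul, mul_inv_cancel₀ h0, Complex.ofReal_one, one_mul]
    rfl
  rw [hF.fderiv_normalFrame hp, map_add, real_smul_eq, real_smul_eq, map_smul, map_smul,
    hF.apply_normalFrame hp, smul_eq_mul, smul_eq_mul, mul_one, ← Complex.real_smul, h1]
  apply Complex.ext <;> (simp; try ring)

/-- The projection of a fixed vector to the tangent spaces of the level sets of `F`. -/
def levelProj (F : CSpace N → ℂ) (z w : CSpace N) : CSpace N :=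
  w - fderiv ℂ F z w • normalFrame F z

lemma IsRegular.fderiv_levelProj (hF : IsRegular F) (hp : p ≠ 0) (w : CSpace N) :
    fderiv ℂ F p (levelProj F p w) = 0 := by
  simp [levelProj, hF.apply_normalFrame hp]

lemma IsRegular.exists_hasFDerivAt_levelProj (hF : IsRegular F) (hp : p ≠ 0) (w : CSpace N) :
    ∃ L : CSpace N →L[ℝ] CSpace N, HasFDerivAt (fun z => levelProj F z w) L p ∧
      ∀ v, L v = -(hess F p v w • normalFrame F p
        + fderiv ℂ F p w • fderiv ℝ (normalFrame F) p v) := by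
  obtain ⟨L1, h1, h1'⟩ := exists_hasFDerivAt_apply (hF.hasFDerivAt_fderiv p)
    (hasFDerivAt_const w p)
  refine ⟨_, ((h1.smul (hF.hasFDerivAt_normalFrame hp)).const_sub w), fun v => ?_⟩
  simp [h1', add_comm]

lemma mem_cone_of_inter_eq (hM : M ∩ U = zeroCone F ∩ U) (hp : p ∈ M ∩ U) : p ∈ zeroCone F :=
  (hM ▸ hp : p ∈ zeroCone F ∩ U).1

lemma IsRegular.secondFF_eq (hF : IsRegular F) (hU : IsOpen U)
    (hM : M ∩ U = zeroCone F ∩ U) (hp : p ∈ M ∩ U) {X Y : CSpace N}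
    (hX : fderiv ℂ F p X = 0) (hY : fderiv ℂ F p Y = 0) :
    ConeGeometry.secondFF M p X Y = -(hess F p X Y) • normalFrame F p := by
  have hp0 := (mem_cone_of_inter_eq hM hp).1
  obtain ⟨L, hL, hL'⟩ := hF.exists_hasFDerivAt_levelProj hp0 Y
  rw [ConeGeometry.secondFF, hF.norProj_eq hU hM hp, fderivWithin_tangent
    (W := ConeGeometry.tanExt M Y) hU hp hL
      (fun q hq => hF.tanProj_eq hU hM hq Y) (by rw [hF.tangentSpace_eq hU hM hp]; simpa using hX),
    hL', hY]
  simp [hF.apply_normalFrame hp0]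

/-- The tangential part of the derivative of a projected tangent vector vanishes. -/
lemma IsRegular.tanConn_tanExt (hF : IsRegular F) (hU : IsOpen U)
    (hM : M ∩ U = zeroCone F ∩ U) (hp : p ∈ M ∩ U) {X Y : CSpace N}
    (hX : fderiv ℂ F p X = 0) (hY : fderiv ℂ F p Y = 0) :
    ConeGeometry.tanConn M (ConeGeometry.tanExt M Y) p X = 0 := by
  have hp0 := (mem_cone_of_inter_eq hM hp).1
  obtain ⟨L, hL, hL'⟩ := hF.exists_hasFDerivAt_levelProj hp0 Y
  rw [ConeGeometry.tanConn, hF.tanProj_eq hU hM hp, fderivWithin_tangent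
    (W := ConeGeometry.tanExt M Y) hU hp hL
      (fun q hq => hF.tanProj_eq hU hM hq Y) (by rw [hF.tangentSpace_eq hU hM hp]; simpa using hX),
    hL', hY]
  simp [hF.apply_normalFrame hp0]

lemma IsRegular.norConn_eq (hF : IsRegular F) (hU : IsOpen U)
    (hM : M ∩ U = zeroCone F ∩ U) (hp : p ∈ M ∩ U) {V W : CSpace N → CSpace N}
    {L : CSpace N →L[ℝ] CSpace N} (hL : HasFDerivAt W L p) (hV : ∀ q ∈ M ∩ U, V q = W q)
    {X : CSpace N} (hX : fderiv ℂ F p X = 0) :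
    ConeGeometry.norConn M V p X = fderiv ℂ F p (L X) • normalFrame F p := by
  rw [ConeGeometry.norConn, hF.norProj_eq hU hM hp, fderivWithin_tangent hU hp hL hV
    (by rw [hF.tangentSpace_eq hU hM hp]; simpa using hX)]

/-- The normal derivative of `Φ J` is `(dΦ - Φ θ) ⊗ J`. -/
lemma IsRegular.norConn_smul_normalFrame (hF : IsRegular F) (hU : IsOpen U)
    (hM : M ∩ U = zeroCone F ∩ U) (hp : p ∈ M ∩ U) {V : CSpace N → CSpace N} {Φ : CSpace N → ℂ}
    {Φ' : CSpace N →L[ℝ] ℂ} (hΦ : HasFDerivAt Φ Φ' p)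
    (hV : ∀ q ∈ M ∩ U, V q = Φ q • normalFrame F q) {X : CSpace N} (hX : fderiv ℂ F p X = 0) :
    ConeGeometry.norConn M V p X = (Φ' X - Φ p * connForm F p X) • normalFrame F p := by
  have hp0 := (mem_cone_of_inter_eq hM hp).1
  rw [hF.norConn_eq hU hM hp (hΦ.smul (hF.hasFDerivAt_normalFrame hp0)) hV hX]
  congr 1
  simp [hF.apply_normalFrame hp0, hF.apply_fderiv_normalFrame hp0]
  ring

end ComplexCone

/-! ### Traces over complex orthonormal bases of the tangent space -/

namespace ComplexCone

open Set Filter Topology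
open scoped NNReal

variable {N : ℕ} {F : CSpace N → ℂ} {M U : Set (CSpace N)} {p : CSpace N}

lemma sum_tanBasis_eq {V : Type*} [AddCommGroup V] [Module ℝ V] {W : Submodule ℝ (CSpace N)}
    (hW : ConeGeometry.tangentSpace M p = W) {κ : Type*} [Fintype κ] (c : OrthonormalBasis κ ℝ W)
    (B : CSpace N →ₗ[ℝ] CSpace N →ₗ[ℝ] V) :
    ∑ i, B (ConeGeometry.tanBasis M p i) (ConeGeometry.tanBasis M p i) = ∑ k, B (c k) (c k) := by
  subst hW
  exact sum_orthonormalBasis_eq _ _ B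

lemma hess_real_smul_left (r : ℝ) (z X Y : CSpace N) :
    hess F z (r • X) Y = r * hess F z X Y := by
  rw [real_smul_eq, map_smul, smul_apply, smul_eq_mul]

lemma hess_real_smul_right (r : ℝ) (z X Y : CSpace N) :
    hess F z X (r • Y) = r * hess F z X Y := by
  rw [real_smul_eq, map_smul, smul_eq_mul]

/-- The complex Hessian, restricted to real scalars. -/
def hessReal (F : CSpace N → ℂ) (z : CSpace N) : CSpace N →ₗ[ℝ] CSpace N →ₗ[ℝ] ℂ :=
  LinearMap.mk₂ ℝ (fun X Y => hess F z X Y) (by simp)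
    (by intro c m n; rw [hess_real_smul_left, Complex.real_smul])
    (by simp) (by intro c m n; rw [hess_real_smul_right, Complex.real_smul])

@[simp] lemma hessReal_apply (z X Y : CSpace N) : hessReal F z X Y = hess F z X Y := rfl

variable {m : ℕ} {l : CSpace N →L[ℂ] ℂ}

/-- An orthonormal basis of a complex hyperplane made of pairs `e, i e`. -/
def IsComplexBasis (c : OrthonormalBasis (Fin m ⊕ Fin m) ℝ (kerReal l)) : Prop :=
  ∀ k, (c (Sum.inr k) : CSpace N) = Complex.I • (c (Sum.inl k) : CSpace N)

lemma apply_basis (c : OrthonormalBasis (Fin m ⊕ Fin m) ℝ (kerReal l)) (k) :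
    l (c k : CSpace N) = 0 := mem_kerReal.1 (c k).2

variable {c : OrthonormalBasis (Fin m ⊕ Fin m) ℝ (kerReal (fderiv ℂ F p))}

/-- The squared Hermitian norm of the complex Hessian on the tangent space. -/
def hessSq (F : CSpace N → ℂ) (p : CSpace N)
    (c : OrthonormalBasis (Fin m ⊕ Fin m) ℝ (kerReal (fderiv ℂ F p))) : ℝ :=
  ∑ k, ∑ j, ‖hess F p (c (Sum.inl k)) (c (Sum.inl j))‖ ^ 2

/-- Complex bilinear forms are trace free over a complex subspace. -/
lemma sum_hess_eq_zero (hc : IsComplexBasis c) : ∑ k, hess F p (c k) (c k) = 0 := by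
  rw [Fintype.sum_sum_type, ← Finset.sum_add_distrib]
  refine Finset.sum_eq_zero fun k _ => ?_
  rw [hc k]
  simp only [map_smul, smul_apply, smul_smul, Complex.I_mul_I]
  simp

lemma IsRegular.meanCurvature_eq_zero (hF : IsRegular F) (hU : IsOpen U)
    (hM : M ∩ U = zeroCone F ∩ U) (hp : p ∈ M ∩ U) : ConeGeometry.meanCurvature M p = 0 := by
  obtain ⟨m, c, hc⟩ := exists_complex_orthonormalBasis (fderiv ℂ F p)
  have hT := hF.tangentSpace_eq hU hM hp
  have h1 : ∀ i, ConeGeometry.secondFF M p (ConeGeometry.tanBasis M p i)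
      (ConeGeometry.tanBasis M p i) = -(hessReal F p (ConeGeometry.tanBasis M p i)
        (ConeGeometry.tanBasis M p i)) • normalFrame F p := by
    intro i
    have h2 : fderiv ℂ F p (ConeGeometry.tanBasis M p i) = 0 := by
      rw [← mem_kerReal, ← hT]
      exact (ConeGeometry.tanBasis M p i).2
    rw [hF.secondFF_eq hU hM hp h2 h2]
    rfl
  rw [ConeGeometry.meanCurvature]
  simp_rw [h1]
  rw [← Finset.sum_smul, Finset.sum_neg_distrib, sum_tanBasis_eq hT c]
  simp [sum_hess_eq_zero (F := F) hc]

lemma IsRegular.simonsOp_eq (hF : IsRegular F) (hU : IsOpen U)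
    (hM : M ∩ U = zeroCone F ∩ U) (hp : p ∈ M ∩ U) (hc : IsComplexBasis c) (ψ : ℂ) :
    ConeGeometry.simonsOp M p (ψ • normalFrame F p)
      = (2 * ‖normalFrame F p‖ ^ 2 * hessSq F p c) • ψ • normalFrame F p := by
  have hT := hF.tangentSpace_eq hU hM hp
  have hE : ∀ i, fderiv ℂ F p (ConeGeometry.tanBasis M p i) = 0 := by
    intro i
    rw [← mem_kerReal, ← hT]
    exact (ConeGeometry.tanBasis M p i).2
  have hp0 := (mem_cone_of_inter_eq hM hp).1
  let J := normalFrame F p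
  -- the summands, as quadratic expressions in either basis vector
  let S : CSpace N → CSpace N → ℂ := fun X Y =>
    (((starRingEnd ℂ) (hess F p X Y) * ψ).re : ℂ) * hess F p X Y
  have hS : ∀ X Y, fderiv ℂ F p X = 0 → fderiv ℂ F p Y = 0 →
      inner ℝ (ConeGeometry.secondFF M p X Y) (ψ • J) • ConeGeometry.secondFF M p X Y
        = (‖J‖ ^ 2 : ℝ) • S X Y • J := by
    intro X Y hX hY
    rw [hF.secondFF_eq hU hM hp hX hY]
    have h1 : inner ℝ (-(hess F p X Y) • normalFrame F p) (ψ • J)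
        = ‖J‖ ^ 2 * -((starRingEnd ℂ) (hess F p X Y) * ψ).re := by
      change inner ℝ (_ • dualVec _) _ = _
      rw [inner_smul_dualVec, map_smul, hF.apply_normalFrame hp0]
      congr 1
      simp
    rw [h1, real_smul_eq, real_smul_eq, smul_smul, smul_smul]
    congr 1
    simp only [S]
    push_cast
    ring
  let B1 : CSpace N → CSpace N →ₗ[ℝ] CSpace N →ₗ[ℝ] ℂ := fun X =>
    LinearMap.mk₂ ℝ (fun Y Y' => (((starRingEnd ℂ) (hess F p X Y) * ψ).re : ℂ) * hess F p X Y')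
      (by intro a b d; simp; ring)
      (by intro a b d; simp; try ring)
      (by intro a b d; simp; ring)
      (by intro a b d; simp; try ring)
  let B2 : CSpace N → CSpace N →ₗ[ℝ] CSpace N →ₗ[ℝ] ℂ := fun Y =>
    LinearMap.mk₂ ℝ (fun X X' => (((starRingEnd ℂ) (hess F p X Y) * ψ).re : ℂ) * hess F p X' Y)
      (by intro a b d; simp; ring)
      (by intro a b d; simp; try ring)
      (by intro a b d; simp; ring)
      (by intro a b d; simp; try ring)
  have h2 : ∀ X, ∑ j, S X (ConeGeometry.tanBasis M p j) = ∑ j, S X (c j) := fun X =>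
    sum_tanBasis_eq hT c (B1 X)
  have h3 : ∀ Y, ∑ j, S (ConeGeometry.tanBasis M p j) Y = ∑ j, S (c j) Y := fun Y =>
    sum_tanBasis_eq hT c (B2 Y)
  have h4 : ∑ i, ∑ j, S (ConeGeometry.tanBasis M p i) (ConeGeometry.tanBasis M p j)
      = (2 * hessSq F p c : ℝ) * ψ := by
    simp_rw [h2]
    rw [Finset.sum_comm]
    simp_rw [h3]
    rw [Fintype.sum_sum_type, ← Finset.sum_add_distrib, hessSq, Finset.sum_comm, Finset.mul_sum,
      Complex.ofReal_sum, Finset.sum_mul]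
    refine Finset.sum_congr rfl fun j _ => ?_
    rw [Fintype.sum_sum_type, Fintype.sum_sum_type, ← Finset.sum_add_distrib,
      ← Finset.sum_add_distrib, ← Finset.sum_add_distrib, Finset.mul_sum, Complex.ofReal_sum,
      Finset.sum_mul]
    refine Finset.sum_congr rfl fun k _ => ?_
    simp only [S, hc k, hc j, map_smul, smul_apply, smul_eq_mul]
    generalize hess F p (c (Sum.inl k)) (c (Sum.inl j)) = b
    rw [← Complex.normSq_eq_norm_sq, Complex.normSq_apply]
    apply Complex.ext
    · simp
      ring
    · simp
      ring
  rw [ConeGeometry.simonsOp]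
  rw [Finset.sum_congr rfl fun i _ => Finset.sum_congr rfl fun j _ => hS _ _ (hE i) (hE j)]
  simp_rw [← Finset.smul_sum, ← Finset.sum_smul]
  rw [h4, real_smul_eq, real_smul_eq, smul_smul, smul_smul]
  congr 1
  push_cast
  ring

/-- The trace identity behind both the Jacobi equation for `J` and the stability of the cone. -/
lemma IsRegular.sum_hess_fderiv_normalFrame (hF : IsRegular F) (hp : p ≠ 0)
    (hc : IsComplexBasis c) :
    ∑ k, hess F p (c k) (fderiv ℝ (normalFrame F) p (c k))
      = (2 * ‖normalFrame F p‖ ^ 2 * hessSq F p c : ℝ) := by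
  have hl := hF.fderiv_ne_zero p hp
  have h0 := (hF.norm_sq_normalFrame_pos hp).ne'
  -- the squared length of the representative of `hess F p v`, split along the tangent space
  have h1 : ∀ v, ‖normalFrame F p‖ ^ 2 * ‖rieszRe (hess F p v)‖ ^ 2
      = ‖normalFrame F p‖ ^ 2 * ∑ j, ‖hess F p v (c (Sum.inl j))‖ ^ 2 + ‖connForm F p v‖ ^ 2 := by
    intro v
    set x := rieszRe (hess F p v)
    have h2 : ‖x‖ ^ 2 = ‖(kerReal (fderiv ℂ F p)).starProjection x‖ ^ 2
        + ‖(kerReal (fderiv ℂ F p))ᗮ.starProjection x‖ ^ 2 :=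
      Submodule.norm_sq_eq_add_norm_sq_starProjection x _
    have h3 : ‖(kerReal (fderiv ℂ F p)).starProjection x‖ ^ 2
        = ∑ j, ‖hess F p v (c (Sum.inl j))‖ ^ 2 := by
      have h4 := c.sum_sq_norm_inner_right
        ((kerReal (fderiv ℂ F p)).orthogonalProjectionOnto x)
      rw [Submodule.starProjection_apply, ← Submodule.coe_norm, ← h4, Fintype.sum_sum_type,
        ← Finset.sum_add_distrib]
      have h5 : ∀ k, inner ℝ (c k) ((kerReal (fderiv ℂ F p)).orthogonalProjectionOnto x)
          = (hess F p v (c k)).re := by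
        intro k
        rw [Submodule.inner_orthogonalProjectionOnto_eq_of_mem_left, real_inner_comm,
          inner_rieszRe]
      refine Finset.sum_congr rfl fun k _ => ?_
      rw [h5, h5, hc k, map_smul, ← Complex.normSq_eq_norm_sq, Complex.normSq_apply]
      simp
      ring
    have h6 : ‖normalFrame F p‖ ^ 2 * ‖(kerReal (fderiv ℂ F p))ᗮ.starProjection x‖ ^ 2
        = ‖connForm F p v‖ ^ 2 := by
      rw [starProjection_kerReal_orthogonal hl, apply_rieszRe, rieszRe_eq_smul_dualVec hl]
      change ‖normalFrame F p‖ ^ 2 * ‖(starRingEnd ℂ) (hess F p v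
        ((‖normalFrame F p‖ ^ 2)⁻¹ • normalFrame F p)) • normalFrame F p‖ ^ 2 = _
      rw [norm_smul, RCLike.norm_conj, real_smul_eq, map_smul, norm_smul, Complex.norm_real,
        norm_inv, norm_pow, norm_norm]
      change _ * (_ * ‖connForm F p v‖ * _) ^ 2 = _
      have h7 : ‖normalFrame F p‖ ≠ 0 := fun h => h0 (by simp [h])
      field_simp
    rw [h2, mul_add, h3, h6]
  have h7 : ∀ v, hess F p v (fderiv ℝ (normalFrame F) p v)
      = ((‖normalFrame F p‖ ^ 2 * ∑ j, ‖hess F p v (c (Sum.inl j))‖ ^ 2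
          + ‖connForm F p v‖ ^ 2 : ℝ) : ℂ) - 2 * (connForm F p v).re * connForm F p v := by
    intro v
    rw [← h1, hF.fderiv_normalFrame hp, map_add, real_smul_eq, real_smul_eq, map_smul, map_smul,
      apply_rieszRe_self]
    change _ * connForm F p v + _ = _
    simp only [smul_eq_mul]
    push_cast
    ring
  simp_rw [h7]
  rw [Fintype.sum_sum_type, ← Finset.sum_add_distrib, hessSq, Finset.mul_sum, Complex.ofReal_sum]
  refine Finset.sum_congr rfl fun k _ => ?_
  have h8 : connForm F p (c (Sum.inr k)) = Complex.I * connForm F p (c (Sum.inl k)) := by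
    simp [connForm, hc k]
  have h9 : ∀ j, ‖hess F p (c (Sum.inr k)) (c (Sum.inl j))‖
      = ‖hess F p (c (Sum.inl k)) (c (Sum.inl j))‖ := by
    intro j
    simp [hc k]
  rw [h8]
  simp_rw [h9]
  generalize ∑ j, ‖hess F p (c (Sum.inl k)) (c (Sum.inl j))‖ ^ 2 = s
  generalize connForm F p (c (Sum.inl k)) = t
  generalize ‖normalFrame F p‖ ^ 2 = h
  rw [← Complex.normSq_eq_norm_sq, ← Complex.normSq_eq_norm_sq, Complex.normSq_apply,
    Complex.normSq_apply]
  apply Complex.ext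
  · simp
    ring
  · simp
    ring

lemma IsRegular.norConnNormSq_eq (hF : IsRegular F) (hU : IsOpen U)
    (hM : M ∩ U = zeroCone F ∩ U) (hp : p ∈ M ∩ U) {V : CSpace N → CSpace N}
    {a : CSpace N →L[ℝ] ℂ} (hV : ∀ X, fderiv ℂ F p X = 0 →
      ConeGeometry.norConn M V p X = a X • normalFrame F p) :
    ConeGeometry.norConnNormSq M V p = ‖normalFrame F p‖ ^ 2 * ∑ k, ‖a (c k)‖ ^ 2 := by
  have hT := hF.tangentSpace_eq hU hM hp
  have hE : ∀ i, fderiv ℂ F p (ConeGeometry.tanBasis M p i) = 0 := by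
    intro i
    rw [← mem_kerReal, ← hT]
    exact (ConeGeometry.tanBasis M p i).2
  let B : CSpace N →ₗ[ℝ] CSpace N →ₗ[ℝ] ℝ :=
    LinearMap.mk₂ ℝ (fun X Y => inner ℝ (a X) (a Y))
      (by intro x y z; rw [map_add, inner_add_left])
      (by intro r x y; rw [map_smul, real_inner_smul_left]; rfl)
      (by intro x y z; rw [map_add, inner_add_right])
      (by intro r x y; rw [map_smul, real_inner_smul_right]; rfl)
  have h1 : ∀ X, ‖a X‖ ^ 2 = B X X := fun X => (real_inner_self_eq_norm_sq _).symm
  rw [ConeGeometry.norConnNormSq]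
  simp_rw [hV _ (hE _), norm_smul, mul_pow, h1]
  rw [← Finset.sum_mul, sum_tanBasis_eq hT c B, mul_comm]

end ComplexCone

namespace ComplexCone

open Set Filter Topology
open scoped NNReal

variable {N : ℕ} {F : CSpace N → ℂ} {M U : Set (CSpace N)} {p : CSpace N} {m : ℕ}
  {c : OrthonormalBasis (Fin m ⊕ Fin m) ℝ (kerReal (fderiv ℂ F p))}

/-- The second covariant derivative of `Φ J` at `p` in the directions `X` and `Y`, as a multiple
of `J`. -/
def hessCoeff (F Φ : CSpace N → ℂ) (p X Y : CSpace N) : ℂ :=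
  fderiv ℝ (fderiv ℝ Φ) p X Y - fderiv ℝ Φ p (hess F p X Y • normalFrame F p)
    - fderiv ℝ Φ p X * connForm F p Y - fderiv ℝ Φ p Y * connForm F p X
    - Φ p * (fderiv ℂ (hess F) p X Y (normalFrame F p)
        - hess F p X Y * connForm F p (normalFrame F p)
        + hess F p Y (fderiv ℝ (normalFrame F) p X) - connForm F p X * connForm F p Y)

lemma IsRegular.norHessian_eq (hF : IsRegular F) (hU : IsOpen U)
    (hM : M ∩ U = zeroCone F ∩ U) (hp : p ∈ M ∩ U) {V : CSpace N → CSpace N} {Φ : CSpace N → ℂ}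
    (hΦ : ∀ q ∈ M ∩ U, ContDiffAt ℝ ∞ Φ q) (hV : ∀ q ∈ M ∩ U, V q = Φ q • normalFrame F q)
    {X Y : CSpace N} (hX : fderiv ℂ F p X = 0) (hY : fderiv ℂ F p Y = 0) :
    ConeGeometry.norHessian M V p X Y = hessCoeff F Φ p X Y • normalFrame F p := by
  have hp0 := (mem_cone_of_inter_eq hM hp).1
  have hΦd : ∀ q ∈ M ∩ U, HasFDerivAt Φ (fderiv ℝ Φ q) q := fun q hq =>
    ((hΦ q hq).differentiableAt (by simp)).hasFDerivAt
  have h2 : HasFDerivAt (fderiv ℝ Φ) (fderiv ℝ (fderiv ℝ Φ) p) p :=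
    (((hΦ p hp).fderiv_right (m := ∞) (by simp)).differentiableAt (by simp)).hasFDerivAt
  obtain ⟨L, hL, hL'⟩ := hF.exists_hasFDerivAt_levelProj hp0 Y
  obtain ⟨L1, h3, h3'⟩ := exists_hasFDerivAt_apply (hF.hasFDerivAt_hess p) hL
  obtain ⟨L2, h4, h4'⟩ := exists_hasFDerivAt_apply h3 (hF.hasFDerivAt_normalFrame hp0)
  -- the first covariant derivative in the direction of the projection of `Y`
  let Ψ : CSpace N → ℂ := fun q =>
    fderiv ℝ Φ q (levelProj F q Y) - Φ q * connForm F q (levelProj F q Y)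
  have hW : ∀ q ∈ M ∩ U, ConeGeometry.norConn M V q (ConeGeometry.tanExt M Y q)
      = Ψ q • normalFrame F q := by
    intro q hq
    have h5 : ConeGeometry.tanExt M Y q = levelProj F q Y := hF.tanProj_eq hU hM hq Y
    rw [h5, hF.norConn_smul_normalFrame hU hM hq (hΦd q hq) hV
      (hF.fderiv_levelProj (mem_cone_of_inter_eq hM hq).1 Y)]
  have hΨ : HasFDerivAt Ψ _ p := (h2.clm_apply hL).sub ((hΦd p hp).mul h4)
  have hPY : levelProj F p Y = Y := by simp [levelProj, hY]
  rw [ConeGeometry.norHessian, hF.tanConn_tanExt hU hM hp hX hY,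
    hF.norConn_smul_normalFrame hU hM hp hΨ hW hX,
    hF.norConn_smul_normalFrame hU hM hp (hΦd p hp) hV (map_zero _)]
  simp only [Ψ, hPY, connForm, hessCoeff, map_zero, zero_apply, mul_zero, sub_zero, zero_smul,
    sub_apply, add_apply, ContinuousLinearMap.comp_apply, ContinuousLinearMap.flip_apply,
    smul_apply, h4', h3', hL', hY, add_zero, map_neg, ContinuousLinearMap.coe_restrictScalars',
    map_smul, smul_eq_mul, neg_apply]
  congr 1
  ring

/-- The stability operator of the cone applied to `Φ J`. The zeroth order term of the normal
Laplacian cancels against Simons' operator. -/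
lemma IsRegular.jacobiOp_eq (hF : IsRegular F) (hU : IsOpen U)
    (hM : M ∩ U = zeroCone F ∩ U) (hp : p ∈ M ∩ U) (hc : IsComplexBasis c)
    {V : CSpace N → CSpace N} {Φ : CSpace N → ℂ}
    (hΦ : ∀ q ∈ M ∩ U, ContDiffAt ℝ ∞ Φ q) (hV : ∀ q ∈ M ∩ U, V q = Φ q • normalFrame F q) :
    ConeGeometry.jacobiOp M V p = (∑ k, (fderiv ℝ (fderiv ℝ Φ) p (c k) (c k)
      - 2 * fderiv ℝ Φ p (c k) * connForm F p (c k))) • normalFrame F p := by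
  have hp0 := (mem_cone_of_inter_eq hM hp).1
  have hT := hF.tangentSpace_eq hU hM hp
  have hE : ∀ i, fderiv ℂ F p (ConeGeometry.tanBasis M p i) = 0 := by
    intro i
    rw [← mem_kerReal, ← hT]
    exact (ConeGeometry.tanBasis M p i).2
  let B : CSpace N →ₗ[ℝ] CSpace N →ₗ[ℝ] ℂ := LinearMap.mk₂ ℝ (hessCoeff F Φ p)
    (by intro x y z; simp [hessCoeff, connForm, add_smul]; ring)
    (by
      intro r x y
      have h : fderiv ℂ (hess F) p (r • x) = (r : ℂ) • fderiv ℂ (hess F) p x := by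
        rw [real_smul_eq, map_smul]
      simp only [hessCoeff, connForm, hess_real_smul_left, h, map_smul, smul_apply,
        mul_smul, Complex.coe_smul, Complex.real_smul, hess_real_smul_right, smul_eq_mul]
      ring)
    (by intro x y z; simp [hessCoeff, connForm, add_smul]; ring)
    (by
      intro r x y
      have h : fderiv ℂ (hess F) p x (r • y) = (r : ℂ) • fderiv ℂ (hess F) p x y := by
        rw [real_smul_eq, map_smul]
      simp only [hessCoeff, connForm, hess_real_smul_left, h, map_smul, smul_apply,
        mul_smul, Complex.coe_smul, Complex.real_smul, hess_real_smul_right, smul_eq_mul]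
      ring)
  have h1 : ConeGeometry.norLaplacian M V p
      = (∑ k, hessCoeff F Φ p (c k) (c k)) • normalFrame F p := by
    rw [ConeGeometry.norLaplacian,
      Finset.sum_congr rfl fun i _ => hF.norHessian_eq hU hM hp hΦ hV (hE i) (hE i),
      ← Finset.sum_smul]
    congr 1
    exact sum_tanBasis_eq hT c B
  -- the traces of complex bilinear forms vanish
  have h2 : ∑ k, (fderiv ℂ (hess F) p (c k) (c k) (normalFrame F p)) = 0 := by
    rw [Fintype.sum_sum_type, ← Finset.sum_add_distrib]
    refine Finset.sum_eq_zero fun k _ => ?_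
    rw [hc k]
    simp only [map_smul, smul_apply, smul_smul, Complex.I_mul_I]
    simp
  have h3 : ∑ k, connForm F p (c k) * connForm F p (c k) = 0 := by
    rw [Fintype.sum_sum_type, ← Finset.sum_add_distrib]
    refine Finset.sum_eq_zero fun k _ => ?_
    rw [hc k]
    simp only [connForm, map_smul, smul_apply, smul_eq_mul]
    linear_combination (hess F p (c (Sum.inl k)) (normalFrame F p)) ^ 2 * Complex.I_mul_I
  have h4 : ∑ k, fderiv ℝ Φ p (hess F p (c k) (c k) • normalFrame F p) = 0 := by
    rw [← map_sum, ← Finset.sum_smul, sum_hess_eq_zero hc, zero_smul, map_zero]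
  have h5 : ∑ k, hess F p (c k) (c k) * connForm F p (normalFrame F p) = 0 := by
    rw [← Finset.sum_mul, sum_hess_eq_zero hc, zero_mul]
  have h6 : ∑ k, hessCoeff F Φ p (c k) (c k) = ∑ k, (fderiv ℝ (fderiv ℝ Φ) p (c k) (c k)
      - 2 * fderiv ℝ Φ p (c k) * connForm F p (c k))
      - Φ p * (2 * ‖normalFrame F p‖ ^ 2 * hessSq F p c : ℝ) := by
    have h7 := hF.sum_hess_fderiv_normalFrame hp0 hc
    rw [← h7]
    have h8 : ∀ k, hessCoeff F Φ p (c k) (c k) = (fderiv ℝ (fderiv ℝ Φ) p (c k) (c k)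
      - 2 * fderiv ℝ Φ p (c k) * connForm F p (c k))
      - Φ p * hess F p (c k) (fderiv ℝ (normalFrame F) p (c k))
      - fderiv ℝ Φ p (hess F p (c k) (c k) • normalFrame F p)
      - Φ p * (fderiv ℂ (hess F) p (c k) (c k) (normalFrame F p))
      + Φ p * (hess F p (c k) (c k) * connForm F p (normalFrame F p))
      + Φ p * (connForm F p (c k) * connForm F p (c k)) := by
      intro k
      simp only [hessCoeff]
      ring
    simp_rw [h8]
    rw [Finset.sum_add_distrib, Finset.sum_add_distrib, Finset.sum_sub_distrib,
      Finset.sum_sub_distrib, Finset.sum_sub_distrib, ← Finset.mul_sum, ← Finset.mul_sum,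
      ← Finset.mul_sum, ← Finset.mul_sum, h2, h3, h4, h5]
    ring
  rw [ConeGeometry.jacobiOp, h1, h6, hV p hp, hF.simonsOp_eq hU hM hp hc, real_smul_eq, smul_smul,
    ← add_smul]
  congr 1
  ring

end ComplexCone

/-! ### Thin neighbourhoods of a hyperplane -/

namespace ComplexCone

open Set Filter Topology MeasureTheory
open scoped NNReal ENNReal

variable {N : ℕ}

/-- A Lipschitz map with constant `K` increases `d`-dimensional Hausdorff integrals by at most the
factor `K ^ d`. -/
lemma lintegral_image_le_of_lipschitzOn {E : Type*} [NormedAddCommGroup E]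
    [MeasurableSpace E] [BorelSpace E] (d : ℕ) {f : E → E} {K : ℝ≥0} {s : Set E}
    (hf : LipschitzOnWith K f s) (hs : MeasurableSet s) {g : E → ℝ≥0∞} (hg : Measurable g) :
    ∫⁻ y in f '' s, g y ∂μHE[d] ≤ (K : ℝ≥0∞) ^ d * ∫⁻ x in s, g (f x) ∂μHE[d] := by
  have hfm : AEMeasurable f ((μHE[d] : Measure E).restrict s) := hf.continuousOn.aemeasurable hs
  have h1 : ∀ t, t ⊆ s → (μHE[d] : Measure E) (f '' t) ≤ (K : ℝ≥0∞) ^ d * μHE[d] t := by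
    intro t ht
    have h2 := (hf.mono ht).hausdorffMeasure_image_le (d := (d : ℝ)) (by positivity)
    rw [Measure.euclideanHausdorffMeasure_def, Measure.smul_apply, Measure.smul_apply,
      ENNReal.smul_def, smul_eq_mul, ENNReal.smul_def, smul_eq_mul, mul_left_comm]
    rw [ENNReal.rpow_natCast] at h2
    gcongr
  have h3 : (μHE[d] : Measure E).restrict (f '' s)
      ≤ ((K : ℝ≥0∞) ^ d) • Measure.map f ((μHE[d] : Measure E).restrict s) := by
    rw [Measure.le_iff]
    intro A hA
    rw [Measure.restrict_apply hA, Measure.smul_apply, Measure.map_apply_of_aemeasurable hfm hA,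
      Measure.restrict_apply' hs, smul_eq_mul]
    refine le_trans (measure_mono ?_) (h1 _ inter_subset_right)
    rintro _ ⟨hxA, x, hx, rfl⟩
    exact ⟨x, ⟨hxA, hx⟩, rfl⟩
  calc ∫⁻ y in f '' s, g y ∂μHE[d]
      ≤ ∫⁻ y, g y ∂(((K : ℝ≥0∞) ^ d) • Measure.map f ((μHE[d] : Measure E).restrict s)) :=
        lintegral_mono' h3 le_rfl
    _ = (K : ℝ≥0∞) ^ d * ∫⁻ x in s, g (f x) ∂μHE[d] := by
        rw [lintegral_smul_measure, lintegral_map' hg.aemeasurable hfm, smul_eq_mul]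

lemma lintegral_complex_smul {b : ℝ} (hb : 0 < b) {g : ℂ → ℝ≥0∞} (hg : Measurable g) :
    ∫⁻ w, g w = ENNReal.ofReal (b ^ 2) * ∫⁻ s, g (b • s) := by
  have h1 := lintegral_map (μ := (volume : Measure ℂ)) hg (measurable_const_smul b)
  have h2 := Measure.map_addHaar_smul (volume : Measure ℂ) hb.ne'
  rw [h2, lintegral_smul_measure, Complex.finrank_real_complex, smul_eq_mul] at h1
  rw [← h1, ← mul_assoc, ← ENNReal.ofReal_mul (by positivity), abs_of_pos (by positivity),
    mul_inv_cancel₀ (by positivity), ENNReal.ofReal_one, one_mul]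

/-- Integration over `ℂ^N` in the coordinates `(t, s) ↦ p + t + a s J`, where `t` ranges over the
kernel of `l` and `J` is dual to `l`. -/
lemma lintegral_eq_lintegral_kerReal_prod {l : CSpace N →L[ℂ] ℂ} (hl : l ≠ 0) (p : CSpace N)
    {a : ℝ} (ha : 0 < a) {f : CSpace N → ℝ≥0∞} (hf : Measurable f) :
    ∫⁻ y, f y = ENNReal.ofReal (a ^ 2 * ‖dualVec l‖ ^ 2) *
      ∫⁻ x : kerReal l × ℂ, f (p + x.1 + ((a : ℂ) * x.2) • dualVec l) := by
  have hJ : 0 < ‖dualVec l‖ := norm_pos_iff.2 (dualVec_ne_zero hl)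
  set J := dualVec l
  have hfin : Module.finrank ℝ ℂ = Module.finrank ℝ (kerReal l)ᗮ := by
    have h1 := finrank_kerReal hl
    have h2 := Submodule.finrank_add_finrank_orthogonal (kerReal l)
    have h3 : Module.finrank ℝ (CSpace N) = 2 * N := by
      rw [finrank_real_of_complex, finrank_euclideanSpace, Fintype.card_fin]
    rw [Complex.finrank_real_complex]
    omega
  let j0 : ℂ →ₗᵢ[ℝ] (kerReal l)ᗮ :=
    { toFun := fun w => ⟨(((‖J‖⁻¹ : ℝ) : ℂ) * w) • J, smul_dualVec_mem_orthogonal l _⟩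
      map_add' := fun x y => by ext1; simp [mul_add, add_smul]
      map_smul' := fun r x => by
        ext1
        simp only [Complex.real_smul, RingHom.id_apply, Submodule.coe_smul]
        rw [real_smul_eq, smul_smul]
        congr 1
        ring
      norm_map' := fun w => by
        change ‖(((‖J‖⁻¹ : ℝ) : ℂ) * w) • J‖ = ‖w‖
        rw [norm_smul, norm_mul, Complex.norm_real, norm_inv, norm_norm]
        field_simp }
  let j := j0.toLinearIsometryEquiv hfin
  have h1 : MeasurePreserving ((kerReal l).measurableEquivProd p).symm volume volume := by
    have := ((kerReal l).measurePreserving_measurableEquivProd p).symm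
    rwa [InnerProductSpace.euclideanHausdorffMeasure_eq_volume] at this
  have h2 : MeasurePreserving (Prod.map (id : kerReal l → kerReal l) j) volume volume :=
    (MeasurePreserving.id volume).prod j.measurePreserving
  have h3 : ∫⁻ y, f y = ∫⁻ x : kerReal l × ℂ, f (p + x.1 + (((‖J‖⁻¹ : ℝ) : ℂ) * x.2) • J) := by
    rw [← (h1.comp h2).lintegral_comp hf]
    refine lintegral_congr fun x => ?_
    congr 1
    simp only [Function.comp, Submodule.measurableEquivProd_symm_apply, Prod.map, id, vadd_eq_add]
    rw [add_comm, ← add_assoc]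
    rfl
  have hm : ∀ b : ℝ, Measurable fun x : kerReal l × ℂ => f (p + x.1 + ((b : ℂ) * x.2) • J) := by
    intro b
    refine hf.comp (Continuous.measurable ?_)
    fun_prop
  rw [h3, Measure.volume_eq_prod, lintegral_prod _ (hm _).aemeasurable,
    lintegral_prod _ (hm a).aemeasurable, ← lintegral_const_mul _ (hm a).lintegral_prod_right']
  refine lintegral_congr fun t => ?_
  have hmt : Measurable fun w : ℂ => f (p + t + (((‖J‖⁻¹ : ℝ) : ℂ) * w) • J) :=
    (hm ‖J‖⁻¹).comp measurable_prodMk_left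
  rw [lintegral_complex_smul (b := a * ‖J‖) (by positivity) hmt, mul_pow]
  congr 1
  refine lintegral_congr fun s => ?_
  congr 3
  rw [Complex.real_smul]
  push_cast
  have : (‖J‖ : ℂ) ≠ 0 := by exact_mod_cast hJ.ne'
  field_simp

/-- A continuous cutoff function on `ℂ`, supported in the unit disc. -/
structure IsCutoff (χ : ℂ → ℝ) : Prop where
  continuous : Continuous χ
  nonneg : ∀ s, 0 ≤ χ s
  le_one : ∀ s, χ s ≤ 1
  eq_zero : ∀ s, 1 ≤ ‖s‖ → χ s = 0

/-- Integrals weighted by cutoffs concentrating on an affine complex hyperplane converge to the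
integral over the hyperplane. -/
lemma tendsto_lintegral_cutoff_hyperplane {l : CSpace N →L[ℂ] ℂ} (hl : l ≠ 0) (p : CSpace N)
    {χ : ℂ → ℝ} (hχ : IsCutoff χ) {G : CSpace N → ℝ} (hG : Continuous G)
    (hGc : HasCompactSupport G) (hG0 : ∀ y, 0 ≤ G y) :
    Tendsto (fun k : ℕ => ∫⁻ y, ENNReal.ofReal
        (((k : ℝ) + 1) ^ 2 * (χ (((k : ℝ) + 1) • l (y - p)) * G y))) atTop
      (𝓝 (ENNReal.ofReal (‖dualVec l‖ ^ 2) *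
        ((∫⁻ t : kerReal l, ENNReal.ofReal (G (p + t))) * ∫⁻ s, ENNReal.ofReal (χ s)))) := by
  set J := dualVec l with hJ
  have hχm := hχ.continuous
  have h1 : ∀ k : ℕ, ∫⁻ y, ENNReal.ofReal
        (((k : ℝ) + 1) ^ 2 * (χ (((k : ℝ) + 1) • l (y - p)) * G y))
      = ENNReal.ofReal (‖J‖ ^ 2) * ∫⁻ x : kerReal l × ℂ, ENNReal.ofReal
          (χ x.2 * G (p + x.1 + ((((k : ℝ) + 1)⁻¹ : ℝ) * x.2) • J)) := by
    intro k
    have hk : (0 : ℝ) < (k : ℝ) + 1 := by positivity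
    have hm : Continuous fun y => ENNReal.ofReal
        (((k : ℝ) + 1) ^ 2 * (χ (((k : ℝ) + 1) • l (y - p)) * G y)) :=
      ENNReal.continuous_ofReal.comp (by fun_prop)
    rw [lintegral_eq_lintegral_kerReal_prod hl p (inv_pos.2 hk) hm.measurable, mul_comm _ (‖_‖ ^ 2),
      ENNReal.ofReal_mul (by positivity), mul_assoc]
    congr 1
    rw [← lintegral_const_mul]
    · refine lintegral_congr fun x => ?_
      rw [← ENNReal.ofReal_mul (by positivity)]
      congr 1
      have h2 : l (p + x.1 + ((((k : ℝ) + 1)⁻¹ : ℝ) * x.2) • dualVec l - p)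
          = (((k : ℝ) + 1)⁻¹ : ℝ) * x.2 := by
        rw [add_assoc, add_sub_cancel_left, map_add, mem_kerReal.1 x.1.2, map_smul,
          apply_dualVec hl]
        simp
      rw [h2, Complex.real_smul, ← mul_assoc (Complex.ofReal _), ← Complex.ofReal_mul,
        mul_inv_cancel₀ hk.ne', Complex.ofReal_one, one_mul, ← mul_assoc, ← mul_pow,
        inv_mul_cancel₀ hk.ne', one_pow, one_mul]
    · refine hm.measurable.comp (Continuous.measurable ?_)
      fun_prop
  simp_rw [h1]
  have hlim : (∫⁻ t : kerReal l, ENNReal.ofReal (G (p + t))) * ∫⁻ s, ENNReal.ofReal (χ s)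
      = ∫⁻ x : kerReal l × ℂ, ENNReal.ofReal (χ x.2 * G (p + x.1)) := by
    rw [← lintegral_prod_mul (by fun_prop) (by fun_prop)]
    refine lintegral_congr fun x => ?_
    rw [← ENNReal.ofReal_mul (hG0 _), mul_comm]
  rw [hlim]
  refine ENNReal.Tendsto.const_mul ?_ (Or.inr ENNReal.ofReal_ne_top)
  obtain ⟨R, hR⟩ := hGc.isCompact.isBounded.exists_norm_le
  obtain ⟨B, hB⟩ := hGc.exists_bound_of_continuous hG
  -- all integrands live on one compact box
  let Q : Set (kerReal l × ℂ) :=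
    Metric.closedBall 0 (R + ‖p‖ + ‖J‖) ×ˢ Metric.closedBall 0 1
  have hQ : IsCompact Q := (isCompact_closedBall _ _).prod (isCompact_closedBall _ _)
  refine tendsto_lintegral_filter_of_dominated_convergence
    (bound := Q.indicator fun _ => ENNReal.ofReal B) ?_ ?_ ?_ ?_
  · exact Eventually.of_forall fun k =>
      (ENNReal.continuous_ofReal.comp (by fun_prop)).measurable
  · refine Eventually.of_forall fun k => Eventually.of_forall fun x => ?_
    have hk : (0 : ℝ) < (k : ℝ) + 1 := by positivity
    by_cases hx : x ∈ Q
    · rw [indicator_of_mem hx]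
      apply ENNReal.ofReal_le_ofReal
      have h3 := hB (p + x.1 + ((((k : ℝ) + 1)⁻¹ : ℝ) * x.2) • J)
      rw [Real.norm_of_nonneg (hG0 _)] at h3
      calc χ x.2 * G _ ≤ 1 * G _ := by gcongr; exacts [hG0 _, hχ.le_one _]
        _ ≤ B := by rw [one_mul]; exact h3
    · rw [indicator_of_notMem hx]
      have h4 : χ x.2 * G (p + x.1 + ((((k : ℝ) + 1)⁻¹ : ℝ) * x.2) • J) = 0 := by
        by_cases h5 : 1 ≤ ‖x.2‖
        · rw [hχ.eq_zero _ h5, zero_mul]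
        · rw [not_le] at h5
          have h6 : p + x.1 + ((((k : ℝ) + 1)⁻¹ : ℝ) * x.2) • J ∉ tsupport G := by
            intro h7
            apply hx
            refine ⟨?_, by simpa using h5.le⟩
            have h8 := hR _ h7
            have h9 : ‖((((k : ℝ) + 1)⁻¹ : ℝ) * x.2) • J‖ ≤ ‖J‖ := by
              rw [norm_smul, norm_mul, Complex.norm_real, Real.norm_of_nonneg (by positivity)]
              have h10 : ((k : ℝ) + 1)⁻¹ ≤ 1 := inv_le_one_of_one_le₀
                (by linarith [k.cast_nonneg (α := ℝ)])
              have h11 : ((k : ℝ) + 1)⁻¹ * ‖x.2‖ ≤ 1 := by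
                calc ((k : ℝ) + 1)⁻¹ * ‖x.2‖ ≤ 1 * 1 := by gcongr
                  _ = 1 := one_mul 1
              exact mul_le_of_le_one_left (norm_nonneg _) h11
            rw [mem_closedBall_zero_iff, Submodule.coe_norm]
            have h12 : (x.1 : CSpace N) = (p + x.1 + ((((k : ℝ) + 1)⁻¹ : ℝ) * x.2) • J) - p
                - ((((k : ℝ) + 1)⁻¹ : ℝ) * x.2) • J := by abel
            rw [h12]
            refine (norm_sub_le _ _).trans ?_
            have := norm_sub_le (p + x.1 + ((((k : ℝ) + 1)⁻¹ : ℝ) * x.2) • J) p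
            linarith
          rw [image_eq_zero_of_notMem_tsupport h6, mul_zero]
      rw [h4, ENNReal.ofReal_zero]
  · rw [lintegral_indicator hQ.measurableSet, setLIntegral_const]
    exact ENNReal.mul_ne_top ENNReal.ofReal_ne_top hQ.measure_ne_top
  · refine Eventually.of_forall fun x => ENNReal.tendsto_ofReal ?_
    refine Tendsto.const_mul _ ?_
    have h3 : Tendsto (fun k : ℕ => ((k : ℝ) + 1)⁻¹) atTop (𝓝 0) := by
      simpa [one_div] using tendsto_one_div_add_atTop_nhds_zero_nat (𝕜 := ℝ)
    have h4 : Continuous fun e : ℝ => G (p + x.1 + ((e : ℂ) * x.2) • J) := by fun_prop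
    have h5 := (h4.tendsto 0).comp h3
    simpa [Function.comp_def] using h5

lemma lintegral_affine_kerReal {l : CSpace N →L[ℂ] ℂ} (p : CSpace N) {d : ℕ}
    (hd : Module.finrank ℝ (kerReal l) = d) {g : CSpace N → ℝ≥0∞} (hg : Measurable g) :
    ∫⁻ t : kerReal l, g (p + t) = ∫⁻ y in {y | l (y - p) = 0}, g y ∂μHE[d] := by
  have hi : Isometry fun t : kerReal l => p + (t : CSpace N) := by
    refine Isometry.of_dist_eq fun x y => ?_
    rw [dist_add_left]
    rfl
  have hr : range (fun t : kerReal l => p + (t : CSpace N)) = {y | l (y - p) = 0} := by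
    ext y
    constructor
    · rintro ⟨t, rfl⟩
      simpa using mem_kerReal.1 t.2
    · intro hy
      exact ⟨⟨y - p, mem_kerReal.2 hy⟩, by simp⟩
  rw [← hr, ← hi.map_euclideanHausdorffMeasure, lintegral_map hg hi.continuous.measurable, ← hd]
  have h := InnerProductSpace.euclideanHausdorffMeasure_eq_volume (V := kerReal l)
  exact congrArg (fun ν => ∫⁻ t : kerReal l, g (p + t) ∂ν) h.symm

end ComplexCone

/-! ### The Hausdorff measure of the cone as a limit of volumes of thin tubes -/

namespace ComplexCone

open Set Filter Topology MeasureTheory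
open scoped NNReal ENNReal

variable {N : ℕ} {F : CSpace N → ℂ}

/-- The integral of `G` over `ℂ^N`, weighted by cutoffs concentrating on the zero set of `F`. -/
def tubeIntegral (F : CSpace N → ℂ) (χ : ℂ → ℝ) (G : CSpace N → ℝ) (k : ℕ) : ℝ≥0∞ :=
  ∫⁻ z, ENNReal.ofReal (((k : ℝ) + 1) ^ 2 * (χ (((k : ℝ) + 1) • F z) * G z))

/-- The integral of `G` over the cone, with the weight `|∇ Re F|⁻²`. -/
def coneIntegral (F : CSpace N → ℂ) (d : ℕ) (G : CSpace N → ℝ) : ℝ≥0∞ :=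
  ∫⁻ z in zeroCone F, ENNReal.ofReal (‖normalFrame F z‖ ^ 2 * G z) ∂μHE[d]

/-- The sequence `a` is, up to a factor `κ`, asymptotic to the number `b`. -/
def IsComparable (κ : ℝ≥0) (a : ℕ → ℝ≥0∞) (b : ℝ≥0∞) : Prop :=
  ∃ (u : ℕ → ℝ≥0∞) (L : ℝ≥0∞), Tendsto u atTop (𝓝 L) ∧ L ≠ ⊤ ∧ (∀ᶠ k in atTop, u k ≤ κ * a k) ∧
    (∀ᶠ k in atTop, a k ≤ κ * u k) ∧ L ≤ κ * b ∧ b ≤ κ * L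

lemma IsComparable.ne_top {κ : ℝ≥0} {a : ℕ → ℝ≥0∞} {b : ℝ≥0∞} (h : IsComparable κ a b) :
    b ≠ ⊤ := by
  obtain ⟨u, L, -, hL, -, -, -, h⟩ := h
  exact ne_top_of_le_ne_top (ENNReal.mul_ne_top ENNReal.coe_ne_top hL) h

lemma IsComparable.sum {ι : Type*} {s : Finset ι} {κ : ℝ≥0} {a : ι → ℕ → ℝ≥0∞} {b : ι → ℝ≥0∞}
    (h : ∀ i ∈ s, IsComparable κ (a i) (b i)) :
    IsComparable κ (fun k => ∑ i ∈ s, a i k) (∑ i ∈ s, b i) := by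
  choose! u L h1 h2 h3 h4 h5 h6 using h
  refine ⟨fun k => ∑ i ∈ s, u i k, ∑ i ∈ s, L i, tendsto_finsetSum _ h1, ?_, ?_, ?_, ?_, ?_⟩
  · exact ENNReal.sum_ne_top.2 h2
  · filter_upwards [(Finset.eventually_all s).2 h3] with k hk
    rw [Finset.mul_sum]
    exact Finset.sum_le_sum hk
  · filter_upwards [(Finset.eventually_all s).2 h4] with k hk
    rw [Finset.mul_sum]
    exact Finset.sum_le_sum hk
  · rw [Finset.mul_sum]
    exact Finset.sum_le_sum h5
  · rw [Finset.mul_sum]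
    exact Finset.sum_le_sum h6

lemma tendsto_of_isComparable {a : ℕ → ℝ≥0∞} {b : ℝ≥0∞}
    (h : ∀ κ : ℝ≥0, 1 < κ → IsComparable κ a b) : Tendsto a atTop (𝓝 b) := by
  have hb : b ≠ ⊤ := (h 2 (by norm_num)).ne_top
  lift b to ℝ≥0 using hb
  have hne : (𝓝[>] (1 : ℝ≥0)).NeBot := inferInstance
  rw [tendsto_order]
  constructor
  · intro x hx
    lift x to ℝ≥0 using (ne_top_of_lt hx)
    have hx' : x < b := by exact_mod_cast hx
    have h1 : ∀ᶠ κ : ℝ≥0 in 𝓝[>] 1, κ * (κ * x) < b := by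
      have hc : Continuous fun κ : ℝ≥0 => κ * (κ * x) := by fun_prop
      refine ((hc.tendsto 1).mono_left nhdsWithin_le_nhds).eventually_lt_const ?_
      simpa using hx'
    obtain ⟨κ, hκ, hκ1⟩ := (h1.and self_mem_nhdsWithin).exists
    obtain ⟨u, L, hu, hL, h2, -, -, h3⟩ := h κ hκ1
    have hκ0 : (κ : ℝ≥0∞) ≠ 0 := by exact_mod_cast (zero_lt_one.trans hκ1).ne'
    have h4 : (κ : ℝ≥0∞) * x < L := by
      have h5 : (κ : ℝ≥0∞) * (κ * x) < κ * L := lt_of_lt_of_le (by exact_mod_cast hκ) h3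
      exact lt_of_mul_lt_mul_left' h5
    filter_upwards [h2, hu.eventually_const_lt h4] with k h5 h6
    exact lt_of_mul_lt_mul_left' (h6.trans_le h5)
  · intro x hx
    have h1 : ∀ᶠ κ : ℝ≥0 in 𝓝[>] 1, ((κ * (κ * b) : ℝ≥0) : ℝ≥0∞) < x := by
      have hc : Continuous fun κ : ℝ≥0 => ((κ * (κ * b) : ℝ≥0) : ℝ≥0∞) :=
        ENNReal.continuous_coe.comp (by fun_prop)
      refine ((hc.tendsto 1).mono_left nhdsWithin_le_nhds).eventually_lt_const ?_
      simpa using hx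
    obtain ⟨κ, hκ, hκ1⟩ := (h1.and self_mem_nhdsWithin).exists
    obtain ⟨u, L, hu, hL, -, h2, h3, -⟩ := h κ hκ1
    have h4 : (κ : ℝ≥0∞) * L < x := by
      refine lt_of_le_of_lt ?_ hκ
      push_cast
      gcongr
    have h5 : Tendsto (fun k => (κ : ℝ≥0∞) * u k) atTop (𝓝 (κ * L)) :=
      ENNReal.Tendsto.const_mul hu (Or.inr ENNReal.coe_ne_top)
    filter_upwards [h2, h5.eventually_lt_const h4] with k h6 h7
    exact h6.trans_lt h7

lemma setLIntegral_eq_of_forall_notMem {α : Type*} [MeasurableSpace α] {μ : Measure α} {s t : Set α}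
    (ht : MeasurableSet t) {f : α → ℝ≥0∞} (h : ∀ x, x ∉ t → f x = 0) :
    ∫⁻ x in s, f x ∂μ = ∫⁻ x in s ∩ t, f x ∂μ := by
  have h1 : f = t.indicator f := by
    ext x
    by_cases hx : x ∈ t
    · rw [indicator_of_mem hx]
    · rw [indicator_of_notMem hx, h x hx]
  conv_lhs => rw [h1]
  rw [setLIntegral_indicator ht, inter_comm]

/-- Both comparisons of integrals under a bi-Lipschitz chart. -/
lemma lintegral_chart_le {e : OpenPartialHomeomorph (CSpace N) (CSpace N)} {K : ℝ≥0} (d : ℕ)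
    (he : LipschitzOnWith K e e.source) (he' : LipschitzOnWith K e.symm e.target)
    {s s' : Set (CSpace N)} (hs : MeasurableSet s) (hs' : MeasurableSet s')
    (hsub : s ⊆ e.source) (himg : e '' s = s') {I I' : CSpace N → ℝ≥0∞} (hI : Measurable I)
    (hI' : Measurable I') (h : ∀ z ∈ s, I' (e z) = I z) :
    ∫⁻ y in s', I' y ∂μHE[d] ≤ (K : ℝ≥0∞) ^ d * ∫⁻ z in s, I z ∂μHE[d] ∧
    ∫⁻ z in s, I z ∂μHE[d] ≤ (K : ℝ≥0∞) ^ d * ∫⁻ y in s', I' y ∂μHE[d] := by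
  constructor
  · have h1 := lintegral_image_le_of_lipschitzOn d (he.mono hsub) hs hI'
    rw [himg] at h1
    refine h1.trans (le_of_eq ?_)
    rw [setLIntegral_congr_fun hs h]
  · have hsub' : s' ⊆ e.target := by
      rw [← himg]
      exact (image_mono hsub).trans e.image_source_eq_target.le
    have himg' : e.symm '' s' = s := by
      rw [← himg, image_image]
      refine (image_congr fun z hz => e.left_inv (hsub hz)).trans (image_id s)
    have h1 := lintegral_image_le_of_lipschitzOn d (he'.mono hsub') hs' hI
    rw [himg'] at h1
    refine h1.trans (le_of_eq ?_)
    congr 1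
    refine setLIntegral_congr_fun hs' fun y hy => ?_
    rw [← himg] at hy
    obtain ⟨z, hz, rfl⟩ := hy
    simp only [e.left_inv (hsub hz), h z hz]

/-- Transport of a compactly supported function by a chart. -/
lemma continuous_indicator_comp_symm {E : Type*} [TopologicalSpace E] [T2Space E]
    (e : OpenPartialHomeomorph E E) {G : E → ℝ} (hG : Continuous G) (hGc : HasCompactSupport G)
    (hGs : tsupport G ⊆ e.source) :
    Continuous (e.target.indicator (G ∘ e.symm)) ∧
      HasCompactSupport (e.target.indicator (G ∘ e.symm)) := by
  have hK : IsCompact (e '' tsupport G) := hGc.isCompact.image_of_continuousOn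
    (e.continuousOn.mono hGs)
  have hzero : ∀ y, y ∉ e '' tsupport G → e.target.indicator (G ∘ e.symm) y = 0 := by
    intro y hy
    by_cases hyt : y ∈ e.target
    · rw [indicator_of_mem hyt]
      have h : G (e.symm y) = 0 :=
        image_eq_zero_of_notMem_tsupport fun h => hy ⟨e.symm y, h, e.right_inv hyt⟩
      exact h
    · rw [indicator_of_notMem hyt]
  refine ⟨continuous_iff_continuousAt.2 fun y => ?_, HasCompactSupport.intro hK hzero⟩
  by_cases hyt : y ∈ e.target
  · have h1 : e.target.indicator (G ∘ e.symm) =ᶠ[𝓝 y] G ∘ e.symm := by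
      filter_upwards [e.open_target.mem_nhds hyt] with x hx using indicator_of_mem hx _
    refine ContinuousAt.congr ?_ h1.symm
    exact hG.continuousAt.comp (e.symm.continuousAt hyt)
  · have hy : y ∉ e '' tsupport G := by
      rintro ⟨z, hz, rfl⟩
      exact hyt (e.map_source (hGs hz))
    have h1 : e.target.indicator (G ∘ e.symm) =ᶠ[𝓝 y] fun _ => 0 := by
      filter_upwards [hK.isClosed.isOpen_compl.mem_nhds hy] with x hx using hzero x hx
    exact continuousAt_const.congr h1.symm

lemma finrank_real_cspace : Module.finrank ℝ (CSpace N) = 2 * N := by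
  rw [finrank_real_of_complex, finrank_euclideanSpace, Fintype.card_fin]

lemma measurableSet_zeroCone (hF : IsRegular F) : MeasurableSet (zeroCone F) :=
  (measurableSet_singleton (0 : CSpace N)).compl.inter
    (isClosed_singleton.preimage hF.contDiff.continuous).measurableSet

lemma IsRegular.continuousAt_norm_sq_normalFrame (hF : IsRegular F) {p : CSpace N} (hp : p ≠ 0) :
    ContinuousAt (fun z => ‖normalFrame F z‖ ^ 2) p :=
  ((hF.contDiffAt_normalFrame hp).continuousAt.norm).pow 2

/-- A flattening chart takes the cone to the affine tangent space. -/
lemma IsRegular.image_flattening_eq (hF : IsRegular F) {p : CSpace N} (hp : p ∈ zeroCone F)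
    {e : OpenPartialHomeomorph (CSpace N) (CSpace N)} (he : ∀ z, e z = flattening F p z)
    (h0 : ∀ z ∈ e.source, z ≠ 0) :
    e '' (zeroCone F ∩ e.source) = {y | fderiv ℂ F p (y - p) = 0} ∩ e.target := by
  have hFe : ∀ z, fderiv ℂ F p (e z - p) = F z := fun z => by
    rw [he, hF.fderiv_flattening_sub hp.1, hp.2, sub_zero]
  ext y
  constructor
  · rintro ⟨z, hz, rfl⟩
    exact ⟨(hFe z).trans hz.1.2, e.map_source hz.2⟩
  · rintro ⟨hy, hyt⟩
    refine ⟨e.symm y, ⟨⟨h0 _ (e.map_target hyt), ?_⟩, e.map_target hyt⟩, e.right_inv hyt⟩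
    rw [← hFe, e.right_inv hyt]
    exact hy

/-- Near a point of the cone, the flattening chart compares the integrals over thin tubes and over
the cone with the same integrals for the tangent hyperplane. -/
lemma IsRegular.exists_isComparable_of_mem (hF : IsRegular F) {χ : ℂ → ℝ} (hχ : IsCutoff χ)
    {d : ℕ} (hd : d + 2 = 2 * N) {κ : ℝ≥0} (hκ : 1 < κ) {p : CSpace N} (hp : p ∈ zeroCone F) :
    ∃ O : Set (CSpace N), IsOpen O ∧ p ∈ O ∧ ∀ G : CSpace N → ℝ, Continuous G →
      HasCompactSupport G → (∀ z, 0 ≤ G z) → tsupport G ⊆ O →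
      IsComparable κ (tubeIntegral F χ G)
        ((∫⁻ s, ENNReal.ofReal (χ s)) * coneIntegral F d G) := by
  have hl := hF.fderiv_ne_zero p hp.1
  have hJ := hF.norm_sq_normalFrame_pos hp.1
  -- the Hausdorff measures change by at most `K ^ (2 * N)`, the weight by at most `K`
  obtain ⟨K, hKκ, hK1⟩ : ∃ K : ℝ≥0, K ^ (2 * N) < κ ∧ 1 < K := by
    have hne : (𝓝[>] (1 : ℝ≥0)).NeBot := inferInstance
    have h1 : ∀ᶠ K : ℝ≥0 in 𝓝[>] 1, K ^ (2 * N) < κ := by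
      refine (((continuous_pow (2 * N)).tendsto 1).mono_left
        nhdsWithin_le_nhds).eventually_lt_const ?_
      simpa using hκ
    exact (h1.and self_mem_nhdsWithin).exists
  have hK1' : (1 : ℝ) < K := by exact_mod_cast hK1
  have hKκ' : (K : ℝ≥0∞) ^ (2 * N) ≤ κ := by exact_mod_cast hKκ.le
  have hKd : (K : ℝ≥0∞) ^ (d + 1) ≤ κ := by
    refine le_trans (pow_le_pow_right₀ (by exact_mod_cast hK1.le) (by omega)) hKκ'
  set h0 := ‖normalFrame F p‖ ^ 2 with hh0
  have hnhds : {z | z ≠ 0} ∩ ({z | ‖normalFrame F z‖ ^ 2 < K * h0} ∩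
      {z | K⁻¹ * h0 < ‖normalFrame F z‖ ^ 2}) ∈ 𝓝 p := by
    have hc := hF.continuousAt_norm_sq_normalFrame hp.1
    refine inter_mem (isOpen_ne.mem_nhds hp.1) (inter_mem ?_ ?_)
    · refine hc.eventually_lt continuousAt_const ?_
      rw [← hh0]
      nlinarith
    · refine continuousAt_const.eventually_lt hc ?_
      rw [← hh0]
      have : (K : ℝ)⁻¹ < 1 := inv_lt_one_of_one_lt₀ hK1'
      push_cast
      nlinarith
  obtain ⟨e, hpe, hsub, he, -, hLip, hLip'⟩ := exists_biLipschitz_chart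
    (hF.contDiff_flattening p) (hF.hasFDerivAt_flattening p) hK1 hnhds
  refine ⟨e.source, e.open_source, hpe, fun G hG hGc hG0 hGs => ?_⟩
  obtain ⟨hG', hGc'⟩ := continuous_indicator_comp_symm e hG hGc hGs
  set G' := e.target.indicator (G ∘ e.symm) with hG'def
  have hG'0 : ∀ y, 0 ≤ G' y := fun y => indicator_nonneg (fun x _ => hG0 _) y
  have hG'e : ∀ z ∈ e.source, G' (e z) = G z := by
    intro z hz
    rw [hG'def, indicator_of_mem (e.map_source hz)]
    simp [e.left_inv hz]
  have hFe : ∀ z, fderiv ℂ F p (e z - p) = F z := by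
    intro z
    rw [he, hF.fderiv_flattening_sub hp.1, hp.2, sub_zero]
  have hχc := hχ.continuous
  have hFc := hF.contDiff.continuous
  have hGz : ∀ z, z ∉ e.source → G z = 0 := fun z hz =>
    image_eq_zero_of_notMem_tsupport fun h => hz (hGs h)
  have hGz' : ∀ y, y ∉ e.target → G' y = 0 := fun y hy => indicator_of_notMem hy _
  have hvol : (volume : Measure (CSpace N)) = μHE[2 * N] := by
    rw [← finrank_real_cspace (N := N), InnerProductSpace.euclideanHausdorffMeasure_eq_volume]
  -- comparison of the integrals over the tubes
  have htube : ∀ k : ℕ,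
      ∫⁻ y, ENNReal.ofReal (((k : ℝ) + 1) ^ 2 * (χ (((k : ℝ) + 1) • fderiv ℂ F p (y - p)) * G' y))
        ≤ (K : ℝ≥0∞) ^ (2 * N) * tubeIntegral F χ G k ∧
      tubeIntegral F χ G k ≤ (K : ℝ≥0∞) ^ (2 * N) * ∫⁻ y, ENNReal.ofReal
        (((k : ℝ) + 1) ^ 2 * (χ (((k : ℝ) + 1) • fderiv ℂ F p (y - p)) * G' y)) := by
    intro k
    have hm1 : Continuous fun z => ENNReal.ofReal
        (((k : ℝ) + 1) ^ 2 * (χ (((k : ℝ) + 1) • F z) * G z)) :=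
      ENNReal.continuous_ofReal.comp (by fun_prop)
    have hm2 : Continuous fun y => ENNReal.ofReal
        (((k : ℝ) + 1) ^ 2 * (χ (((k : ℝ) + 1) • fderiv ℂ F p (y - p)) * G' y)) :=
      ENNReal.continuous_ofReal.comp (by fun_prop)
    have h1 := lintegral_chart_le (2 * N) hLip hLip' e.open_source.measurableSet
      e.open_target.measurableSet subset_rfl e.image_source_eq_target hm1.measurable
      hm2.measurable (fun z hz => by simp only [hFe, hG'e z hz])
    rw [tubeIntegral, hvol, ← setLIntegral_univ, ← setLIntegral_univ (fun z => ENNReal.ofReal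
        (((k : ℝ) + 1) ^ 2 * (χ (((k : ℝ) + 1) • F z) * G z))),
      setLIntegral_eq_of_forall_notMem (s := univ) e.open_source.measurableSet
        (f := fun z => ENNReal.ofReal (((k : ℝ) + 1) ^ 2 * (χ (((k : ℝ) + 1) • F z) * G z)))
        (fun z hz => by simp [hGz z hz]),
      setLIntegral_eq_of_forall_notMem (s := univ) e.open_target.measurableSet
        (f := fun y => ENNReal.ofReal
          (((k : ℝ) + 1) ^ 2 * (χ (((k : ℝ) + 1) • fderiv ℂ F p (y - p)) * G' y)))
        (fun z hz => by simp [hGz' z hz]), univ_inter, univ_inter]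
    exact h1
  -- comparison of the integrals over the cone and over its tangent space
  have hfin : Module.finrank ℝ (kerReal (fderiv ℂ F p)) = d := by
    have := finrank_kerReal hl
    omega
  set I := ∫⁻ t : kerReal (fderiv ℂ F p), ENNReal.ofReal (G' (p + t)) with hI
  have hIfin : I ≠ ⊤ := by
    have h1 : Continuous fun t : kerReal (fderiv ℂ F p) => G' (p + t) := by fun_prop
    have h2 : HasCompactSupport fun t : kerReal (fderiv ℂ F p) => G' (p + t) := by
      have hemb : IsClosedEmbedding fun t : kerReal (fderiv ℂ F p) => p + (t : CSpace N) :=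
        (Homeomorph.addLeft p).isClosedEmbedding.comp
          (kerReal (fderiv ℂ F p)).closed_of_finiteDimensional.isClosedEmbedding_subtypeVal
      exact hGc'.comp_isClosedEmbedding hemb
    have h3 := (h1.integrable_of_hasCompactSupport h2 (μ := volume)).lintegral_lt_top
    exact h3.ne
  have hχfin : ∫⁻ s, ENNReal.ofReal (χ s) ≠ ⊤ := by
    have h2 : HasCompactSupport χ := HasCompactSupport.intro (isCompact_closedBall (0 : ℂ) 1)
      fun s hs => hχ.eq_zero s (by
        rw [mem_closedBall_zero_iff, not_le] at hs
        exact hs.le)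
    exact (hχc.integrable_of_hasCompactSupport h2).lintegral_lt_top.ne
  have hcone : I ≤ (K : ℝ≥0∞) ^ d * ∫⁻ z in zeroCone F, ENNReal.ofReal (G z) ∂μHE[d] ∧
      ∫⁻ z in zeroCone F, ENNReal.ofReal (G z) ∂μHE[d] ≤ (K : ℝ≥0∞) ^ d * I := by
    have hcl : MeasurableSet {y | fderiv ℂ F p (y - p) = 0} :=
      (isClosed_singleton.preimage (f := fun y => fderiv ℂ F p (y - p))
        (by fun_prop)).measurableSet
    have himg := hF.image_flattening_eq hp he fun z hz => (hsub hz).1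
    have h1 := lintegral_chart_le d hLip hLip'
      ((measurableSet_zeroCone hF).inter e.open_source.measurableSet)
      (hcl.inter e.open_target.measurableSet) inter_subset_right himg
      (I := fun z => ENNReal.ofReal (G z)) (I' := fun y => ENNReal.ofReal (G' y))
      (ENNReal.continuous_ofReal.comp hG).measurable (ENNReal.continuous_ofReal.comp hG').measurable
      (fun z hz => by simp only [hG'e z hz.2])
    rw [← setLIntegral_eq_of_forall_notMem e.open_source.measurableSet
        (fun z hz => by simp [hGz z hz]),
      ← setLIntegral_eq_of_forall_notMem e.open_target.measurableSet
        (fun z hz => by simp [hGz' z hz]),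
      ← lintegral_affine_kerReal p hfin (g := fun y => ENNReal.ofReal (G' y))
        (ENNReal.continuous_ofReal.comp hG').measurable] at h1
    exact h1
  -- the weight is almost constant
  have hw1 : coneIntegral F d G ≤ ENNReal.ofReal (K * h0) *
      ∫⁻ z in zeroCone F, ENNReal.ofReal (G z) ∂μHE[d] := by
    rw [← lintegral_const_mul (f := fun z => ENNReal.ofReal (G z)) _
      (ENNReal.continuous_ofReal.comp hG).measurable]
    refine lintegral_mono fun z => ?_
    rw [← ENNReal.ofReal_mul (by positivity)]
    apply ENNReal.ofReal_le_ofReal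
    by_cases hz : z ∈ e.source
    · exact mul_le_mul_of_nonneg_right (hsub hz).2.1.le (hG0 z)
    · simp [hGz z hz]
  have hw2 : ENNReal.ofReal h0 * ∫⁻ z in zeroCone F, ENNReal.ofReal (G z) ∂μHE[d]
      ≤ K * coneIntegral F d G := by
    have h1 : ENNReal.ofReal (K⁻¹ * h0) * ∫⁻ z in zeroCone F, ENNReal.ofReal (G z) ∂μHE[d]
        ≤ coneIntegral F d G := by
      rw [← lintegral_const_mul (f := fun z => ENNReal.ofReal (G z)) _
      (ENNReal.continuous_ofReal.comp hG).measurable]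
      refine lintegral_mono fun z => ?_
      rw [← ENNReal.ofReal_mul (by positivity)]
      apply ENNReal.ofReal_le_ofReal
      by_cases hz : z ∈ e.source
      · exact mul_le_mul_of_nonneg_right (hsub hz).2.2.le (hG0 z)
      · simp [hGz z hz]
    calc ENNReal.ofReal h0 * ∫⁻ z in zeroCone F, ENNReal.ofReal (G z) ∂μHE[d]
        = K * (ENNReal.ofReal (K⁻¹ * h0) *
            ∫⁻ z in zeroCone F, ENNReal.ofReal (G z) ∂μHE[d]) := by
          rw [← mul_assoc, ← ENNReal.ofReal_coe_nnreal, ← ENNReal.ofReal_mul (by positivity)]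
          congr 2
          have : (K : ℝ) ≠ 0 := by linarith
          push_cast
          field_simp
      _ ≤ K * coneIntegral F d G := by gcongr
  have hlim := tendsto_lintegral_cutoff_hyperplane hl p hχ hG' hGc' hG'0
  refine ⟨_, _, hlim, ?_, Eventually.of_forall fun k => ?_, Eventually.of_forall fun k => ?_,
    ?_, ?_⟩
  · exact ENNReal.mul_ne_top ENNReal.ofReal_ne_top (ENNReal.mul_ne_top hIfin hχfin)
  · exact (htube k).1.trans (by gcongr)
  · exact (htube k).2.trans (by gcongr)
  · change ENNReal.ofReal h0 * (I * _) ≤ _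
    calc ENNReal.ofReal h0 * (I * ∫⁻ s, ENNReal.ofReal (χ s))
        = (∫⁻ s, ENNReal.ofReal (χ s)) * (ENNReal.ofReal h0 * I) := by ring
      _ ≤ (∫⁻ s, ENNReal.ofReal (χ s)) * (ENNReal.ofReal h0 * ((K : ℝ≥0∞) ^ d *
            ∫⁻ z in zeroCone F, ENNReal.ofReal (G z) ∂μHE[d])) := by gcongr; exact hcone.1
      _ = (∫⁻ s, ENNReal.ofReal (χ s)) * ((K : ℝ≥0∞) ^ d * (ENNReal.ofReal h0 *
            ∫⁻ z in zeroCone F, ENNReal.ofReal (G z) ∂μHE[d])) := by ring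
      _ ≤ (∫⁻ s, ENNReal.ofReal (χ s)) * ((K : ℝ≥0∞) ^ d * (K * coneIntegral F d G)) := by
          gcongr
      _ = (K : ℝ≥0∞) ^ (d + 1) * ((∫⁻ s, ENNReal.ofReal (χ s)) * coneIntegral F d G) := by ring
      _ ≤ _ := by gcongr
  · change _ ≤ _ * (ENNReal.ofReal h0 * (I * _))
    calc (∫⁻ s, ENNReal.ofReal (χ s)) * coneIntegral F d G
        ≤ (∫⁻ s, ENNReal.ofReal (χ s)) * (ENNReal.ofReal (K * h0) * ((K : ℝ≥0∞) ^ d * I)) := by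
          gcongr
          exact hw1.trans (by gcongr; exact hcone.2)
      _ = (K : ℝ≥0∞) ^ (d + 1) * (ENNReal.ofReal h0 * (I * ∫⁻ s, ENNReal.ofReal (χ s))) := by
          rw [ENNReal.ofReal_mul (by positivity), ENNReal.ofReal_coe_nnreal]
          ring
      _ ≤ _ := by gcongr

end ComplexCone

namespace ComplexCone

open Set Filter Topology MeasureTheory
open scoped NNReal ENNReal

variable {N : ℕ} {F : CSpace N → ℂ}

/-- The comparison near any point off the origin: away from the cone thin tubes are empty. -/
lemma IsRegular.exists_isComparable (hF : IsRegular F) {χ : ℂ → ℝ} (hχ : IsCutoff χ)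
    {d : ℕ} (hd : d + 2 = 2 * N) {κ : ℝ≥0} (hκ : 1 < κ) {p : CSpace N} (hp : p ≠ 0) :
    ∃ O : Set (CSpace N), IsOpen O ∧ p ∈ O ∧ ∀ G : CSpace N → ℝ, Continuous G →
      HasCompactSupport G → (∀ z, 0 ≤ G z) → tsupport G ⊆ O →
      IsComparable κ (tubeIntegral F χ G)
        ((∫⁻ s, ENNReal.ofReal (χ s)) * coneIntegral F d G) := by
  by_cases hFp : F p = 0
  · exact hF.exists_isComparable_of_mem hχ hd hκ ⟨hp, hFp⟩
  have h0 : 0 < ‖F p‖ := norm_pos_iff.2 hFp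
  have hc := hF.contDiff.continuous
  refine ⟨{z | ‖F p‖ / 2 < ‖F z‖}, isOpen_lt continuous_const hc.norm, ?_,
    fun G hG hGc hG0 hGs => ?_⟩
  · change ‖F p‖ / 2 < ‖F p‖
    linarith
  have hGz : ∀ z, ‖F z‖ ≤ ‖F p‖ / 2 → G z = 0 := fun z hz =>
    image_eq_zero_of_notMem_tsupport fun h => not_lt.2 hz (hGs h)
  have h1 : coneIntegral F d G = 0 := by
    rw [coneIntegral, setLIntegral_congr_fun (measurableSet_zeroCone hF) (g := 0),
      lintegral_zero_fun]
    intro z hz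
    simp [hGz z (by rw [hz.2, norm_zero]; positivity)]
  have h2 : ∀ᶠ k in atTop, tubeIntegral F χ G k = 0 := by
    have h3 : Tendsto (fun k : ℕ => ((k : ℝ) + 1) * (‖F p‖ / 2)) atTop atTop :=
      (tendsto_atTop_add_const_right _ _ tendsto_natCast_atTop_atTop).atTop_mul_const
        (by positivity)
    filter_upwards [h3.eventually_ge_atTop 1] with k hk
    rw [tubeIntegral, lintegral_congr (g := 0),
      lintegral_zero_fun]
    intro z
    by_cases hz : ‖F z‖ ≤ ‖F p‖ / 2
    · simp [hGz z hz]
    · have h4 : 1 ≤ ‖((k : ℝ) + 1) • F z‖ := by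
        rw [norm_smul, Real.norm_of_nonneg (by positivity)]
        refine hk.trans ?_
        rw [not_le] at hz
        gcongr
      rw [hχ.eq_zero _ h4]
      simp
  refine ⟨fun _ => 0, 0, tendsto_const_nhds, by simp, by simp, ?_, by simp, by simp [h1]⟩
  filter_upwards [h2] with k hk
  rw [hk]
  simp

/-- The local comparisons are added up by a partition of unity. -/
lemma IsRegular.isComparable (hF : IsRegular F) {χ : ℂ → ℝ} (hχ : IsCutoff χ)
    {d : ℕ} (hd : d + 2 = 2 * N) {κ : ℝ≥0} (hκ : 1 < κ) {G : CSpace N → ℝ} (hG : Continuous G)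
    (hGc : HasCompactSupport G) (hG0 : ∀ z, 0 ≤ G z) (h0 : 0 ∉ tsupport G) :
    IsComparable κ (tubeIntegral F χ G)
        ((∫⁻ s, ENNReal.ofReal (χ s)) * coneIntegral F d G) := by
  have hx : ∀ x : CSpace N, ∃ O : Set (CSpace N), IsOpen O ∧ (x ≠ 0 → x ∈ O) ∧
      ∀ G : CSpace N → ℝ, Continuous G →
      HasCompactSupport G → (∀ z, 0 ≤ G z) → tsupport G ⊆ O →
      IsComparable κ (tubeIntegral F χ G)
        ((∫⁻ s, ENNReal.ofReal (χ s)) * coneIntegral F d G) := by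
    intro x
    by_cases h : x = 0
    · refine ⟨∅, isOpen_empty, fun h' => (h' h).elim, fun G _ _ _ hs => ?_⟩
      have : G = 0 := by
        rw [← tsupport_eq_empty_iff]
        exact subset_empty_iff.1 hs
      subst this
      refine ⟨fun _ => 0, 0, tendsto_const_nhds, by simp, by simp, ?_, by simp, ?_⟩
      · simp [tubeIntegral]
      · simp [coneIntegral]
    · obtain ⟨O, h1, h2, h3⟩ := hF.exists_isComparable hχ hd hκ h
      exact ⟨O, h1, fun _ => h2, h3⟩
  choose O hO hpO hcomp using hx
  obtain ⟨t, ht⟩ := hGc.isCompact.elim_finite_subcover O hO fun x hx =>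
    mem_iUnion.2 ⟨x, hpO x fun h => h0 (h ▸ hx)⟩
  let s : Fin t.card → Set (CSpace N) := fun i => O (t.equivFin.symm i)
  have hts : tsupport G ⊆ ⋃ i, s i := by
    intro x hx
    obtain ⟨y, hy, hxy⟩ := mem_iUnion₂.1 (ht hx)
    refine mem_iUnion.2 ⟨t.equivFin ⟨y, hy⟩, ?_⟩
    simpa [s] using hxy
  obtain ⟨f, hfs, hf1, hf01, -⟩ := exists_continuous_sum_one_of_isOpen_isCompact
    (s := s) (fun i => hO _) hGc.isCompact hts
  have hsum : ∀ z, ∑ i, f i z * G z = G z := by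
    intro z
    rw [← Finset.sum_mul]
    by_cases hz : z ∈ tsupport G
    · have := hf1 hz
      simp only [Finset.sum_apply, Pi.one_apply] at this
      rw [this, one_mul]
    · rw [image_eq_zero_of_notMem_tsupport hz, mul_zero]
  have hi : ∀ i ∈ Finset.univ, IsComparable κ (tubeIntegral F χ fun z => f i z * G z)
      ((∫⁻ s, ENNReal.ofReal (χ s)) * coneIntegral F d fun z => f i z * G z) := by
    intro i _
    refine hcomp _ _ ((f i).continuous.mul hG) hGc.mul_left
      (fun z => mul_nonneg (hf01 i z).1 (hG0 z)) ((tsupport_mul_subset_left).trans (hfs i))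
  have key := IsComparable.sum hi
  have hχc := hχ.continuous
  have hFc := hF.contDiff.continuous
  have e1 : tubeIntegral F χ G = fun k => ∑ i, tubeIntegral F χ (fun z => f i z * G z) k := by
    ext k
    simp only [tubeIntegral]
    rw [← lintegral_finsetSum]
    · refine lintegral_congr fun z => ?_
      rw [← ENNReal.ofReal_sum_of_nonneg]
      · conv_lhs => rw [← hsum z]
        rw [Finset.mul_sum, Finset.mul_sum]
      · intro i _
        exact mul_nonneg (by positivity)
          (mul_nonneg (hχ.nonneg _) (mul_nonneg (hf01 i z).1 (hG0 z)))
    · intro i _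
      have := (f i).continuous
      exact (ENNReal.continuous_ofReal.comp (by fun_prop)).measurable
  have e2 : coneIntegral F d G = ∑ i, coneIntegral F d (fun z => f i z * G z) := by
    simp only [coneIntegral]
    rw [← lintegral_finsetSum']
    · refine lintegral_congr fun z => ?_
      rw [← ENNReal.ofReal_sum_of_nonneg]
      · conv_lhs => rw [← hsum z]
        rw [Finset.mul_sum]
      · intro i _
        exact mul_nonneg (by positivity) (mul_nonneg (hf01 i z).1 (hG0 z))
    · intro i _
      refine ContinuousOn.aemeasurable ?_ (measurableSet_zeroCone hF)
      refine ENNReal.continuous_ofReal.comp_continuousOn fun z hz =>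
        ContinuousAt.continuousWithinAt ?_
      have h1 := (f i).continuous.continuousAt (x := z)
      exact (hF.continuousAt_norm_sq_normalFrame hz.1).mul (h1.mul hG.continuousAt)
  rw [e2, Finset.mul_sum, e1]
  exact key

/-- The mass of thin tubes around the cone converges to the Hausdorff measure of the cone with
weight `|∇ Re F|⁻²`. -/
lemma IsRegular.tendsto_tubeIntegral (hF : IsRegular F) {χ : ℂ → ℝ} (hχ : IsCutoff χ)
    {d : ℕ} (hd : d + 2 = 2 * N) {G : CSpace N → ℝ} (hG : Continuous G)
    (hGc : HasCompactSupport G) (hG0 : ∀ z, 0 ≤ G z) (h0 : 0 ∉ tsupport G) :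
    Tendsto (tubeIntegral F χ G) atTop
      (𝓝 ((∫⁻ s, ENNReal.ofReal (χ s)) * coneIntegral F d G)) :=
  tendsto_of_isComparable fun _ hκ => hF.isComparable hχ hd hκ hG hGc hG0 h0

/-- A smooth radial cutoff on `ℂ`. -/
def bump : ContDiffBump (0 : ℂ) := ⟨1 / 2, 1, by norm_num, by norm_num⟩

lemma isCutoff_bump : IsCutoff bump where
  continuous := bump.continuous
  nonneg _ := bump.nonneg
  le_one _ := bump.le_one
  eq_zero s hs := bump.zero_of_le_dist (by simpa [bump] using hs)

lemma lintegral_bump_ne_zero : ∫⁻ s, ENNReal.ofReal (bump s) ≠ 0 := by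
  rw [← ofReal_integral_eq_lintegral_ofReal bump.integrable
    (Eventually.of_forall fun _ => bump.nonneg)]
  exact (ENNReal.ofReal_pos.2 (bump.integral_pos (μ := volume))).ne'

lemma lintegral_bump_ne_top : ∫⁻ s, ENNReal.ofReal (bump s) ≠ ⊤ :=
  bump.integrable.lintegral_lt_top.ne

lemma IsRegular.coneIntegral_ne_top (hF : IsRegular F) {d : ℕ} (hd : d + 2 = 2 * N)
    {G : CSpace N → ℝ} (hG : Continuous G) (hGc : HasCompactSupport G) (hG0 : ∀ z, 0 ≤ G z)
    (h0 : 0 ∉ tsupport G) : coneIntegral F d G ≠ ⊤ := by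
  have h := (hF.isComparable isCutoff_bump hd (κ := 2) (by norm_num) hG hGc hG0 h0).ne_top
  intro h1
  rw [h1, ENNReal.mul_top lintegral_bump_ne_zero] at h
  exact h rfl

lemma continuous_of_continuousAt_ne {g : CSpace N → ℝ} (hg : ∀ z ≠ 0, ContinuousAt g z)
    (h0 : 0 ∉ tsupport g) : Continuous g := by
  refine continuous_iff_continuousAt.2 fun z => ?_
  by_cases hz : z = 0
  · subst hz
    refine (continuousAt_const (y := (0 : ℝ))).congr ?_
    exact (notMem_tsupport_iff_eventuallyEq.1 h0).symm
  · exact hg z hz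

lemma IsRegular.integrableOn_zeroCone (hF : IsRegular F) {d : ℕ} (hd : d + 2 = 2 * N)
    {G : CSpace N → ℝ} (hG : ∀ z ≠ 0, ContinuousAt G z) (hGc : HasCompactSupport G)
    (h0 : 0 ∉ tsupport G) : IntegrableOn G (zeroCone F) μHE[d] := by
  have hGcont := continuous_of_continuousAt_ne hG h0
  refine ⟨hGcont.aestronglyMeasurable, ?_⟩
  set H : CSpace N → ℝ := fun z => (‖normalFrame F z‖ ^ 2)⁻¹ * ‖G z‖ with hH
  have hHs : tsupport H ⊆ tsupport G := by
    refine closure_mono fun z hz => ?_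
    rw [Function.mem_support] at hz ⊢
    intro h
    simp [hH, h] at hz
  have hHcont : Continuous H := by
    refine continuous_of_continuousAt_ne (fun z hz => ?_) fun h => h0 (hHs h)
    exact ((hF.continuousAt_norm_sq_normalFrame hz).inv₀ (hF.norm_sq_normalFrame_pos hz).ne').mul
      hGcont.continuousAt.norm
  have h1 := hF.coneIntegral_ne_top hd hHcont (hGc.mono' (subset_closure.trans hHs))
    (fun z => by positivity) fun h => h0 (hHs h)
  rw [hasFiniteIntegral_iff_norm, lt_top_iff_ne_top]
  convert h1 using 1
  refine setLIntegral_congr_fun (measurableSet_zeroCone hF) fun z hz => ?_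
  have := (hF.norm_sq_normalFrame_pos hz.1).ne'
  simp only [hH]
  rw [← mul_assoc, mul_inv_cancel₀ this, one_mul]

end ComplexCone

/-! ### The divergence theorem for fields tangent to the level sets -/

namespace ComplexCone

open Set Filter Topology MeasureTheory
open scoped NNReal ENNReal

variable {N : ℕ} {F : CSpace N → ℂ}

/-- The divergence of a vector field on `ℂ^N = ℝ^{2N}`. -/
def divergence (X : CSpace N → CSpace N) (z : CSpace N) : ℝ :=
  LinearMap.trace ℝ (CSpace N) (fderiv ℝ X z : CSpace N →ₗ[ℝ] CSpace N)

lemma divergence_eq_sum (X : CSpace N → CSpace N) (z : CSpace N) :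
    divergence X z = ∑ i, inner ℝ (stdOrthonormalBasis ℝ (CSpace N) i)
      (fderiv ℝ X z (stdOrthonormalBasis ℝ (CSpace N) i)) :=
  LinearMap.trace_eq_sum_inner _ (stdOrthonormalBasis ℝ (CSpace N))

lemma continuous_divergence {X : CSpace N → CSpace N} (hX : ContDiff ℝ 1 X) :
    Continuous (divergence X) := by
  have h : divergence X = fun z => ∑ i, inner ℝ (stdOrthonormalBasis ℝ (CSpace N) i)
      (fderiv ℝ X z (stdOrthonormalBasis ℝ (CSpace N) i)) := funext (divergence_eq_sum X)
  rw [h]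
  have h1 := hX.continuous_fderiv one_ne_zero
  fun_prop

lemma tsupport_divergence_subset (X : CSpace N → CSpace N) :
    tsupport (divergence X) ⊆ tsupport X := by
  refine (closure_mono ?_).trans (tsupport_fderiv_subset ℝ (f := X))
  intro z hz
  rw [Function.mem_support] at hz ⊢
  intro h
  apply hz
  rw [divergence, h]
  simp

/-- Integration by parts against a function that is constant along `X`. -/
lemma integral_mul_divergence_eq_zero {X : CSpace N → CSpace N} (hX : ContDiff ℝ 1 X)
    (hXc : HasCompactSupport X) {g : CSpace N → ℝ} (hg : ContDiff ℝ 1 g)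
    (h : ∀ z, fderiv ℝ g z (X z) = 0) : ∫ z, g z * divergence X z = 0 := by
  set b := stdOrthonormalBasis ℝ (CSpace N)
  have hgc := hg.continuous
  have hg' := hg.continuous_fderiv one_ne_zero
  have hXcont := hX.continuous
  have hX' := hX.continuous_fderiv one_ne_zero
  have hXs : ∀ z, z ∉ tsupport X → X z = 0 := fun z hz => image_eq_zero_of_notMem_tsupport hz
  have hXs' : ∀ z, z ∉ tsupport X → fderiv ℝ X z = 0 := fun z hz =>
    image_eq_zero_of_notMem_tsupport fun h' => hz (tsupport_fderiv_subset ℝ h')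
  have hd : ∀ i z, fderiv ℝ (fun z => inner ℝ (b i) (X z)) z (b i)
      = inner ℝ (b i) (fderiv ℝ X z (b i)) := by
    intro i z
    have h1 := ((hX.differentiable one_ne_zero) z).hasFDerivAt
    have h2 : HasFDerivAt (fun z => inner ℝ (b i) (X z))
        ((innerSL ℝ (b i)).comp (fderiv ℝ X z)) z :=
      (innerSL ℝ (b i)).hasFDerivAt.comp z h1
    rw [h2.fderiv]
    rfl
  have hi1 : ∀ i, Integrable fun z => fderiv ℝ g z (b i) * inner ℝ (b i) (X z) := by
    intro i
    refine Continuous.integrable_of_hasCompactSupport (by fun_prop)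
      (HasCompactSupport.intro hXc.isCompact fun z hz => by simp [hXs z hz])
  have hi2 : ∀ i, Integrable fun z => g z * inner ℝ (b i) (fderiv ℝ X z (b i)) := by
    intro i
    refine Continuous.integrable_of_hasCompactSupport (by fun_prop)
      (HasCompactSupport.intro hXc.isCompact fun z hz => by simp [hXs' z hz])
  have hi3 : ∀ i, Integrable fun z => g z * inner ℝ (b i) (X z) := by
    intro i
    refine Continuous.integrable_of_hasCompactSupport (by fun_prop)
      (HasCompactSupport.intro hXc.isCompact fun z hz => by simp [hXs z hz])
  have key : ∀ i, ∫ z, g z * inner ℝ (b i) (fderiv ℝ X z (b i))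
      = -∫ z, fderiv ℝ g z (b i) * inner ℝ (b i) (X z) := by
    intro i
    have h1 := integral_mul_fderiv_eq_neg_fderiv_mul_of_integrable
      (μ := (volume : Measure (CSpace N)))
      (f := g) (g := fun z => inner ℝ (b i) (X z)) (v := b i) (hi1 i)
      (by simp only [hd]; exact hi2 i) (hi3 i)
      (fun z _ => hg.differentiable one_ne_zero z)
      (fun z _ => ((contDiff_const.inner ℝ hX).differentiable one_ne_zero) z)
    simp only [hd] at h1
    exact h1
  calc ∫ z, g z * divergence X z
      = ∫ z, ∑ i, g z * inner ℝ (b i) (fderiv ℝ X z (b i)) := by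
        refine integral_congr_ae (Eventually.of_forall fun z => ?_)
        simp only [divergence_eq_sum, Finset.mul_sum]
        rfl
    _ = ∑ i, -∫ z, fderiv ℝ g z (b i) * inner ℝ (b i) (X z) := by
        rw [integral_finsetSum _ fun i _ => hi2 i]
        exact Finset.sum_congr rfl fun i _ => key i
    _ = -∫ z, ∑ i, fderiv ℝ g z (b i) * inner ℝ (b i) (X z) := by
        rw [integral_finsetSum _ fun i _ => hi1 i, Finset.sum_neg_distrib]
    _ = 0 := by
        rw [neg_eq_zero]
        refine integral_eq_zero_of_ae (Eventually.of_forall fun z => ?_)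
        have h1 : ∑ i, inner ℝ (b i) (X z) • b i = X z := b.sum_repr' (X z)
        have h2 := h z
        rw [← h1, map_sum] at h2
        simp only [map_smul, smul_eq_mul] at h2
        simp only [Pi.zero_apply]
        rw [← h2]
        exact Finset.sum_congr rfl fun i _ => mul_comm _ _

/-- The divergence theorem on the cone, weighted by `|∇ Re F|⁻²`, for an ambient field tangent to
all level sets of `F`: by the coarea formula the weighted measure is a limit of volumes of tubes. -/
theorem IsRegular.setIntegral_divergence_eq_zero (hF : IsRegular F) {d : ℕ} (hd : d + 2 = 2 * N)
    {X : CSpace N → CSpace N} (hX : ContDiff ℝ 1 X) (hXc : HasCompactSupport X)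
    (h0 : 0 ∉ tsupport X) (ht : ∀ z, fderiv ℂ F z (X z) = 0) :
    ∫ z in zeroCone F, ‖normalFrame F z‖ ^ 2 * divergence X z ∂μHE[d] = 0 := by
  set G := divergence X with hG
  have hGc : Continuous G := continuous_divergence hX
  have hGcs : HasCompactSupport G := hXc.mono' (subset_closure.trans (tsupport_divergence_subset X))
  have hG0 : 0 ∉ tsupport G := fun h => h0 (tsupport_divergence_subset X h)
  have hpos : ∀ (H : CSpace N → ℝ), Continuous H → tsupport H ⊆ tsupport G →
      Continuous (fun z => max (H z) 0) ∧ HasCompactSupport (fun z => max (H z) 0) ∧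
      0 ∉ tsupport (fun z => max (H z) 0) := by
    intro H hH hHG
    have h1 : tsupport (fun z => max (H z) 0) ⊆ tsupport G := by
      refine (closure_mono fun z hz => ?_).trans hHG
      rw [Function.mem_support] at hz ⊢
      intro h
      simp [h] at hz
    exact ⟨by fun_prop, hGcs.mono' (subset_closure.trans h1), fun h => hG0 (h1 h)⟩
  obtain ⟨p1, p2, p3⟩ := hpos G hGc subset_rfl
  obtain ⟨m1, m2, m3⟩ := hpos (fun z => -G z) hGc.neg (by
    refine (closure_mono fun z hz => ?_)
    rw [Function.mem_support] at hz ⊢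
    simpa using hz)
  have hFr : ContDiff ℝ 1 F := hF.contDiff_real.of_le (by exact_mod_cast le_top)
  -- the divergence integrates to zero over each tube, as the cutoff of `F` is constant along `X`
  have htube : tubeIntegral F bump (fun z => max (G z) 0)
      = tubeIntegral F bump (fun z => max (-G z) 0) := by
    ext k
    set g : CSpace N → ℝ := fun z => bump (((k : ℝ) + 1) • F z) with hg
    have hbump : ContDiff ℝ 1 bump := bump.contDiff
    have hgd : ContDiff ℝ 1 g := hbump.comp (hFr.const_smul ((k : ℝ) + 1))
    have hgz : ∀ z, fderiv ℝ g z (X z) = 0 := by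
      intro z
      have h1 : HasFDerivAt F (((fderiv ℂ F z).restrictScalars ℝ)) z :=
        (hF.hasFDerivAt z).restrictScalars ℝ
      have h2 := ((hbump.differentiable one_ne_zero) (((k : ℝ) + 1) • F z)).hasFDerivAt.comp z
        (h1.const_smul ((k : ℝ) + 1))
      have h3 : fderiv ℝ g z = _ := h2.fderiv
      rw [h3]
      simp [ht z]
    have h1 : ∫ z, ((k : ℝ) + 1) ^ 2 * (g z * G z) = 0 := by
      rw [integral_const_mul, integral_mul_divergence_eq_zero hX hXc hgd hgz, mul_zero]
    have hgc := hgd.continuous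
    have hint : Integrable fun z => ((k : ℝ) + 1) ^ 2 * (g z * G z) :=
      Continuous.integrable_of_hasCompactSupport (by fun_prop) (hGcs.mul_left.mul_left)
    have hneg : ∫⁻ z, ENNReal.ofReal (-(((k : ℝ) + 1) ^ 2 * (g z * G z))) ≠ ⊤ :=
      hint.neg.lintegral_lt_top.ne
    rw [integral_eq_lintegral_pos_part_sub_lintegral_neg_part hint, sub_eq_zero,
      ENNReal.toReal_eq_toReal_iff' hint.lintegral_lt_top.ne hneg] at h1
    have hmax : ∀ (a : ℝ) (z : CSpace N), ENNReal.ofReal (((k : ℝ) + 1) ^ 2 * (g z * max a 0))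
        = ENNReal.ofReal (((k : ℝ) + 1) ^ 2 * (g z * a)) := by
      intro a z
      have hgn : 0 ≤ g z := bump.nonneg
      rcases le_total a 0 with h | h
      · rw [max_eq_right h, mul_zero, mul_zero, ENNReal.ofReal_zero, ENNReal.ofReal_of_nonpos]
        exact mul_nonpos_of_nonneg_of_nonpos (by positivity)
          (mul_nonpos_of_nonneg_of_nonpos hgn h)
      · rw [max_eq_left h]
    simp only [tubeIntegral]
    change ∫⁻ z, ENNReal.ofReal (((k : ℝ) + 1) ^ 2 * (g z * max (G z) 0))
      = ∫⁻ z, ENNReal.ofReal (((k : ℝ) + 1) ^ 2 * (g z * max (-G z) 0))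
    simp only [hmax]
    rw [h1]
    refine lintegral_congr fun z => ?_
    congr 1
    ring
  have hp := hF.tendsto_tubeIntegral isCutoff_bump hd p1 p2 (fun z => le_max_right _ _) p3
  have hm := hF.tendsto_tubeIntegral isCutoff_bump hd m1 m2 (fun z => le_max_right _ _) m3
  rw [htube] at hp
  have heq := tendsto_nhds_unique hp hm
  rw [ENNReal.mul_right_inj lintegral_bump_ne_zero lintegral_bump_ne_top] at heq
  have hint : IntegrableOn (fun z => ‖normalFrame F z‖ ^ 2 * G z) (zeroCone F) μHE[d] :=
    hF.integrableOn_zeroCone hd (fun z hz =>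
      (hF.continuousAt_norm_sq_normalFrame hz).mul hGc.continuousAt) hGcs.mul_left fun h =>
        hG0 (tsupport_mul_subset_right h)
  rw [integral_eq_lintegral_pos_part_sub_lintegral_neg_part hint, sub_eq_zero]
  congr 1
  have hmax : ∀ (a : ℝ) (z : CSpace N), ENNReal.ofReal (‖normalFrame F z‖ ^ 2 * max a 0)
      = ENNReal.ofReal (‖normalFrame F z‖ ^ 2 * a) := by
    intro a z
    rcases le_total a 0 with h | h
    · rw [max_eq_right h, mul_zero, ENNReal.ofReal_zero, ENNReal.ofReal_of_nonpos]
      exact mul_nonpos_of_nonneg_of_nonpos (by positivity) h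
    · rw [max_eq_left h]
  simp only [coneIntegral, hmax] at heq
  rw [heq]
  refine lintegral_congr fun z => ?_
  congr 1
  ring

end ComplexCone

/-! ### Local finiteness and scaling of the area of the cone -/

namespace ComplexCone

open Set Filter Topology MeasureTheory
open scoped NNReal ENNReal Pointwise

variable {N : ℕ} {F : CSpace N → ℂ}

/-- A smooth cutoff function around a compact set. -/
lemma exists_contDiff_cutoff {K O : Set (CSpace N)} (hK : IsCompact K) (hO : IsOpen O)
    (hKO : K ⊆ O) : ∃ ρ : CSpace N → ℝ, ContDiff ℝ ∞ ρ ∧ HasCompactSupport ρ ∧ tsupport ρ ⊆ O ∧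
      (∀ z ∈ K, ∀ᶠ w in 𝓝 z, ρ w = 1) ∧ ∀ z, ρ z ∈ Icc (0 : ℝ) 1 := by
  obtain ⟨L, hL, hKL, hLO⟩ := exists_compact_between hK hO hKO
  obtain ⟨f, h1, h2, h3⟩ := exists_contMDiffMap_one_nhds_of_subset_interior
    (modelWithCornersSelf ℝ (CSpace N)) (n := (⊤ : ℕ∞)) hK.isClosed hKL
  have hs : tsupport f ⊆ L := closure_minimal (fun x hx => by
    by_contra h
    exact hx (h2 x h)) hL.isClosed
  refine ⟨f, f.contMDiff.contDiff, HasCompactSupport.intro hL h2, hs.trans hLO, fun z hz => ?_, h3⟩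
  exact (eventually_nhdsSet_iff_forall.1 h1) z hz

lemma IsRegular.measure_zeroCone_inter_lt_top (hF : IsRegular F) {d : ℕ} (hd : d + 2 = 2 * N)
    {K : Set (CSpace N)} (hK : IsCompact K) (h0 : 0 ∉ K) :
    (μHE[d] : Measure (CSpace N)) (zeroCone F ∩ K) < ⊤ := by
  obtain ⟨ρ, h1, h2, h3, h4, -⟩ := exists_contDiff_cutoff hK isOpen_compl_singleton
    (fun z hz h => h0 (h ▸ hz) : K ⊆ {0}ᶜ)
  have h5 := hF.integrableOn_zeroCone hd (fun z _ => h1.continuous.continuousAt) h2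
    (fun h => h3 h rfl)
  have h6 : (μHE[d] : Measure (CSpace N)) (zeroCone F ∩ K)
      ≤ ∫⁻ z in zeroCone F, ENNReal.ofReal ‖ρ z‖ ∂μHE[d] := by
    rw [← setLIntegral_one]
    calc ∫⁻ z in zeroCone F ∩ K, 1 ∂μHE[d]
        ≤ ∫⁻ z in zeroCone F ∩ K, ENNReal.ofReal ‖ρ z‖ ∂μHE[d] := by
          refine setLIntegral_mono' ((measurableSet_zeroCone hF).inter hK.measurableSet)
            fun z hz => ?_
          rw [(h4 z hz.2).self_of_nhds]
          simp
      _ ≤ _ := lintegral_mono_set inter_subset_left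
  refine h6.trans_lt ?_
  rw [← hasFiniteIntegral_iff_norm]
  exact h5.2

/-- `F` is homogeneous of degree `n` over the complex numbers. -/
def IsHomogeneousFun (n : ℕ) (F : CSpace N → ℂ) : Prop :=
  ∀ (t : ℂ) (z : CSpace N), F (t • z) = t ^ n * F z

variable {n : ℕ}

lemma IsHomogeneousFun.smul_mem (hh : IsHomogeneousFun n F) {t : ℝ} (ht : t ≠ 0) {z : CSpace N} :
    t • z ∈ zeroCone F ↔ z ∈ zeroCone F := by
  have ht' : (t : ℂ) ≠ 0 := by exact_mod_cast ht
  change t • z ≠ 0 ∧ F (t • z) = 0 ↔ z ≠ 0 ∧ F z = 0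
  rw [real_smul_eq, hh, mul_eq_zero, or_iff_right (pow_ne_zero n ht'), smul_ne_zero_iff_right ht']

lemma IsRegular.hasFDerivAt_complex (hF : IsRegular F) (z : CSpace N) :
    HasFDerivAt F (fderiv ℂ F z) z :=
  (hF.contDiff.differentiable (by simp) z).hasFDerivAt

lemma IsHomogeneousFun.fderiv_smul (hh : IsHomogeneousFun n F) (hF : IsRegular F) (t : ℂ)
    (z : CSpace N) : t • fderiv ℂ F (t • z) = t ^ n • fderiv ℂ F z := by
  have h1 : HasFDerivAt (fun z => F (t • z))
      ((fderiv ℂ F (t • z)).comp (t • ContinuousLinearMap.id ℂ (CSpace N))) z :=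
    (hF.hasFDerivAt_complex (t • z)).comp z ((hasFDerivAt_id z).const_smul t)
  have h2 : HasFDerivAt (fun z => F (t • z)) (t ^ n • fderiv ℂ F z) z := by
    simp_rw [hh t]
    exact (hF.hasFDerivAt_complex z).const_mul _
  rw [← h1.unique h2]
  ext v
  simp

lemma dualVec_real_smul {s : ℝ} (hs : s ≠ 0) (l : CSpace N →L[ℂ] ℂ) :
    dualVec ((s : ℂ) • l) = s⁻¹ • dualVec l := by
  have h : rieszRe ((s : ℂ) • l) = s • rieszRe l := by
    rw [← map_smul]
    rfl
  rw [dualVec, dualVec, h, norm_smul, smul_smul, smul_smul, mul_pow, Real.norm_eq_abs, sq_abs,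
    mul_inv]
  congr 1
  field_simp

lemma IsHomogeneousFun.normalFrame_smul (hh : IsHomogeneousFun n F) (hF : IsRegular F) {t : ℝ}
    (ht : 0 < t) (z : CSpace N) : normalFrame F (t • z) = (t / t ^ n) • normalFrame F z := by
  have ht' : (t : ℂ) ≠ 0 := by exact_mod_cast ht.ne'
  have h1 : fderiv ℂ F (t • z) = ((t ^ n / t : ℝ) : ℂ) • fderiv ℂ F z := by
    have h2 := hh.fderiv_smul hF (t : ℂ) z
    rw [real_smul_eq, Complex.ofReal_div, Complex.ofReal_pow, div_eq_inv_mul, mul_smul, ← h2,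
      smul_smul, inv_mul_cancel₀ ht', one_smul]
  rw [normalFrame, h1, dualVec_real_smul (by positivity), inv_div]
  rfl

/-- Euler's identity. -/
lemma IsHomogeneousFun.fderiv_self (hh : IsHomogeneousFun n F) (hF : IsRegular F) (z : CSpace N) :
    fderiv ℂ F z z = n * F z := by
  have h1 : HasDerivAt (fun t : ℂ => F (t • z)) (fderiv ℂ F ((1 : ℂ) • z) ((1 : ℂ) • z)) 1 :=
    (hF.hasFDerivAt_complex ((1 : ℂ) • z)).comp_hasDerivAt 1 ((hasDerivAt_id (1 : ℂ)).smul_const z)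
  have h2 : HasDerivAt (fun t : ℂ => F (t • z)) (n * 1 ^ (n - 1) * F z) 1 := by
    have h5 : (fun t : ℂ => F (t • z)) = fun t => t ^ n * F z := funext fun t => hh t z
    rw [h5]
    exact (hasDerivAt_pow n (1 : ℂ)).mul_const _
  simpa using h1.unique h2

/-- Euler's identity for the derivative. -/
lemma IsHomogeneousFun.hess_self (hh : IsHomogeneousFun n F) (hF : IsRegular F) (z : CSpace N) :
    hess F z z = ((n : ℂ) - 1) • fderiv ℂ F z := by
  have h0 : HasFDerivAt (fderiv ℂ F) (hess F ((1 : ℂ) • z)) ((1 : ℂ) • z) :=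
    (hF.contDiff_fderiv.differentiable (by simp) _).hasFDerivAt
  have h1 : HasDerivAt (fun t : ℂ => fderiv ℂ F (t • z)) (hess F ((1 : ℂ) • z) ((1 : ℂ) • z)) 1 :=
    h0.comp_hasDerivAt 1 ((hasDerivAt_id (1 : ℂ)).smul_const z)
  have h3 : HasDerivAt (fun t : ℂ => t • fderiv ℂ F (t • z)) _ 1 := (hasDerivAt_id (1 : ℂ)).smul h1
  have h2 : HasDerivAt (fun t : ℂ => t • fderiv ℂ F (t • z))
      ((n * 1 ^ (n - 1) : ℂ) • fderiv ℂ F z) 1 := by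
    have h5 : (fun t : ℂ => t • fderiv ℂ F (t • z)) = fun t => t ^ n • fderiv ℂ F z :=
      funext fun t => hh.fderiv_smul hF t z
    rw [h5]
    exact (hasDerivAt_pow n (1 : ℂ)).smul_const (fderiv ℂ F z)
  have h4 := h3.unique h2
  simp only [id, one_smul, one_pow, mul_one] at h4
  rw [eq_sub_of_add_eq h4]
  module

lemma IsHomogeneousFun.connForm_self (hh : IsHomogeneousFun n F) (hF : IsRegular F) {z : CSpace N}
    (hz : z ≠ 0) : connForm F z z = n - 1 := by
  rw [connForm, hh.hess_self hF, smul_apply, hF.apply_normalFrame hz, smul_eq_mul, mul_one]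

/-- The density `|∇ Re F|⁻² |z|⁻²`. For homogeneous `F` it turns the Hausdorff measure of the cone
into a measure invariant under dilations. -/
def radialDensity (F : CSpace N → ℂ) (z : CSpace N) : ℝ≥0∞ :=
  ENNReal.ofReal (‖normalFrame F z‖ ^ 2 * (‖z‖ ^ 2)⁻¹)

/-- The distribution of `log |z|²` under the measure with density `radialDensity` on the
cone. -/
def radialMeasure (F : CSpace N → ℂ) (d : ℕ) : Measure ℝ :=
  (((μHE[d] : Measure (CSpace N)).restrict (zeroCone F)).withDensity (radialDensity F)).map
    fun z => Real.log (‖z‖ ^ 2)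

lemma measurable_log_norm_sq : Measurable fun z : CSpace N => Real.log (‖z‖ ^ 2) := by
  fun_prop

lemma IsRegular.measurable_indicator (hF : IsRegular F) {Y : Type*} [TopologicalSpace Y]
    [MeasurableSpace Y] [BorelSpace Y] [Zero Y] {g : CSpace N → Y}
    (hg : ∀ z ≠ 0, ContinuousAt g z) : Measurable ((zeroCone F).indicator g) := by
  have h1 : ContinuousOn g {0}ᶜ := fun z hz => (hg z hz).continuousWithinAt
  have h2 : Measurable (({0}ᶜ : Set (CSpace N)).indicator g) := by
    rw [← piecewise_eq_indicator]
    exact h1.measurable_piecewise continuousOn_const (measurableSet_singleton _).compl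
  have h3 : (zeroCone F).indicator g
      = (zeroCone F).indicator (({0}ᶜ : Set (CSpace N)).indicator g) := by
    rw [indicator_indicator]
    congr 1
    exact (inter_eq_left.2 fun z hz => hz.1).symm
  rw [h3]
  exact h2.indicator (measurableSet_zeroCone hF)

lemma map_smul_euclideanHausdorffMeasure (d : ℕ) {t : ℝ} (ht : 0 < t) :
    (μHE[d] : Measure (CSpace N)).map (t • ·) = ENNReal.ofReal (t⁻¹ ^ d) • μHE[d] := by
  ext A hA
  rw [Measure.map_apply (measurable_const_smul t) hA]
  have h1 : (t • ·) ⁻¹' A = t⁻¹ • A := by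
    rw [← preimage_smul_inv₀ (inv_ne_zero ht.ne'), inv_inv]
  rw [h1, Measure.euclideanHausdorffMeasure_smul₀ d (inv_ne_zero ht.ne'), Measure.smul_apply,
    ENNReal.smul_def, smul_eq_mul, smul_eq_mul, ENNReal.ofReal_pow (by positivity), ENNReal.coe_pow]
  congr 2
  rw [← enorm_eq_nnnorm, Real.enorm_of_nonneg (by positivity)]

lemma IsRegular.continuousAt_radialDensity (hF : IsRegular F) {z : CSpace N} (hz : z ≠ 0) :
    ContinuousAt (radialDensity F) z := by
  refine ENNReal.continuous_ofReal.continuousAt.comp ?_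
  have : ‖z‖ ^ 2 ≠ 0 := by simpa using hz
  exact (hF.continuousAt_norm_sq_normalFrame hz).mul (ContinuousAt.inv₀ (by fun_prop) this)

lemma IsRegular.aemeasurable_radialDensity (hF : IsRegular F) (d : ℕ) :
    AEMeasurable (radialDensity F) ((μHE[d] : Measure (CSpace N)).restrict (zeroCone F)) := by
  rw [← aemeasurable_indicator_iff (measurableSet_zeroCone hF)]
  exact (hF.measurable_indicator fun z hz => hF.continuousAt_radialDensity hz).aemeasurable

lemma IsRegular.lintegral_radialMeasure (hF : IsRegular F) (d : ℕ) {g : ℝ → ℝ≥0∞}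
    (hg : Measurable g) : ∫⁻ s, g s ∂(radialMeasure F d)
      = ∫⁻ z in zeroCone F, radialDensity F z * g (Real.log (‖z‖ ^ 2)) ∂μHE[d] := by
  rw [radialMeasure, lintegral_map hg measurable_log_norm_sq,
    lintegral_withDensity_eq_lintegral_mul₀ (g := fun z => g (Real.log (‖z‖ ^ 2)))
      (hF.aemeasurable_radialDensity d)
      (hg.comp measurable_log_norm_sq).aemeasurable]
  rfl

lemma IsHomogeneousFun.radialDensity_smul (hh : IsHomogeneousFun n F) (hF : IsRegular F) {t : ℝ}
    (ht : 0 < t) (z : CSpace N) :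
    radialDensity F z = ENNReal.ofReal (t ^ (2 * n)) * radialDensity F (t • z) := by
  rw [radialDensity, radialDensity, ← ENNReal.ofReal_mul (by positivity), hh.normalFrame_smul hF ht,
    norm_smul, norm_smul, Real.norm_of_nonneg (by positivity), Real.norm_of_nonneg ht.le]
  congr 1
  rcases eq_or_ne z 0 with rfl | hz
  · simp
  have : ‖z‖ ≠ 0 := by simpa using hz
  field_simp
  ring

lemma log_norm_smul_sq {t : ℝ} (ht : 0 < t) {z : CSpace N} (hz : z ≠ 0) :
    Real.log (‖t • z‖ ^ 2) = 2 * Real.log t + Real.log (‖z‖ ^ 2) := by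
  have : ‖z‖ ≠ 0 := by simpa using hz
  rw [norm_smul, mul_pow, Real.log_mul (by simpa using ht.ne') (by positivity),
    Real.norm_of_nonneg ht.le, Real.log_pow]
  norm_num

/-- Dilations of the cone act as translations on `log |z|²`. -/
lemma IsHomogeneousFun.isAddLeftInvariant_radialMeasure (hh : IsHomogeneousFun n F)
    (hF : IsRegular F) : (radialMeasure F (2 * n)).IsAddLeftInvariant := by
  refine ⟨fun s => Measure.ext_of_lintegral _ fun g hg => ?_⟩
  set t := Real.exp (s / 2) with htdef
  have ht : 0 < t := Real.exp_pos _
  have hs : 2 * Real.log t = s := by rw [htdef, Real.log_exp]; ring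
  rw [lintegral_map hg (measurable_const_add s),
    hF.lintegral_radialMeasure _ (g := fun x => g (s + x)) (hg.comp (measurable_const_add s)),
    hF.lintegral_radialMeasure _ hg, ← lintegral_indicator (measurableSet_zeroCone hF),
    ← lintegral_indicator (measurableSet_zeroCone hF)]
  set G := (zeroCone F).indicator
    fun z => radialDensity F z * g (Real.log (‖z‖ ^ 2)) with hG
  have hGm : Measurable G := by
    have h1 : G = fun z => (zeroCone F).indicator (radialDensity F) z
        * g (Real.log (‖z‖ ^ 2)) := by
      ext z
      by_cases hz : z ∈ zeroCone F <;> simp [hG, hz]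
    rw [h1]
    exact (hF.measurable_indicator fun z hz => hF.continuousAt_radialDensity hz).mul
      (hg.comp measurable_log_norm_sq)
  have h2 : ∀ z, (zeroCone F).indicator
      (fun z => radialDensity F z * g (s + Real.log (‖z‖ ^ 2))) z
      = ENNReal.ofReal (t ^ (2 * n)) * G (t • z) := by
    intro z
    by_cases hz : z ∈ zeroCone F
    · rw [indicator_of_mem hz, hG, indicator_of_mem ((hh.smul_mem ht.ne').2 hz),
        hh.radialDensity_smul hF ht, log_norm_smul_sq ht hz.1, hs, mul_assoc]
    · rw [indicator_of_notMem hz, hG,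
        indicator_of_notMem (fun h => hz ((hh.smul_mem ht.ne').1 h)), mul_zero]
  simp_rw [h2]
  rw [lintegral_const_mul (f := fun z => G (t • z)) _ (hGm.comp (measurable_const_smul t)),
    ← lintegral_map hGm (measurable_const_smul t), map_smul_euclideanHausdorffMeasure _ ht,
    lintegral_smul_measure, smul_eq_mul, ← mul_assoc, ← ENNReal.ofReal_mul (by positivity),
    ← mul_pow, mul_inv_cancel₀ ht.ne', one_pow, ENNReal.ofReal_one, one_mul]

/-- The annulus of points with `a ≤ log |z|² ≤ b`. -/
lemma isCompact_annulus (a b : ℝ) :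
    IsCompact {z : CSpace N | Real.exp a ≤ ‖z‖ ^ 2 ∧ ‖z‖ ^ 2 ≤ Real.exp b} := by
  refine (isCompact_closedBall (0 : CSpace N) (Real.exp b + 1)).of_isClosed_subset ?_ ?_
  · have h : Continuous fun z : CSpace N => ‖z‖ ^ 2 := by fun_prop
    exact (isClosed_le continuous_const h).inter (isClosed_le h continuous_const)
  · rintro z ⟨-, hz⟩
    rw [mem_closedBall_zero_iff]
    nlinarith [norm_nonneg z, sq_nonneg (‖z‖ - 1)]

lemma IsRegular.isFiniteMeasureOnCompacts_radialMeasure (hF : IsRegular F) {d : ℕ}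
    (hd : d + 2 = 2 * N) : IsFiniteMeasureOnCompacts (radialMeasure F d) := by
  refine ⟨fun K hK => ?_⟩
  obtain ⟨R, hR⟩ := hK.isBounded.subset_closedBall 0
  set A : Set (CSpace N) := {z | Real.exp (-R) ≤ ‖z‖ ^ 2 ∧ ‖z‖ ^ 2 ≤ Real.exp R} with hA
  have hAc : IsCompact A := isCompact_annulus _ _
  have hA0 : 0 ∉ A := fun h => by
    have := h.1
    rw [norm_zero] at this
    have := Real.exp_pos (-R)
    nlinarith
  have h1 : radialMeasure F d K ≤ ∫⁻ z in zeroCone F ∩ A, radialDensity F z ∂μHE[d] := by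
    rw [← lintegral_indicator_one hK.measurableSet, hF.lintegral_radialMeasure d
      (measurable_one.indicator hK.measurableSet), setLIntegral_eq_of_forall_notMem
      (s := zeroCone F) hAc.measurableSet (t := A)]
    · refine lintegral_mono' le_rfl fun z => ?_
      refine mul_le_of_le_one_right' ?_
      exact indicator_le_self' (fun _ _ => zero_le_one) _
    · intro z hz
      by_cases hz0 : z = 0
      · subst hz0
        simp [radialDensity]
      have hz1 : 0 < ‖z‖ ^ 2 := by
        have : 0 < ‖z‖ := norm_pos_iff.2 hz0
        positivity
      rw [indicator_of_notMem, mul_zero]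
      intro h
      apply hz
      have h2 := hR h
      rw [Real.closedBall_eq_Icc, zero_sub, zero_add] at h2
      exact ⟨(Real.le_log_iff_exp_le hz1).1 h2.1, (Real.log_le_iff_le_exp hz1).1 h2.2⟩
  refine h1.trans_lt ?_
  obtain ⟨B, hB⟩ := hAc.bddAbove_image (f := fun z => ‖normalFrame F z‖ ^ 2 * (‖z‖ ^ 2)⁻¹) (by
    intro z hz
    have hz0 : z ≠ 0 := fun h => hA0 (h ▸ hz)
    have : ‖z‖ ^ 2 ≠ 0 := by simpa using hz0
    exact ((hF.continuousAt_norm_sq_normalFrame hz0).mul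
      (ContinuousAt.inv₀ (by fun_prop) this)).continuousWithinAt)
  calc ∫⁻ z in zeroCone F ∩ A, radialDensity F z ∂μHE[d]
      ≤ ∫⁻ z in zeroCone F ∩ A, ENNReal.ofReal B ∂μHE[d] := by
        refine setLIntegral_mono' ((measurableSet_zeroCone hF).inter hAc.measurableSet)
          fun z hz => ?_
        exact ENNReal.ofReal_le_ofReal (hB ⟨z, hz.2, rfl⟩)
    _ = ENNReal.ofReal B * μHE[d] (zeroCone F ∩ A) := setLIntegral_const _ _
    _ < ⊤ := ENNReal.mul_lt_top ENNReal.ofReal_lt_top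
        (hF.measure_zeroCone_inter_lt_top hd hAc hA0)

/-- The distribution of `log |z|²` is a multiple of Lebesgue measure, by uniqueness of Haar
measure. -/
lemma IsHomogeneousFun.exists_radialMeasure_eq (hh : IsHomogeneousFun n F) (hF : IsRegular F)
    (hd : 2 * n + 2 = 2 * N) :
    ∃ a : ℝ≥0, radialMeasure F (2 * n) = a • (volume : Measure ℝ) := by
  have := hh.isAddLeftInvariant_radialMeasure hF
  have := hF.isFiniteMeasureOnCompacts_radialMeasure hd
  exact ⟨_, Measure.isAddLeftInvariant_eq_smul _ _⟩

lemma IsRegular.measure_zeroCone_ne_zero (hF : IsRegular F) {d : ℕ} (hd : d + 2 = 2 * N)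
    (hne : (zeroCone F).Nonempty) : (μHE[d] : Measure (CSpace N)) (zeroCone F) ≠ 0 := by
  obtain ⟨p, hp⟩ := hne
  obtain ⟨e, hpe, hsub, he, -, hLip, -⟩ := exists_biLipschitz_chart
    (hF.contDiff_flattening p) (hF.hasFDerivAt_flattening p) (K := 2) (by norm_num)
    (isOpen_ne.mem_nhds hp.1)
  have hl := hF.fderiv_ne_zero p hp.1
  have hfin : Module.finrank ℝ (kerReal (fderiv ℂ F p)) = d := by
    have := finrank_kerReal hl
    omega
  have hpt : p ∈ e.target := by
    have h := e.map_source hpe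
    rwa [he, flattening_self] at h
  -- the affine tangent space at `p` meets the target of the chart in a set of positive measure
  have hpos : 0 < ∫⁻ t : kerReal (fderiv ℂ F p),
      e.target.indicator (1 : CSpace N → ℝ≥0∞) (p + t) := by
    have hopen : IsOpen {t : kerReal (fderiv ℂ F p) | p + (t : CSpace N) ∈ e.target} :=
      e.open_target.preimage (by fun_prop)
    have h1 : (fun t : kerReal (fderiv ℂ F p) =>
        e.target.indicator (1 : CSpace N → ℝ≥0∞) (p + t))
        = {t : kerReal (fderiv ℂ F p) | p + (t : CSpace N) ∈ e.target}.indicator 1 := rfl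
    rw [h1, lintegral_indicator_one hopen.measurableSet]
    exact hopen.measure_pos _ ⟨0, by simpa using hpt⟩
  have hcl : MeasurableSet {y | fderiv ℂ F p (y - p) = 0} :=
    (isClosed_singleton.preimage (f := fun y => fderiv ℂ F p (y - p)) (by fun_prop)).measurableSet
  rw [lintegral_affine_kerReal p hfin (measurable_one.indicator e.open_target.measurableSet),
    setLIntegral_indicator e.open_target.measurableSet, inter_comm,
    ← hF.image_flattening_eq hp he hsub] at hpos
  intro h0
  have h1 := lintegral_image_le_of_lipschitzOn d (hLip.mono inter_subset_right)
    ((measurableSet_zeroCone hF).inter e.open_source.measurableSet)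
    (g := (1 : CSpace N → ℝ≥0∞)) measurable_one
  have h2 : (μHE[d] : Measure (CSpace N)) (zeroCone F ∩ e.source) = 0 :=
    measure_mono_null inter_subset_left h0
  rw [setLIntegral_measure_zero (zeroCone F ∩ e.source) _ h2, mul_zero] at h1
  exact absurd hpos (not_lt.2 h1)

lemma IsRegular.radialMeasure_ne_zero (hF : IsRegular F) {d : ℕ} (hd : d + 2 = 2 * N)
    (hne : (zeroCone F).Nonempty) : radialMeasure F d ≠ 0 := by
  intro h
  have h1 := hF.lintegral_radialMeasure d (g := 1) measurable_one
  simp only [h, lintegral_zero_measure, Pi.one_apply, mul_one] at h1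
  rw [eq_comm, setLIntegral_eq_zero_iff' (measurableSet_zeroCone hF)
    (hF.aemeasurable_radialDensity d)] at h1
  refine hF.measure_zeroCone_ne_zero hd hne (measure_mono_null
    (t := {z | ¬(z ∈ zeroCone F → radialDensity F z = 0)}) (fun z hz h2 => ?_) (ae_iff.1 h1))
  have hz0 : 0 < ‖z‖ ^ 2 := by
    have := norm_pos_iff.2 hz.1
    positivity
  have h3 := h2 hz
  rw [radialDensity, ENNReal.ofReal_eq_zero] at h3
  exact absurd (mul_pos (hF.norm_sq_normalFrame_pos hz.1) (inv_pos.2 hz0)) (not_lt.2 h3)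

/-- The link of the cone has measure zero in the dimension of the cone: it is a level set of
`log |z|²`, whose distribution has no atoms. -/
lemma IsHomogeneousFun.measure_zeroCone_inter_sphere (hh : IsHomogeneousFun n F)
    (hF : IsRegular F) (hd : 2 * n + 2 = 2 * N) :
    (μHE[2 * n] : Measure (CSpace N)) (zeroCone F ∩ Metric.sphere 0 1) = 0 := by
  obtain ⟨a, ha⟩ := hh.exists_radialMeasure_eq hF hd
  have h1 : radialMeasure F (2 * n) {0} = 0 := by simp [ha]
  rw [← lintegral_indicator_one (measurableSet_singleton 0), hF.lintegral_radialMeasure _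
      (measurable_one.indicator (measurableSet_singleton 0))] at h1
  have h2 : ∫⁻ z in zeroCone F ∩ Metric.sphere 0 1, radialDensity F z ∂μHE[2 * n] = 0 := by
    refine le_antisymm ?_ zero_le
    rw [← h1]
    refine le_trans ?_ (lintegral_mono_set (inter_subset_left (t := Metric.sphere 0 1)))
    refine setLIntegral_mono'
      ((measurableSet_zeroCone hF).inter Metric.isClosed_sphere.measurableSet)
      fun z hz => ?_
    have h3 : ‖z‖ = 1 := mem_sphere_zero_iff_norm.1 hz.2
    simp [h3]
  rw [lintegral_eq_zero_iff'] at h2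
  · rw [← Measure.restrict_eq_zero, ← ae_eq_bot, ← Filter.eventually_false_iff_eq_bot]
    filter_upwards [h2, ae_restrict_mem ((measurableSet_zeroCone hF).inter
      Metric.isClosed_sphere.measurableSet)] with z hz hz'
    have h3 : ‖z‖ = 1 := mem_sphere_zero_iff_norm.1 hz'.2
    have h4 := hF.norm_sq_normalFrame_pos hz'.1.1
    simp only [radialDensity, h3, Pi.zero_apply, ENNReal.ofReal_eq_zero] at hz
    norm_num at hz
    exact (hF.norm_sq_normalFrame_pos hz'.1.1).ne' (by simp [hz])
  · refine ContinuousOn.aemeasurable (fun z hz => ?_)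
      ((measurableSet_zeroCone hF).inter Metric.isClosed_sphere.measurableSet)
    exact (hF.continuousAt_radialDensity hz.1.1).continuousWithinAt

end ComplexCone

/-! ### The vector field calibrating the stability inequality -/

namespace ComplexCone

open Set Filter Topology MeasureTheory

variable {N : ℕ} {F : CSpace N → ℂ} {p : CSpace N} {m : ℕ}
  {c : OrthonormalBasis (Fin m ⊕ Fin m) ℝ (kerReal (fderiv ℂ F p))}

/-- The real trace of an endomorphism of `ℂ^N`, split along a complex hyperplane. -/
lemma trace_eq_sum_kerReal {l : CSpace N →L[ℂ] ℂ} (hl : l ≠ 0) {κ : Type*} [Fintype κ]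
    (c : OrthonormalBasis κ ℝ (kerReal l)) (L : CSpace N →L[ℝ] CSpace N) :
    LinearMap.trace ℝ (CSpace N) (L : CSpace N →ₗ[ℝ] CSpace N)
      = ∑ k, inner ℝ (c k : CSpace N) (L (c k)) + (l (L (dualVec l))).re
        + (l (L (Complex.I • dualVec l))).im := by
  let lre : CSpace N →ₗ[ℝ] ℝ := Complex.reLm ∘ₗ (l.restrictScalars ℝ : CSpace N →ₗ[ℝ] ℂ) ∘ₗ L
  let lim : CSpace N →ₗ[ℝ] ℝ := Complex.imLm ∘ₗ (l.restrictScalars ℝ : CSpace N →ₗ[ℝ] ℂ) ∘ₗ L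
  let lk : κ → CSpace N →ₗ[ℝ] ℝ := fun k => (innerₗ (CSpace N) (c k : CSpace N)) ∘ₗ L
  have h : (L : CSpace N →ₗ[ℝ] CSpace N) = ∑ k, (lk k).smulRight (c k : CSpace N)
      + lre.smulRight (dualVec l) + lim.smulRight (Complex.I • dualVec l) := by
    ext1 v
    have h1 : L v = (kerReal l).starProjection (L v) + l (L v) • dualVec l := by
      rw [starProjection_kerReal hl]
      simp
    have h2 : (kerReal l).starProjection (L v)
        = ∑ k, inner ℝ (c k : CSpace N) (L v) • (c k : CSpace N) := by
      rw [Submodule.starProjection_apply,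
        ← c.sum_repr' ((kerReal l).orthogonalProjectionOnto (L v)),
        Submodule.coe_sum]
      refine Finset.sum_congr rfl fun k _ => ?_
      rw [Submodule.inner_orthogonalProjectionOnto_eq_of_mem_left]
      rfl
    have h3 : l (L v) • dualVec l = (l (L v)).re • dualVec l
        + (l (L v)).im • Complex.I • dualVec l := by
      rw [real_smul_eq, real_smul_eq, smul_smul, ← add_smul, Complex.re_add_im]
    change L v = _
    conv_lhs => rw [h1, h2, h3, ← add_assoc]
    simp [lk, lre, lim]
  rw [h, map_add, map_add, map_sum]
  simp only [LinearMap.trace_smulRight]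
  rfl

/-- Multiplication by `i`, as a real linear map. -/
def mulI (N : ℕ) : CSpace N →L[ℝ] CSpace N := Complex.I • ContinuousLinearMap.id ℝ (CSpace N)

@[simp] lemma mulI_apply (v : CSpace N) : mulI N v = Complex.I • v := rfl

/-- The one-form `v ↦ Im (conj Φ · ∇_{iv} Φ)`, where `∇ = d - θ`. -/
def rotForm (F Φ : CSpace N → ℂ) (z : CSpace N) : CSpace N →L[ℝ] ℝ :=
  Complex.imCLM ∘L ((starRingEnd ℂ) (Φ z) • (fderiv ℝ Φ z ∘L mulI N))
    - (‖Φ z‖ ^ 2) • (Complex.reCLM ∘L (hess F z (normalFrame F z)).restrictScalars ℝ)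

lemma IsRegular.rotForm_apply (hF : IsRegular F) (Φ : CSpace N → ℂ) (z v : CSpace N) :
    rotForm F Φ z v = ((starRingEnd ℂ) (Φ z) * fderiv ℝ Φ z (Complex.I • v)).im
      - ‖Φ z‖ ^ 2 * (connForm F z v).re := by
  rw [connForm, hF.hess_comm]
  simp [rotForm]

/-- The vector field dual to `rotForm`, made tangent to the level sets of `F`. -/
def rotField (F Φ : CSpace N → ℂ) (z : CSpace N) : CSpace N :=
  levelProj F z (rieszReal (rotForm F Φ z))

lemma IsRegular.fderiv_rotField (hF : IsRegular F) (hp : p ≠ 0) (Φ : CSpace N → ℂ) :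
    fderiv ℂ F p (rotField F Φ p) = 0 := hF.fderiv_levelProj hp _

lemma IsRegular.levelProj_eq (hF : IsRegular F) (hp : p ≠ 0) (w : CSpace N) :
    levelProj F p w = (kerReal (fderiv ℂ F p)).starProjection w :=
  (starProjection_kerReal (hF.fderiv_ne_zero p hp) w).symm

lemma IsRegular.inner_rotField (hF : IsRegular F) (hp : p ≠ 0) (Φ : CSpace N → ℂ) (w : CSpace N) :
    inner ℝ w (rotField F Φ p) = rotForm F Φ p (levelProj F p w) := by
  rw [rotField, hF.levelProj_eq hp, hF.levelProj_eq hp,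
    ← Submodule.inner_starProjection_left_eq_right,
    real_inner_comm, inner_rieszReal]

lemma contDiff_restrictScalars {G : Type*} [NormedAddCommGroup G] [NormedSpace ℂ G]
    {a : CSpace N → CSpace N →L[ℂ] G} (ha : ContDiff ℝ ∞ a) :
    ContDiff ℝ ∞ fun z => (a z).restrictScalars ℝ :=
  (ContinuousLinearMap.restrictScalarsIsometry ℂ (CSpace N) G ℝ ℝ).contDiff.comp ha

lemma IsRegular.contDiffAt_rotField (hF : IsRegular F) (hp : p ≠ 0) {Φ : CSpace N → ℂ}
    (hΦ : ContDiff ℝ ∞ Φ) : ContDiffAt ℝ ∞ (rotField F Φ) p := by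
  have hJ := hF.contDiffAt_normalFrame hp
  have h1 : ContDiff ℝ ∞ (fderiv ℝ Φ) := hΦ.fderiv_right (by simp)
  have h2 : ContDiff ℝ ∞ (fun z => (starRingEnd ℂ) (Φ z)) := Complex.conjCLE.contDiff.comp hΦ
  have h3 : ContDiffAt ℝ ∞ (fun z => (hess F z (normalFrame F z)).restrictScalars ℝ) p := by
    have h6 := contDiff_restrictScalars (hF.contDiff_hess.restrict_scalars ℝ)
    exact (ContinuousLinearMap.restrictScalarsL ℂ (CSpace N) ℂ ℝ ℝ).contDiff.contDiffAt.comp p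
      (h6.contDiffAt.clm_apply hJ)
  have h4 : ContDiffAt ℝ ∞ (rotForm F Φ) p := by
    refine ContDiffAt.sub ?_ ?_
    · exact (contDiff_const.clm_comp (h2.smul (h1.clm_comp contDiff_const))).contDiffAt
    · exact (hΦ.norm_sq ℝ).contDiffAt.smul (contDiffAt_const.clm_comp h3)
  have h5 : ContDiffAt ℝ ∞ (fun z => rieszReal (rotForm F Φ z)) p :=
    rieszReal.contDiff.contDiffAt.comp p h4
  have h6 : ContDiff ℝ ∞ fun z => (fderiv ℂ F z).restrictScalars ℝ :=
    (ContinuousLinearMap.restrictScalarsL ℂ (CSpace N) ℂ ℝ ℝ).contDiff.comp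
      (hF.contDiff_fderiv.restrict_scalars ℝ)
  exact h5.sub ((h6.contDiffAt.clm_apply h5).smul hJ)

/-- The covariant derivative of `Φ J`, as a multiple of `J`. -/
def covDeriv (F Φ : CSpace N → ℂ) (z v : CSpace N) : ℂ :=
  fderiv ℝ Φ z v - Φ z * connForm F z v

lemma IsRegular.inner_fderiv_rotField (hF : IsRegular F) (hp : p ≠ 0) {Φ : CSpace N → ℂ}
    (hΦ : ContDiff ℝ ∞ Φ) {E : CSpace N} (hE : fderiv ℂ F p E = 0) :
    inner ℝ E (fderiv ℝ (rotField F Φ) p E)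
      = ((starRingEnd ℂ) (fderiv ℝ Φ p E) * fderiv ℝ Φ p (Complex.I • E)
          + (starRingEnd ℂ) (Φ p) * (fderiv ℝ (fderiv ℝ Φ) p E (Complex.I • E)
            - fderiv ℝ Φ p (Complex.I • hess F p E E • normalFrame F p))).im
        - 2 * ((starRingEnd ℂ) (Φ p) * fderiv ℝ Φ p E).re * (connForm F p E).re
        - ‖Φ p‖ ^ 2 * (fderiv ℂ (hess F) p E E (normalFrame F p)
            - hess F p E E * connForm F p (normalFrame F p)
            + hess F p E (fderiv ℝ (normalFrame F) p E)).re := by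
  have hX : HasFDerivAt (rotField F Φ) (fderiv ℝ (rotField F Φ) p) p :=
    ((hF.contDiffAt_rotField hp hΦ).differentiableAt (by simp)).hasFDerivAt
  have h1 : HasFDerivAt (fun z => inner ℝ E (rotField F Φ z))
      ((innerSL ℝ E).comp (fderiv ℝ (rotField F Φ) p)) p :=
    (innerSL ℝ E).hasFDerivAt.comp p hX
  have hΦd : HasFDerivAt Φ (fderiv ℝ Φ p) p := (hΦ.differentiable (by simp) p).hasFDerivAt
  have h2 : HasFDerivAt (fderiv ℝ Φ) (fderiv ℝ (fderiv ℝ Φ) p) p :=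
    ((hΦ.fderiv_right (m := ∞) (by simp)).differentiable (by simp) p).hasFDerivAt
  obtain ⟨L, hL, hL'⟩ := hF.exists_hasFDerivAt_levelProj hp E
  obtain ⟨L1, h3, h3'⟩ := exists_hasFDerivAt_apply (hF.hasFDerivAt_hess p) hL
  obtain ⟨L2, h4, h4'⟩ := exists_hasFDerivAt_apply h3 (hF.hasFDerivAt_normalFrame hp)
  have h5 : HasFDerivAt (fun z => mulI N (levelProj F z E)) (mulI N ∘L L) p :=
    (mulI N).hasFDerivAt.comp p hL
  have h6 : HasFDerivAt (fun z => (starRingEnd ℂ) (Φ z))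
      ((Complex.conjCLE : ℂ →L[ℝ] ℂ) ∘L fderiv ℝ Φ p) p :=
    (Complex.conjCLE : ℂ →L[ℝ] ℂ).hasFDerivAt.comp p hΦd
  have h7 := Complex.imCLM.hasFDerivAt.comp p (h6.mul (h2.clm_apply h5))
  have h8 := hΦd.norm_sq.mul (Complex.reCLM.hasFDerivAt.comp p h4)
  have h9 := h7.sub h8
  have h10 : (fun z => inner ℝ E (rotField F Φ z)) =ᶠ[𝓝 p] fun z =>
      ((starRingEnd ℂ) (Φ z) * fderiv ℝ Φ z (mulI N (levelProj F z E))).im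
        - ‖Φ z‖ ^ 2 * (hess F z (levelProj F z E) (normalFrame F z)).re := by
    filter_upwards [isOpen_ne.mem_nhds hp] with z hz
    rw [hF.inner_rotField hz, hF.rotForm_apply]
    rfl
  have h11 := (h9.congr_of_eventuallyEq h10).unique h1
  have h12 := congrArg (fun T : CSpace N →L[ℝ] ℝ => T E) h11
  have hPE : levelProj F p E = E := by simp [levelProj, hE]
  simp only [ContinuousLinearMap.comp_apply, innerSL_apply_apply, Function.comp] at h12
  rw [← h12]
  have h13 : ∀ x y : ℂ, inner ℝ x y = ((starRingEnd ℂ) x * y).re := fun x y => by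
    rw [Complex.inner, mul_comm]
  simp only [sub_apply, add_apply, smul_apply, ContinuousLinearMap.comp_apply,
    ContinuousLinearMap.flip_apply, h4', h3', hL', hE, hPE, mulI_apply, zero_smul, add_zero,
    innerSL_apply_apply, h13, ContinuousLinearMap.coe_restrictScalars', map_neg,
    map_smul, neg_apply, smul_eq_mul, Complex.reCLM_apply, Complex.imCLM_apply, nsmul_eq_mul,
    connForm, ContinuousLinearEquiv.coe_coe, Complex.conjCLE_apply]
  simp only [Complex.sub_re, Complex.add_re, Complex.add_im, Complex.mul_im, Complex.sub_im,
    Complex.sub_re, Complex.neg_im, Complex.neg_re, Nat.cast_ofNat]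
  ring

/-- The divergence of `rotField` on the cone: up to the curvature term it is the sum of the
Jacobians of the covariant derivative over an orthonormal basis of complex lines. -/
lemma IsRegular.divergence_rotField (hF : IsRegular F) (hp : p ≠ 0) {Φ : CSpace N → ℂ}
    (hΦ : ContDiff ℝ ∞ Φ) (hc : IsComplexBasis c) :
    divergence (rotField F Φ) p
      = ∑ k, 2 * ((starRingEnd ℂ) (covDeriv F Φ p (c (Sum.inl k)))
          * covDeriv F Φ p (c (Sum.inr k))).im
        - 2 * ‖normalFrame F p‖ ^ 2 * hessSq F p c * ‖Φ p‖ ^ 2 := by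
  have hl := hF.fderiv_ne_zero p hp
  have hX : HasFDerivAt (rotField F Φ) (fderiv ℝ (rotField F Φ) p) p :=
    ((hF.contDiffAt_rotField hp hΦ).differentiableAt (by simp)).hasFDerivAt
  set X := rotField F Φ p with hXdef
  set L := fderiv ℝ (rotField F Φ) p with hLdef
  -- the normal part of the derivative
  have hnor : ∀ v, fderiv ℂ F p (L v) = -hess F p v X := by
    intro v
    obtain ⟨T, hT, hT'⟩ := exists_hasFDerivAt_apply (hF.hasFDerivAt_fderiv p) hX
    have h1 : (fun z => fderiv ℂ F z (rotField F Φ z)) =ᶠ[𝓝 p] fun _ => 0 := by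
      filter_upwards [isOpen_ne.mem_nhds hp] with z hz
      exact hF.fderiv_rotField hz Φ
    have h2 := (hT.congr_of_eventuallyEq h1.symm).unique (hasFDerivAt_const (0 : ℂ) p)
    have h3 := hT' v
    rw [h2] at h3
    simp only [zero_apply, ContinuousLinearMap.coe_restrictScalars'] at h3
    exact eq_neg_of_add_eq_zero_right h3.symm
  have hXsum : X = ∑ k, rotForm F Φ p (c k) • (c k : CSpace N) := by
    have h1 : X ∈ kerReal (fderiv ℂ F p) := mem_kerReal.2 (hF.fderiv_rotField hp Φ)
    have h2 := congrArg (fun x : kerReal (fderiv ℂ F p) => (x : CSpace N)) (c.sum_repr' ⟨X, h1⟩)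
    simp only [Submodule.coe_sum, Submodule.coe_smul] at h2
    rw [← h2]
    refine Finset.sum_congr rfl fun k _ => ?_
    congr 1
    have h3 : levelProj F p (c k) = c k := by simp [levelProj, apply_basis c k]
    have h4 := hF.inner_rotField hp Φ (c k)
    rw [h3] at h4
    exact h4
  have hθX : (connForm F p X).re = ∑ k, rotForm F Φ p (c k) * (connForm F p (c k)).re := by
    have h1 : connForm F p X = ∑ k, rotForm F Φ p (c k) * connForm F p (c k) := by
      conv_lhs => rw [hXsum]
      simp only [connForm]
      rw [map_sum, sum_apply]
      refine Finset.sum_congr rfl fun k _ => ?_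
      rw [hess_real_smul_left]
    rw [h1, Complex.re_sum]
    simp only [Complex.re_ofReal_mul]
  have hdiv : divergence (rotField F Φ) p
      = ∑ k, inner ℝ (c k : CSpace N) (L (c k)) - 2 * (connForm F p X).re := by
    rw [divergence, trace_eq_sum_kerReal hl c]
    change _ + (fderiv ℂ F p (L (normalFrame F p))).re
      + (fderiv ℂ F p (L (Complex.I • normalFrame F p))).im = _
    have e1 : fderiv ℂ F p (L (normalFrame F p)) = -connForm F p X := by
      rw [hnor, hF.hess_comm]
      rfl
    have e2 : fderiv ℂ F p (L (Complex.I • normalFrame F p)) = -(Complex.I * connForm F p X) := by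
      rw [hnor, hF.hess_comm, map_smul]
      rfl
    rw [e1, e2]
    simp only [Complex.neg_re, Complex.neg_im, Complex.I_mul_im]
    ring
  have hsymm : ∀ v w, fderiv ℝ (fderiv ℝ Φ) p v w = fderiv ℝ (fderiv ℝ Φ) p w v :=
    hΦ.contDiffAt.isSymmSndFDerivAt (by
      rw [minSmoothness_of_isRCLikeNormedField]
      exact WithTop.coe_le_coe.2 (le_top : (2 : ℕ∞) ≤ ⊤))
  -- the second derivatives of `Φ` cancel in each complex line
  have hpair : ∀ k : Fin m,
      (inner ℝ (c (Sum.inl k) : CSpace N) (L (c (Sum.inl k)))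
        - 2 * (rotForm F Φ p (c (Sum.inl k)) * (connForm F p (c (Sum.inl k))).re))
      + (inner ℝ (c (Sum.inr k) : CSpace N) (L (c (Sum.inr k)))
        - 2 * (rotForm F Φ p (c (Sum.inr k)) * (connForm F p (c (Sum.inr k))).re))
      = 2 * ((starRingEnd ℂ) (covDeriv F Φ p (c (Sum.inl k)))
          * covDeriv F Φ p (c (Sum.inr k))).im
        - ‖Φ p‖ ^ 2 * (hess F p (c (Sum.inl k)) (fderiv ℝ (normalFrame F) p (c (Sum.inl k)))
          + hess F p (c (Sum.inr k)) (fderiv ℝ (normalFrame F) p (c (Sum.inr k)))).re := by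
    intro k
    have hI : Complex.I • (c (Sum.inr k) : CSpace N) = -(c (Sum.inl k) : CSpace N) := by
      rw [hc k, smul_smul, Complex.I_mul_I, neg_one_smul]
    have hII : Complex.I • (c (Sum.inl k) : CSpace N) = c (Sum.inr k) := (hc k).symm
    have b1 : connForm F p (c (Sum.inr k)) = Complex.I * connForm F p (c (Sum.inl k)) := by
      simp [connForm, hc k]
    have b2 : hess F p (c (Sum.inr k)) (c (Sum.inr k))
        = -hess F p (c (Sum.inl k)) (c (Sum.inl k)) := by
      rw [hc k]
      simp only [map_smul, smul_apply, smul_smul, Complex.I_mul_I]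
      simp
    have b3 : fderiv ℂ (hess F) p (c (Sum.inr k)) (c (Sum.inr k)) (normalFrame F p)
        = -fderiv ℂ (hess F) p (c (Sum.inl k)) (c (Sum.inl k)) (normalFrame F p) := by
      rw [hc k]
      simp only [map_smul, smul_apply, smul_smul, Complex.I_mul_I]
      simp
    rw [hF.inner_fderiv_rotField hp hΦ (apply_basis c _),
      hF.inner_fderiv_rotField hp hΦ (apply_basis c _), hF.rotForm_apply, hF.rotForm_apply,
      hI, hII, b1, b2, b3, map_neg, map_neg, hsymm (c (Sum.inr k)) (c (Sum.inl k))]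
    simp only [covDeriv, b1, neg_smul, smul_neg, map_neg]
    generalize fderiv ℝ Φ p (c (Sum.inl k)) = a
    generalize fderiv ℝ Φ p (c (Sum.inr k)) = b
    generalize connForm F p (c (Sum.inl k)) = t
    generalize fderiv ℝ (fderiv ℝ Φ) p (c (Sum.inl k)) (c (Sum.inr k)) = D
    rw [← Complex.normSq_eq_norm_sq, Complex.normSq_apply]
    generalize Φ p = φ
    simp only [Complex.mul_im, Complex.mul_re, Complex.add_re, Complex.add_im, Complex.sub_re,
      Complex.sub_im, Complex.neg_re, Complex.neg_im, Complex.conj_re, Complex.conj_im,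
      Complex.I_re, Complex.I_im, map_sub, map_mul]
    ring
  have hK := congrArg Complex.re (hF.sum_hess_fderiv_normalFrame hp hc)
  rw [Complex.ofReal_re, Fintype.sum_sum_type, ← Finset.sum_add_distrib, Complex.re_sum] at hK
  rw [hdiv, hθX, Finset.mul_sum, ← Finset.sum_sub_distrib, Fintype.sum_sum_type,
    ← Finset.sum_add_distrib, Finset.sum_congr rfl fun k _ => hpair k, Finset.sum_sub_distrib,
    ← Finset.mul_sum, ← Finset.mul_sum, hK]
  ring

end ComplexCone

/-! ### Test fields as multiples of the normal frame -/

namespace ComplexCone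

open Set Filter Topology MeasureTheory

variable {N : ℕ} {F : CSpace N → ℂ} {p : CSpace N} {V : CSpace N → CSpace N}

lemma truncation_inter_ball (F : CSpace N → ℂ) :
    ConeGeometry.truncation (zeroCone F) ∩ Metric.ball 0 1 = zeroCone F ∩ Metric.ball 0 1 := by
  rw [ConeGeometry.truncation, inter_assoc, inter_eq_right.2 Metric.ball_subset_closedBall]

lemma IsRegular.isClosed_truncation_union (hF : IsRegular F) (h0 : F 0 = 0) :
    IsClosed (ConeGeometry.truncation (zeroCone F) ∪ {0}) := by
  have h : ConeGeometry.truncation (zeroCone F) ∪ {0} = {z | F z = 0} ∩ Metric.closedBall 0 1 := by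
    ext z
    by_cases hz : z = 0
    · subst hz
      simp [h0]
    · simp [ConeGeometry.truncation, zeroCone, hz]
  rw [h]
  exact (isClosed_singleton.preimage hF.contDiff.continuous).inter Metric.isClosed_closedBall

/-- A test field on the truncated cone extends to a smooth field on `ℂ^N` whose support is compact
and does not contain the vertex: local extensions, taken to be zero off the truncated cone and near
the vertex, are glued by a partition of unity. -/
lemma IsRegular.exists_extension (hF : IsRegular F) (h0 : F 0 = 0)
    (hV : ConeGeometry.IsTestField (zeroCone F) V) :
    ∃ W : CSpace N → CSpace N, ContDiff ℝ ∞ W ∧ HasCompactSupport W ∧ 0 ∉ tsupport W ∧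
      ∀ z ∈ ConeGeometry.truncation (zeroCone F), W z = V z := by
  obtain ⟨⟨hsm, -⟩, ⟨K, hKC, hK, hVK⟩, -⟩ := hV
  set C₁ := ConeGeometry.truncation (zeroCone F)
  have hK0 : (0 : CSpace N) ∉ K := fun h => (hKC h).1.1 rfl
  obtain ⟨r, hr, hrK⟩ := Metric.isOpen_iff.1 hK.isClosed.isOpen_compl 0 hK0
  have hVr : ∀ z ∈ C₁, ‖z‖ < r → V z = 0 := fun z hz hzr =>
    hVK z ⟨hz, hrK (mem_ball_zero_iff.2 hzr)⟩
  -- the constraints on the value of the extension at `z`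
  let t : CSpace N → Set (CSpace N) := fun z =>
    {v | (z ∈ C₁ → v = V z) ∧ (‖z‖ < r / 2 → v = 0) ∧ (2 ≤ ‖z‖ → v = 0)}
  have ht : ∀ z, Convex ℝ (t z) := by
    intro z x hx y hy a b ha hb hab
    refine ⟨fun h => ?_, fun h => ?_, fun h => ?_⟩
    · rw [hx.1 h, hy.1 h, ← add_smul, hab, one_smul]
    · rw [hx.2.1 h, hy.2.1 h]
      simp
    · rw [hx.2.2 h, hy.2.2 h]
      simp
  have hloc : ∀ z : CSpace N, ∃ U ∈ 𝓝 z, ∃ g : CSpace N → CSpace N,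
      ContMDiffOn (modelWithCornersSelf ℝ (CSpace N)) (modelWithCornersSelf ℝ (CSpace N)) ∞ g U ∧
        ∀ y ∈ U, g y ∈ t y := by
    intro z
    rcases lt_or_ge ‖z‖ r with hz | hz
    · refine ⟨Metric.ball 0 r, Metric.isOpen_ball.mem_nhds (mem_ball_zero_iff.2 hz), fun _ => 0,
        contMDiffOn_const, fun y hy => ⟨fun h => ?_, fun _ => rfl, fun _ => rfl⟩⟩
      exact (hVr y h (mem_ball_zero_iff.1 hy)).symm
    · have hz0 : z ≠ 0 := by
        rintro rfl
        rw [norm_zero] at hz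
        linarith
      by_cases hzC : z ∈ C₁
      · obtain ⟨U, g, hU, hzU, hg, hgV⟩ := hsm z hzC
        have hz1 : ‖z‖ ≤ 1 := by simpa using hzC.2
        refine ⟨U ∩ ({y | r / 2 < ‖y‖} ∩ {y | ‖y‖ < 2}), ?_, g,
          (hg.mono inter_subset_left).contMDiffOn, fun y hy => ⟨fun h => ?_, fun h => ?_,
            fun h => ?_⟩⟩
        · refine inter_mem (hU.mem_nhds hzU) (inter_mem ?_ ?_)
          · exact (isOpen_lt continuous_const continuous_norm).mem_nhds (by
              change r / 2 < ‖z‖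
              linarith)
          · exact (isOpen_lt continuous_norm continuous_const).mem_nhds (by
              change ‖z‖ < 2
              linarith)
        · exact (hgV y ⟨hy.1, h⟩).symm
        · exact (lt_asymm h hy.2.1).elim
        · exact (not_lt.2 h hy.2.2).elim
      · refine ⟨(C₁ ∪ {0})ᶜ, (hF.isClosed_truncation_union h0).isOpen_compl.mem_nhds ?_,
          fun _ => 0, contMDiffOn_const, fun y hy => ⟨fun h => ?_, fun _ => rfl, fun _ => rfl⟩⟩
        · rintro (h | h)
          · exact hzC h
          · exact hz0 h
        · exact (hy (Or.inl h)).elim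
  obtain ⟨g, hg⟩ := exists_contMDiffMap_forall_mem_convex_of_local
    (modelWithCornersSelf ℝ (CSpace N)) ht hloc
  refine ⟨g, g.contMDiff.contDiff, HasCompactSupport.intro (isCompact_closedBall 0 2)
    fun z hz => ?_, ?_, fun z hz => (hg z).1 hz⟩
  · rw [mem_closedBall_zero_iff, not_le] at hz
    exact (hg z).2.2 hz.le
  · rw [notMem_tsupport_iff_eventuallyEq]
    filter_upwards [Metric.ball_mem_nhds (0 : CSpace N) (half_pos hr)] with z hz
    exact (hg z).2.1 (mem_ball_zero_iff.1 hz)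

/-- A test field is `Φ J` for a smooth complex function `Φ` on `ℂ^N`. -/
lemma IsRegular.exists_eq_smul_normalFrame (hF : IsRegular F) (h0 : F 0 = 0)
    (hV : ConeGeometry.IsTestField (zeroCone F) V) :
    ∃ Φ : CSpace N → ℂ, ContDiff ℝ ∞ Φ ∧ HasCompactSupport Φ ∧ 0 ∉ tsupport Φ ∧
      (∀ z ∈ ConeGeometry.truncation (zeroCone F), V z = Φ z • normalFrame F z) ∧
      ∀ z ∈ zeroCone F ∩ Metric.sphere 0 1, Φ z = 0 := by
  obtain ⟨W, hW, hWc, hW0, hWV⟩ := hF.exists_extension h0 hV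
  have hs : tsupport (fun z => fderiv ℂ F z (W z)) ⊆ tsupport W := by
    refine closure_mono fun z hz => ?_
    rw [Function.mem_support] at hz ⊢
    intro h
    simp [h] at hz
  have h6 : ContDiff ℝ ∞ fun z => (fderiv ℂ F z).restrictScalars ℝ :=
    contDiff_restrictScalars (hF.contDiff_fderiv.restrict_scalars ℝ)
  refine ⟨fun z => fderiv ℂ F z (W z), h6.clm_apply hW, hWc.mono' (subset_closure.trans hs),
    fun h => hW0 (hs h), fun z hz => ?_, fun z hz => ?_⟩
  · rcases lt_or_eq_of_le (mem_closedBall_zero_iff.1 hz.2) with h1 | h1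
    · have h2 : z ∈ ConeGeometry.truncation (zeroCone F) ∩ Metric.ball 0 1 :=
        ⟨hz, mem_ball_zero_iff.2 h1⟩
      have h3 := hV.1.2 z hz
      rw [hF.tangentSpace_eq Metric.isOpen_ball (truncation_inter_ball F) h2,
        mem_kerReal_orthogonal_iff (hF.fderiv_ne_zero z hz.1.1)] at h3
      simp only [hWV z hz]
      exact h3
    · have h2 := hV.2.2 z ⟨hz.1, mem_sphere_zero_iff_norm.2 h1⟩
      simp [hWV z hz, h2]
  · have h1 : z ∈ ConeGeometry.truncation (zeroCone F) :=
      ⟨hz.1, Metric.sphere_subset_closedBall hz.2⟩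
    simp [hWV z h1, hV.2.2 z hz]

end ComplexCone

/-! ### The integral of the divergence over the truncated cone -/

namespace ComplexCone

open Set Filter Topology MeasureTheory

variable {N : ℕ} {F Φ : CSpace N → ℂ} {p : CSpace N}

lemma rotForm_eq_zero {z : CSpace N} (h : Φ z = 0) : rotForm F Φ z = 0 := by
  ext v
  simp [rotForm, h]

lemma rotField_eq_zero {z : CSpace N} (h : Φ z = 0) : rotField F Φ z = 0 := by
  simp [rotField, rotForm_eq_zero h, levelProj]

lemma tsupport_rotField_subset : tsupport (rotField F Φ) ⊆ tsupport Φ :=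
  closure_mono fun _ hz h => hz (rotField_eq_zero h)

lemma IsRegular.contDiff_rotField (hF : IsRegular F) (hΦ : ContDiff ℝ ∞ Φ)
    (h0 : 0 ∉ tsupport Φ) : ContDiff ℝ ∞ (rotField F Φ) := by
  refine contDiff_iff_contDiffAt.2 fun z => ?_
  by_cases hz : z = 0
  · subst hz
    have h1 : rotField F Φ =ᶠ[𝓝 0] fun _ => 0 :=
      notMem_tsupport_iff_eventuallyEq.1 fun h => h0 (tsupport_rotField_subset h)
    exact contDiffAt_const.congr_of_eventuallyEq h1
  · exact hF.contDiffAt_rotField hz hΦ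

lemma norm_rieszReal_le (l : CSpace N →L[ℝ] ℝ) : ‖rieszReal l‖ ≤ ‖l‖ := by
  change ‖(InnerProductSpace.toDual ℝ (CSpace N)).symm l‖ ≤ ‖l‖
  rw [LinearIsometryEquiv.norm_map]

/-- The size of the covariant derivative controlling `rotField`. -/
def covSize (F Φ : CSpace N → ℂ) (z : CSpace N) : ℝ :=
  ‖fderiv ℝ Φ z‖ + ‖Φ z‖ * ‖hess F z (normalFrame F z)‖

lemma IsRegular.norm_rotField_le (hF : IsRegular F) (hp : p ≠ 0) :
    ‖rotField F Φ p‖ ≤ ‖Φ p‖ * covSize F Φ p := by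
  have h1 : ‖rotForm F Φ p‖ ≤ ‖Φ p‖ * covSize F Φ p := by
    refine ContinuousLinearMap.opNorm_le_bound _ (by unfold covSize; positivity) fun v => ?_
    have h2 : rotForm F Φ p v = ((starRingEnd ℂ) (Φ p) * fderiv ℝ Φ p (Complex.I • v)).im
      - ‖Φ p‖ ^ 2 * (hess F p (normalFrame F p) v).re := by
      rw [hF.rotForm_apply, connForm, hF.hess_comm]
    rw [h2]
    refine (norm_sub_le _ _).trans ?_
    have h3 : ‖((starRingEnd ℂ) (Φ p) * fderiv ℝ Φ p (Complex.I • v)).im‖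
        ≤ ‖Φ p‖ * (‖fderiv ℝ Φ p‖ * ‖v‖) := by
      refine (Complex.abs_im_le_norm _).trans ?_
      rw [norm_mul, RCLike.norm_conj]
      gcongr
      refine (ContinuousLinearMap.le_opNorm _ _).trans ?_
      rw [norm_smul, Complex.norm_I, one_mul]
    have h4 : ‖‖Φ p‖ ^ 2 * (hess F p (normalFrame F p) v).re‖
        ≤ ‖Φ p‖ ^ 2 * (‖hess F p (normalFrame F p)‖ * ‖v‖) := by
      rw [norm_mul, norm_pow, norm_norm]
      gcongr
      exact (Complex.abs_re_le_norm _).trans (ContinuousLinearMap.le_opNorm _ _)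
    rw [covSize]
    linarith
  rw [rotField, hF.levelProj_eq hp]
  exact (Submodule.norm_starProjection_apply_le _ _).trans ((norm_rieszReal_le _).trans h1)

lemma divergence_smul {ψ : CSpace N → ℝ} {X : CSpace N → CSpace N}
    (hψ : DifferentiableAt ℝ ψ p) (hX : DifferentiableAt ℝ X p) :
    divergence (fun z => ψ z • X z) p = ψ p * divergence X p + fderiv ℝ ψ p (X p) := by
  have h : HasFDerivAt (fun z => ψ z • X z) _ p := hψ.hasFDerivAt.smul hX.hasFDerivAt
  rw [divergence, h.fderiv]
  have h1 : ((ψ p • fderiv ℝ X p + (fderiv ℝ ψ p).smulRight (X p) : CSpace N →L[ℝ] CSpace N) :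
      CSpace N →ₗ[ℝ] CSpace N) = ψ p • (fderiv ℝ X p : CSpace N →ₗ[ℝ] CSpace N)
        + (fderiv ℝ ψ p : CSpace N →ₗ[ℝ] ℝ).smulRight (X p) := rfl
  rw [h1, map_add, map_smul, LinearMap.trace_smulRight]
  rfl

lemma divergence_congr {X Y : CSpace N → CSpace N} (h : X =ᶠ[𝓝 p] Y) :
    divergence X p = divergence Y p := by
  rw [divergence, divergence, h.fderiv_eq]

/-- A smooth step function, vanishing up to `1/2` and equal to one from `1` on. -/
def stepFun (s : ℝ) : ℝ := Real.smoothTransition (2 * s - 1)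

lemma contDiff_stepFun : ContDiff ℝ ∞ stepFun :=
  Real.smoothTransition.contDiff.comp (by fun_prop)

lemma stepFun_of_le {s : ℝ} (h : s ≤ 1 / 2) : stepFun s = 0 :=
  Real.smoothTransition.zero_of_nonpos (by linarith)

lemma stepFun_of_ge {s : ℝ} (h : 1 ≤ s) : stepFun s = 1 :=
  Real.smoothTransition.one_of_one_le (by linarith)

lemma stepFun_mem (s : ℝ) : stepFun s ∈ Icc (0 : ℝ) 1 :=
  ⟨Real.smoothTransition.nonneg _, Real.smoothTransition.le_one _⟩

lemma deriv_stepFun_of_gt {s : ℝ} (h : 1 < s) : deriv stepFun s = 0 := by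
  have h1 : stepFun =ᶠ[𝓝 s] fun _ => 1 := by
    filter_upwards [lt_mem_nhds h] with x hx using stepFun_of_ge hx.le
  rw [h1.deriv_eq, deriv_const]

lemma deriv_stepFun_of_lt {s : ℝ} (h : s < 1 / 2) : deriv stepFun s = 0 := by
  have h1 : stepFun =ᶠ[𝓝 s] fun _ => 0 := by
    filter_upwards [gt_mem_nhds h] with x hx using stepFun_of_le hx.le
  rw [h1.deriv_eq, deriv_const]

lemma exists_bound_deriv_stepFun : ∃ B : ℝ, 0 ≤ B ∧ ∀ s, |deriv stepFun s| ≤ B := by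
  have hc : Continuous (deriv stepFun) := contDiff_stepFun.continuous_deriv (by simp)
  obtain ⟨B, hB⟩ := (HasCompactSupport.intro (isCompact_Icc (a := (0 : ℝ)) (b := 2)) fun s hs => by
    rw [mem_Icc, not_and_or, not_le, not_le] at hs
    rcases hs with hs | hs
    · exact deriv_stepFun_of_lt (by linarith)
    · exact deriv_stepFun_of_gt (by linarith)).exists_bound_of_continuous hc
  exact ⟨B, (norm_nonneg _).trans (hB 0), hB⟩

/-- The cutoff removing the set where `Φ` is small. -/
def levelCutoff (Φ : CSpace N → ℂ) (k : ℕ) (z : CSpace N) : ℝ :=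
  stepFun (((k : ℝ) + 1) * ‖Φ z‖ ^ 2)

lemma contDiff_levelCutoff (hΦ : ContDiff ℝ ∞ Φ) (k : ℕ) : ContDiff ℝ ∞ (levelCutoff Φ k) :=
  contDiff_stepFun.comp (contDiff_const.mul (hΦ.norm_sq ℝ))

lemma fderiv_levelCutoff (hΦ : ContDiff ℝ ∞ Φ) (k : ℕ) (z v : CSpace N) :
    fderiv ℝ (levelCutoff Φ k) z v = deriv stepFun (((k : ℝ) + 1) * ‖Φ z‖ ^ 2) *
      (((k : ℝ) + 1) * (2 * inner ℝ (Φ z) (fderiv ℝ Φ z v))) := by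
  have h1 : HasFDerivAt Φ (fderiv ℝ Φ z) z := (hΦ.differentiable (by simp) z).hasFDerivAt
  have h2 := ((contDiff_stepFun.differentiable (by simp)
    (((k : ℝ) + 1) * ‖Φ z‖ ^ 2)).hasDerivAt).comp_hasFDerivAt z (h1.norm_sq.const_mul ((k : ℝ) + 1))
  have h3 : fderiv ℝ (levelCutoff Φ k) z = _ := h2.fderiv
  rw [h3]
  simp only [smul_apply, ContinuousLinearMap.comp_apply, innerSL_apply_apply, smul_eq_mul,
    nsmul_eq_mul, Nat.cast_ofNat]

/-- The derivative of the cutoff along `rotField` is bounded independently of the cutoff, as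
`rotField` vanishes with `Φ`. -/
lemma IsRegular.abs_fderiv_levelCutoff_le (hF : IsRegular F) (hΦ : ContDiff ℝ ∞ Φ) {B : ℝ}
    (hB : ∀ s, |deriv stepFun s| ≤ B) (k : ℕ) {z : CSpace N} (hz : z ≠ 0) :
    |fderiv ℝ (levelCutoff Φ k) z (rotField F Φ z)|
      ≤ 2 * B * (‖fderiv ℝ Φ z‖ * covSize F Φ z) := by
  have hB0 : 0 ≤ B := (abs_nonneg _).trans (hB 0)
  have hc0 : 0 ≤ covSize F Φ z := by unfold covSize; positivity
  rw [fderiv_levelCutoff hΦ]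
  rcases lt_or_ge 1 (((k : ℝ) + 1) * ‖Φ z‖ ^ 2) with h | h
  · rw [deriv_stepFun_of_gt h, zero_mul, abs_zero]
    positivity
  · have h1 : |inner ℝ (Φ z) (fderiv ℝ Φ z (rotField F Φ z))|
        ≤ ‖Φ z‖ ^ 2 * (‖fderiv ℝ Φ z‖ * covSize F Φ z) := by
      refine (abs_real_inner_le_norm _ _).trans ?_
      calc ‖Φ z‖ * ‖fderiv ℝ Φ z (rotField F Φ z)‖
          ≤ ‖Φ z‖ * (‖fderiv ℝ Φ z‖ * (‖Φ z‖ * covSize F Φ z)) := by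
            gcongr
            exact ((fderiv ℝ Φ z).le_opNorm _).trans (by gcongr; exact hF.norm_rotField_le hz)
        _ = _ := by ring
    rw [abs_mul, abs_mul, abs_mul, abs_of_nonneg (by positivity : (0 : ℝ) ≤ (k : ℝ) + 1), abs_two]
    calc |deriv stepFun (((k : ℝ) + 1) * ‖Φ z‖ ^ 2)| * (((k : ℝ) + 1) *
          (2 * |inner ℝ (Φ z) (fderiv ℝ Φ z (rotField F Φ z))|))
        ≤ B * (((k : ℝ) + 1) * (2 * (‖Φ z‖ ^ 2 * (‖fderiv ℝ Φ z‖ * covSize F Φ z)))) := by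
          gcongr
          exact hB _
      _ = 2 * B * (‖fderiv ℝ Φ z‖ * covSize F Φ z) * (((k : ℝ) + 1) * ‖Φ z‖ ^ 2) := by ring
      _ ≤ 2 * B * (‖fderiv ℝ Φ z‖ * covSize F Φ z) * 1 := by gcongr
      _ = _ := mul_one _

/-- The field `rotField`, cut off where `Φ` is small, extends by zero across the link to an
admissible field for the divergence theorem. -/
lemma IsRegular.exists_cutoff_field (hF : IsRegular F) (hΦ : ContDiff ℝ ∞ Φ)
    (h0 : 0 ∉ tsupport Φ) (hS : ∀ z ∈ zeroCone F ∩ Metric.sphere 0 1, Φ z = 0) (k : ℕ) :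
    ∃ X : CSpace N → CSpace N, ContDiff ℝ 1 X ∧ HasCompactSupport X ∧ 0 ∉ tsupport X ∧
      (∀ z, fderiv ℂ F z (X z) = 0) ∧ ∀ z ∈ zeroCone F, divergence X z
        = (Metric.ball 0 1).indicator (fun z => levelCutoff Φ k z * divergence (rotField F Φ) z
          + fderiv ℝ (levelCutoff Φ k) z (rotField F Φ z)) z := by
  -- on the truncated cone the cutoff is supported in this compact set, which misses the link
  set K : Set (CSpace N) := {z | F z = 0 ∧ ‖z‖ ≤ 1 ∧ 1 / 4 ≤ ((k : ℝ) + 1) * ‖Φ z‖ ^ 2} with hKdef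
  have hΦc := hΦ.continuous
  have hΦ0 : Φ 0 = 0 := image_eq_zero_of_notMem_tsupport h0
  have hK : IsCompact K := by
    refine (isCompact_closedBall (0 : CSpace N) 1).of_isClosed_subset ?_ fun z hz => by
      simpa using hz.2.1
    have h1 : Continuous fun z : CSpace N => ((k : ℝ) + 1) * ‖Φ z‖ ^ 2 := by fun_prop
    exact (isClosed_singleton.preimage hF.contDiff.continuous).inter
      ((isClosed_le continuous_norm continuous_const).inter (isClosed_le continuous_const h1))
  have hKb : K ⊆ Metric.ball 0 1 := by
    intro z hz
    rw [mem_ball_zero_iff]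
    refine lt_of_le_of_ne hz.2.1 fun h => ?_
    have hz0 : z ≠ 0 := by
      rintro rfl
      simp at h
    have h1 := hS z ⟨⟨hz0, hz.1⟩, mem_sphere_zero_iff_norm.2 h⟩
    have h2 := hz.2.2
    rw [h1, norm_zero] at h2
    norm_num at h2
  obtain ⟨ρ, hρ, hρc, hρs, hρ1, -⟩ := exists_contDiff_cutoff hK Metric.isOpen_ball hKb
  have hX := hF.contDiff_rotField hΦ h0
  have hψ := contDiff_levelCutoff hΦ k
  have hle : (1 : ℕ∞ω) ≤ ∞ := by exact_mod_cast le_top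
  refine ⟨fun z => ρ z • levelCutoff Φ k z • rotField F Φ z, (hρ.smul (hψ.smul hX)).of_le hle,
    hρc.smul_right, fun h => h0 (tsupport_rotField_subset (F := F) ?_), fun z => ?_, fun z hz => ?_⟩
  · refine closure_mono ?_ h
    intro z hz h'
    simp [h'] at hz
  · by_cases hz : z = 0
    · subst hz
      simp [rotField_eq_zero hΦ0]
    · change fderiv ℂ F z (ρ z • levelCutoff Φ k z • rotField F Φ z) = 0
      rw [real_smul_eq, real_smul_eq, map_smul, map_smul, hF.fderiv_rotField hz, smul_zero,
        smul_zero]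
  · rcases lt_or_ge ‖z‖ 1 with h1 | h1
    · rw [indicator_of_mem (mem_ball_zero_iff.2 h1), ← divergence_smul
        (hψ.differentiable (by simp) z) (hX.differentiable (by simp) z)]
      refine divergence_congr ?_
      by_cases h2 : 1 / 4 ≤ ((k : ℝ) + 1) * ‖Φ z‖ ^ 2
      · filter_upwards [hρ1 z ⟨hz.2, h1.le, h2⟩] with w hw
        rw [hw, one_smul]
      · have h3 : Continuous fun z : CSpace N => ((k : ℝ) + 1) * ‖Φ z‖ ^ 2 := by fun_prop
        filter_upwards [h3.continuousAt.eventually_lt continuousAt_const (not_le.1 h2)] with w hw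
        have h4 : levelCutoff Φ k w = 0 := stepFun_of_le (by linarith)
        rw [h4, zero_smul, smul_zero]
    · have h2 : z ∉ Metric.ball (0 : CSpace N) 1 := fun h =>
        absurd (mem_ball_zero_iff.1 h) (not_lt.2 h1)
      rw [indicator_of_notMem h2]
      have h3 : (fun z => ρ z • levelCutoff Φ k z • rotField F Φ z) =ᶠ[𝓝 z] fun _ => 0 := by
        filter_upwards [notMem_tsupport_iff_eventuallyEq.1 fun h => h2 (hρs h)] with w hw
        rw [hw]
        simp
      rw [divergence_congr h3]
      simp [divergence]

end ComplexCone

namespace ComplexCone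

open Set Filter Topology MeasureTheory

variable {N n : ℕ} {F Φ : CSpace N → ℂ} {p : CSpace N}

/-- If `Φ` vanishes on the link, the divergence of `rotField` over the part of the truncated cone
where `Φ` does not vanish has integral zero. -/
theorem IsRegular.setIntegral_divergence_rotField (hF : IsRegular F) {d : ℕ} (hd : d + 2 = 2 * N)
    (hΦ : ContDiff ℝ ∞ Φ) (hΦc : HasCompactSupport Φ) (h0 : 0 ∉ tsupport Φ)
    (hS : ∀ z ∈ zeroCone F ∩ Metric.sphere 0 1, Φ z = 0) :
    IntegrableOn ((Metric.ball 0 1 ∩ {z | Φ z ≠ 0}).indicator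
        fun z => ‖normalFrame F z‖ ^ 2 * divergence (rotField F Φ) z) (zeroCone F) μHE[d] ∧
      ∫ z in zeroCone F, (Metric.ball 0 1 ∩ {z | Φ z ≠ 0}).indicator
        (fun z => ‖normalFrame F z‖ ^ 2 * divergence (rotField F Φ) z) z ∂μHE[d] = 0 := by
  choose X hX hXc hX0 hXt hXd using hF.exists_cutoff_field hΦ h0 hS
  obtain ⟨B, hB0, hB⟩ := exists_bound_deriv_stepFun
  have hR := hF.contDiff_rotField hΦ h0
  have hle : (1 : ℕ∞ω) ≤ ∞ := by exact_mod_cast le_top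
  have hdR : Continuous (divergence (rotField F Φ)) := continuous_divergence (hR.of_le hle)
  have hdΦ : Continuous (fderiv ℝ Φ) := hΦ.continuous_fderiv (by simp)
  have hΦcont := hΦ.continuous
  -- a bound for the weighted divergences of all cut-off fields
  set G : CSpace N → ℝ := fun z => ‖normalFrame F z‖ ^ 2 *
    (|divergence (rotField F Φ) z| + 2 * B * (‖fderiv ℝ Φ z‖ * covSize F Φ z)) with hGdef
  have hGsupp : tsupport G ⊆ tsupport Φ := by
    refine closure_minimal (fun z hz => ?_) (isClosed_tsupport Φ)
    by_contra h
    apply hz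
    have h1 : divergence (rotField F Φ) z = 0 := image_eq_zero_of_notMem_tsupport fun h' =>
      h (tsupport_rotField_subset (tsupport_divergence_subset _ h'))
    have h2 : fderiv ℝ Φ z = 0 := image_eq_zero_of_notMem_tsupport fun h' =>
      h (tsupport_fderiv_subset ℝ h')
    simp [hGdef, h1, h2]
  have hGc : ∀ z ≠ 0, ContinuousAt G z := by
    intro z hz
    have h1 : ContinuousAt (fun z => ‖hess F z (normalFrame F z)‖) z :=
      ((hF.contDiff_hess.continuous.continuousAt).clm_apply
        (hF.contDiffAt_normalFrame hz).continuousAt).norm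
    refine (hF.continuousAt_norm_sq_normalFrame hz).mul (hdR.continuousAt.abs.add
      (continuousAt_const.mul (hdΦ.continuousAt.norm.mul ?_)))
    exact hdΦ.continuousAt.norm.add (hΦcont.continuousAt.norm.mul h1)
  have hGint : IntegrableOn G (zeroCone F) μHE[d] := hF.integrableOn_zeroCone hd hGc
    (hΦc.mono' (subset_closure.trans hGsupp)) fun h => h0 (hGsupp h)
  have hmeas : ∀ k, AEStronglyMeasurable (fun z => ‖normalFrame F z‖ ^ 2 * divergence (X k) z)
      ((μHE[d] : Measure (CSpace N)).restrict (zeroCone F)) := by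
    intro k
    have h1 : Continuous fun z => ‖normalFrame F z‖ ^ 2 * divergence (X k) z := by
      have h2 := continuous_divergence (hX k)
      refine continuous_of_continuousAt_ne (fun z hz =>
        (hF.continuousAt_norm_sq_normalFrame hz).mul h2.continuousAt) fun h => hX0 k ?_
      refine tsupport_divergence_subset (X k) (closure_mono (fun z hz => ?_) h)
      rw [Function.mem_support] at hz ⊢
      exact right_ne_zero_of_mul hz
    exact h1.aestronglyMeasurable
  have hbound : ∀ k, ∀ᵐ z ∂((μHE[d] : Measure (CSpace N)).restrict (zeroCone F)),
      ‖‖normalFrame F z‖ ^ 2 * divergence (X k) z‖ ≤ G z := by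
    intro k
    filter_upwards [ae_restrict_mem (measurableSet_zeroCone hF)] with z hz
    rw [hXd k z hz, norm_mul, norm_pow, norm_norm]
    have hc : 0 ≤ covSize F Φ z := by unfold covSize; positivity
    refine mul_le_mul_of_nonneg_left ?_ (by positivity)
    by_cases h1 : z ∈ Metric.ball (0 : CSpace N) 1
    · rw [indicator_of_mem h1]
      refine (norm_add_le _ _).trans (add_le_add ?_ ?_)
      · rw [norm_mul, Real.norm_eq_abs, Real.norm_eq_abs]
        have h2 : levelCutoff Φ k z ∈ Icc (0 : ℝ) 1 := stepFun_mem _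
        refine mul_le_of_le_one_left (abs_nonneg _) ?_
        rw [abs_of_nonneg h2.1]
        exact h2.2
      · exact hF.abs_fderiv_levelCutoff_le hΦ hB k hz.1
    · rw [indicator_of_notMem h1, norm_zero]
      positivity
  have hlim : ∀ᵐ z ∂((μHE[d] : Measure (CSpace N)).restrict (zeroCone F)),
      Tendsto (fun k => ‖normalFrame F z‖ ^ 2 * divergence (X k) z) atTop
        (𝓝 ((Metric.ball 0 1 ∩ {z | Φ z ≠ 0}).indicator
          (fun z => ‖normalFrame F z‖ ^ 2 * divergence (rotField F Φ) z) z)) := by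
    filter_upwards [ae_restrict_mem (measurableSet_zeroCone hF)] with z hz
    refine tendsto_const_nhds.congr' ?_
    simp_rw [hXd _ z hz]
    by_cases h1 : z ∈ Metric.ball (0 : CSpace N) 1
    · by_cases h2 : Φ z = 0
      · refine Eventually.of_forall fun k => ?_
        have h3 : z ∉ Metric.ball 0 1 ∩ {z | Φ z ≠ 0} := fun h => h.2 h2
        simp only []
        rw [indicator_of_notMem h3, indicator_of_mem h1, rotField_eq_zero h2,
          map_zero, levelCutoff, h2, stepFun_of_le (by simp)]
        simp
      · have h3 : 0 < ‖Φ z‖ ^ 2 := by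
          have := norm_pos_iff.2 h2
          positivity
        have h4 : Tendsto (fun k : ℕ => ((k : ℝ) + 1) * ‖Φ z‖ ^ 2) atTop atTop :=
          (tendsto_atTop_add_const_right _ _ tendsto_natCast_atTop_atTop).atTop_mul_const h3
        filter_upwards [h4.eventually_gt_atTop 1] with k hk
        have h5 : z ∈ Metric.ball 0 1 ∩ {z | Φ z ≠ 0} := ⟨h1, h2⟩
        rw [indicator_of_mem h5, indicator_of_mem h1, fderiv_levelCutoff hΦ,
          deriv_stepFun_of_gt hk, levelCutoff, stepFun_of_ge hk.le]
        ring
    · refine Eventually.of_forall fun k => ?_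
      have h2 : z ∉ Metric.ball 0 1 ∩ {z | Φ z ≠ 0} := fun h => h1 h.1
      simp only []
      rw [indicator_of_notMem h2, indicator_of_notMem h1, mul_zero]
  have hmeas' := aestronglyMeasurable_of_tendsto_ae atTop hmeas hlim
  refine ⟨hGint.mono' hmeas' ?_, ?_⟩
  · have hall : ∀ᵐ z ∂((μHE[d] : Measure (CSpace N)).restrict (zeroCone F)), ∀ k,
        ‖‖normalFrame F z‖ ^ 2 * divergence (X k) z‖ ≤ G z := ae_all_iff.2 hbound
    filter_upwards [hlim, hall] with z h1 h2
    exact le_of_tendsto h1.norm (Eventually.of_forall h2)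
  · have h1 := tendsto_integral_of_dominated_convergence G hmeas hGint hbound hlim
    have h2 : ∀ k, ∫ z in zeroCone F, ‖normalFrame F z‖ ^ 2 * divergence (X k) z ∂μHE[d] = 0 :=
      fun k => hF.setIntegral_divergence_eq_zero hd (hX k) (hXc k) (hX0 k) (hXt k)
    simp only [h2] at h1
    exact tendsto_nhds_unique h1 tendsto_const_nhds

/-- The covariant derivative as a real linear map. -/
def covDerivCLM (F Φ : CSpace N → ℂ) (z : CSpace N) : CSpace N →L[ℝ] ℂ :=
  fderiv ℝ Φ z - Φ z • (hess F z (normalFrame F z)).restrictScalars ℝ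

lemma IsRegular.covDerivCLM_apply (hF : IsRegular F) (z v : CSpace N) :
    covDerivCLM F Φ z v = covDeriv F Φ z v := by
  rw [covDeriv, connForm, hF.hess_comm]
  simp [covDerivCLM]

lemma IsRegular.secondVariation_integrand_eq (hF : IsRegular F) (hΦ : ContDiff ℝ ∞ Φ)
    {V : CSpace N → CSpace N}
    (hV : ∀ z ∈ ConeGeometry.truncation (zeroCone F), V z = Φ z • normalFrame F z)
    (hp : p ∈ zeroCone F) (hp1 : p ∈ Metric.ball 0 1) {m : ℕ}
    {c : OrthonormalBasis (Fin m ⊕ Fin m) ℝ (kerReal (fderiv ℂ F p))} (hc : IsComplexBasis c) :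
    ConeGeometry.norConnNormSq (ConeGeometry.truncation (zeroCone F)) V p
        - inner ℝ (V p) (ConeGeometry.simonsOp (ConeGeometry.truncation (zeroCone F)) p (V p))
      = ‖normalFrame F p‖ ^ 2 * (∑ k, ‖covDerivCLM F Φ p (c k)‖ ^ 2
        - 2 * ‖normalFrame F p‖ ^ 2 * hessSq F p c * ‖Φ p‖ ^ 2) := by
  have hpt : p ∈ ConeGeometry.truncation (zeroCone F) := ⟨hp, Metric.ball_subset_closedBall hp1⟩
  have hM := truncation_inter_ball F
  have hpM : p ∈ ConeGeometry.truncation (zeroCone F) ∩ Metric.ball 0 1 := ⟨hpt, hp1⟩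
  have hΦd : HasFDerivAt Φ (fderiv ℝ Φ p) p := (hΦ.differentiable (by simp) p).hasFDerivAt
  have h1 := hF.norConnNormSq_eq Metric.isOpen_ball hM hpM (c := c) (V := V)
    (a := covDerivCLM F Φ p) fun X hX => by
      rw [hF.norConn_smul_normalFrame Metric.isOpen_ball hM hpM hΦd (fun q hq => hV q hq.1) hX,
        hF.covDerivCLM_apply]
      rfl
  have h2 : inner ℝ (V p) (ConeGeometry.simonsOp (ConeGeometry.truncation (zeroCone F)) p (V p))
      = 2 * ‖normalFrame F p‖ ^ 2 * hessSq F p c * (‖Φ p‖ ^ 2 * ‖normalFrame F p‖ ^ 2) := by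
    rw [hV p hpt, hF.simonsOp_eq Metric.isOpen_ball hM hpM hc, real_inner_smul_right,
      real_inner_self_eq_norm_sq, norm_smul, mul_pow]
  rw [h1, h2]
  ring

/-- The integrand of the second variation dominates the weighted divergence of `rotField`: the
difference is, up to a constant, the squared norm of the antiholomorphic part of the covariant
derivative, by the pointwise inequality `2 Im (conj a · b) ≤ |a|² + |b|²`. -/
lemma IsRegular.le_secondVariation_integrand (hF : IsRegular F) (hΦ : ContDiff ℝ ∞ Φ)
    {V : CSpace N → CSpace N}
    (hV : ∀ z ∈ ConeGeometry.truncation (zeroCone F), V z = Φ z • normalFrame F z)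
    (hp : p ∈ zeroCone F) (hp1 : p ∈ Metric.ball 0 1) :
    (Metric.ball 0 1 ∩ {z | Φ z ≠ 0}).indicator
        (fun z => ‖normalFrame F z‖ ^ 2 * divergence (rotField F Φ) z) p
      ≤ ConeGeometry.norConnNormSq (ConeGeometry.truncation (zeroCone F)) V p
        - inner ℝ (V p) (ConeGeometry.simonsOp (ConeGeometry.truncation (zeroCone F)) p (V p)) := by
  obtain ⟨m, c, hc⟩ := exists_complex_orthonormalBasis (fderiv ℂ F p)
  rw [hF.secondVariation_integrand_eq hΦ hV hp hp1 hc]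
  have h7 : (0 : ℝ) ≤ ‖normalFrame F p‖ ^ 2 := by positivity
  by_cases h3 : Φ p = 0
  · have h6 : p ∉ Metric.ball 0 1 ∩ {z | Φ z ≠ 0} := fun h => h.2 h3
    rw [indicator_of_notMem h6, h3]
    simp only [norm_zero, ne_eq, OfNat.ofNat_ne_zero, not_false_eq_true, zero_pow, mul_zero,
      sub_zero]
    exact mul_nonneg h7 (Finset.sum_nonneg fun k _ => by positivity)
  · have h6 : p ∈ Metric.ball 0 1 ∩ {z | Φ z ≠ 0} := ⟨hp1, h3⟩
    rw [indicator_of_mem h6, hF.divergence_rotField hp.1 hΦ hc, Fintype.sum_sum_type,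
      ← Finset.sum_add_distrib]
    simp only [hF.covDerivCLM_apply]
    have h4 : ∀ a b : ℂ, 2 * ((starRingEnd ℂ) a * b).im ≤ ‖a‖ ^ 2 + ‖b‖ ^ 2 := by
      intro a b
      rw [← Complex.normSq_eq_norm_sq, ← Complex.normSq_eq_norm_sq, Complex.normSq_apply,
        Complex.normSq_apply, Complex.mul_im, Complex.conj_re, Complex.conj_im]
      nlinarith [sq_nonneg (a.re - b.im), sq_nonneg (a.im + b.re)]
    gcongr with k
    exact h4 _ _

/-- The integrand of the second variation, as a trace over the whole space. Unlike the expression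
in an orthonormal basis of the tangent space it is visibly continuous. -/
def secondVariationDensity (F Φ : CSpace N → ℂ) (z : CSpace N) : ℝ :=
  ‖normalFrame F z‖ ^ 2 * ∑ i, (‖covDerivCLM F Φ z
      (levelProj F z (stdOrthonormalBasis ℝ (CSpace N) i))‖ ^ 2
    - (hess F z (levelProj F z (stdOrthonormalBasis ℝ (CSpace N) i))
        (fderiv ℝ (normalFrame F) z (levelProj F z (stdOrthonormalBasis ℝ (CSpace N) i)))).re
      * ‖Φ z‖ ^ 2)

lemma IsRegular.secondVariationDensity_eq (hF : IsRegular F) (hp : p ≠ 0) {m : ℕ}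
    {c : OrthonormalBasis (Fin m ⊕ Fin m) ℝ (kerReal (fderiv ℂ F p))} (hc : IsComplexBasis c) :
    secondVariationDensity F Φ p = ‖normalFrame F p‖ ^ 2 * (∑ k, ‖covDerivCLM F Φ p (c k)‖ ^ 2
        - 2 * ‖normalFrame F p‖ ^ 2 * hessSq F p c * ‖Φ p‖ ^ 2) := by
  let B : CSpace N →ₗ[ℝ] CSpace N →ₗ[ℝ] ℝ := LinearMap.mk₂ ℝ
    (fun v w => inner ℝ (covDerivCLM F Φ p v) (covDerivCLM F Φ p w)
      - (hess F p v (fderiv ℝ (normalFrame F) p w)).re * ‖Φ p‖ ^ 2)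
    (by
      intro x y z
      simp only [map_add, inner_add_left, add_apply, Complex.add_re]
      ring)
    (by
      intro r x y
      rw [hess_real_smul_left, map_smul, real_inner_smul_left, Complex.re_ofReal_mul, smul_eq_mul]
      ring)
    (by
      intro x y z
      simp only [map_add, inner_add_right, Complex.add_re]
      ring)
    (by
      intro r x y
      rw [map_smul, map_smul, hess_real_smul_right, real_inner_smul_right, Complex.re_ofReal_mul,
        smul_eq_mul]
      ring)
  have h1 := sum_orthonormalBasis_eq_sum_starProjection (stdOrthonormalBasis ℝ (CSpace N)) c B
  have h2 := congrArg Complex.re (hF.sum_hess_fderiv_normalFrame hp hc)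
  rw [Complex.ofReal_re, Complex.re_sum] at h2
  simp only [B, LinearMap.mk₂_apply, real_inner_self_eq_norm_sq, ← hF.levelProj_eq hp] at h1
  rw [secondVariationDensity, ← h1, Finset.sum_sub_distrib, ← Finset.sum_mul, h2]

lemma IsRegular.integrableOn_secondVariationDensity (hF : IsRegular F) {d : ℕ}
    (hd : d + 2 = 2 * N) (hΦ : ContDiff ℝ ∞ Φ) (hΦc : HasCompactSupport Φ) (h0 : 0 ∉ tsupport Φ) :
    IntegrableOn (secondVariationDensity F Φ) (zeroCone F) μHE[d] := by
  have hs : tsupport (secondVariationDensity F Φ) ⊆ tsupport Φ := by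
    refine closure_minimal (fun z hz => ?_) (isClosed_tsupport Φ)
    by_contra h
    apply hz
    have h1 : Φ z = 0 := image_eq_zero_of_notMem_tsupport h
    have h2 : fderiv ℝ Φ z = 0 := image_eq_zero_of_notMem_tsupport fun h' =>
      h (tsupport_fderiv_subset ℝ h')
    simp [secondVariationDensity, covDerivCLM, h1, h2]
  refine hF.integrableOn_zeroCone hd (fun z hz => ?_) (hΦc.mono' (subset_closure.trans hs))
    fun h => h0 (hs h)
  have hJ := hF.contDiffAt_normalFrame hz
  have hJ' : ContinuousAt (fderiv ℝ (normalFrame F)) z :=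
    (hJ.fderiv_right (m := 0) (by simp)).continuousAt
  have hD : ContinuousAt (fderiv ℝ Φ) z := (hΦ.continuous_fderiv (by simp)).continuousAt
  have hH : ContinuousAt (hess F) z := hF.contDiff_hess.continuous.continuousAt
  have hΦ' : ContinuousAt Φ z := hΦ.continuous.continuousAt
  have hP (v : CSpace N) : ContinuousAt (fun z => levelProj F z v) z :=
    continuousAt_const.sub (((hF.contDiff_fderiv.continuous.continuousAt).clm_apply
      continuousAt_const).smul hJ.continuousAt)
  refine (hF.continuousAt_norm_sq_normalFrame hz).mul
    (tendsto_finsetSum _ fun i _ => ContinuousAt.sub (ContinuousAt.pow (ContinuousAt.norm ?_) 2)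
      (ContinuousAt.mul (Complex.continuous_re.continuousAt.comp ?_) (hΦ'.norm.pow 2)))
  · exact (hD.clm_apply (hP _)).sub (hΦ'.mul ((hH.clm_apply hJ.continuousAt).clm_apply (hP _)))
  · exact (hH.clm_apply (hP _)).clm_apply (hJ'.clm_apply (hP _))

/-- The divergence of the dual field of `rotForm` integrates to zero and is a lower bound for the
integrand of the second variation. -/
theorem IsHomogeneousFun.isStable (hh : IsHomogeneousFun n F) (hF : IsRegular F)
    (hd : 2 * n + 2 = 2 * N) (h0 : F 0 = 0) : ConeGeometry.IsStable (2 * n) (zeroCone F) := by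
  intro V hV
  obtain ⟨Φ, hΦ, hΦc, hΦ0, hVΦ, hS⟩ := hF.exists_eq_smul_normalFrame h0 hV
  obtain ⟨hint, hzero⟩ := hF.setIntegral_divergence_rotField hd hΦ hΦc hΦ0 hS
  rw [ConeGeometry.secondVariation, ConeGeometry.areaIntegral]
  set q : CSpace N → ℝ := fun p =>
    ConeGeometry.norConnNormSq (ConeGeometry.truncation (zeroCone F)) V p
      - inner ℝ (V p) (ConeGeometry.simonsOp (ConeGeometry.truncation (zeroCone F)) p (V p))
    with hq
  set f := (Metric.ball 0 1 ∩ {z | Φ z ≠ 0}).indicator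
        fun z => ‖normalFrame F z‖ ^ 2 * divergence (rotField F Φ) z with hf
  have hae : ConeGeometry.truncation (zeroCone F) =ᵐ[(μHE[2 * n] : Measure (CSpace N))]
      (zeroCone F ∩ Metric.ball 0 1 : Set (CSpace N)) := by
    have h1 := hh.measure_zeroCone_inter_sphere hF hd
    refine ae_eq_set.2 ⟨measure_mono_null ?_ h1, ?_⟩
    · rintro z ⟨⟨hz, hz1⟩, hz2⟩
      refine ⟨hz, mem_sphere_zero_iff_norm.2 (le_antisymm (mem_closedBall_zero_iff.1 hz1) ?_)⟩
      by_contra h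
      exact hz2 ⟨hz, mem_ball_zero_iff.2 (not_le.1 h)⟩
    · have : (zeroCone F ∩ Metric.ball 0 1) \ ConeGeometry.truncation (zeroCone F) = ∅ :=
        sdiff_eq_bot_iff.2 (inter_subset_inter_right _ Metric.ball_subset_closedBall)
      rw [this, measure_empty]
  rw [setIntegral_congr_set hae]
  have hm : MeasurableSet (zeroCone F ∩ Metric.ball 0 1) :=
    (measurableSet_zeroCone hF).inter Metric.isOpen_ball.measurableSet
  have hqi : IntegrableOn q (zeroCone F ∩ Metric.ball 0 1) μHE[2 * n] := by
    refine ((hF.integrableOn_secondVariationDensity hd hΦ hΦc hΦ0).mono_set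
      inter_subset_left).congr_fun (fun z hz => ?_) hm
    obtain ⟨m, c, hc⟩ := exists_complex_orthonormalBasis (fderiv ℂ F z)
    rw [hF.secondVariationDensity_eq hz.1.1 hc]
    exact (hF.secondVariation_integrand_eq hΦ hVΦ hz.1 hz.2 hc).symm
  calc (0 : ℝ) = ∫ z in zeroCone F, f z ∂μHE[2 * n] := hzero.symm
    _ = ∫ z in zeroCone F ∩ Metric.ball 0 1, f z ∂μHE[2 * n] := by
        refine (setIntegral_eq_of_subset_of_forall_sdiff_eq_zero (measurableSet_zeroCone hF)
          inter_subset_left fun z hz => ?_)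
        exact indicator_of_notMem (fun h => hz.2 ⟨hz.1, h.1⟩) _
    _ ≤ ∫ z in zeroCone F ∩ Metric.ball 0 1, q z ∂μHE[2 * n] := by
        refine setIntegral_mono_on (hint.mono_set inter_subset_left) hqi hm fun z hz => ?_
        exact hF.le_secondVariation_integrand hΦ hVΦ hz.1 hz.2

end ComplexCone

/-! ### Radial test fields -/

namespace ComplexCone

open Set Filter Topology MeasureTheory
open scoped NNReal ENNReal

variable {N n : ℕ} {F : CSpace N → ℂ} {p : CSpace N}

/-- The real inner product as a bilinear map with values in `ℂ`. -/
def innerC (N : ℕ) : CSpace N →L[ℝ] CSpace N →L[ℝ] ℂ :=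
  LinearMap.toContinuousLinearMap
    { toFun := fun z => Complex.ofRealCLM ∘L innerSL ℝ z
      map_add' := fun x y => by ext v; simp
      map_smul' := fun r x => by ext v; simp }

@[simp] lemma innerC_apply (v w : CSpace N) : innerC N v w = (inner ℝ v w : ℝ) := rfl

lemma hasFDerivAt_comp_norm_sq {g : ℝ → ℝ} {g' : ℝ} (hg : HasDerivAt g g' (‖p‖ ^ 2)) :
    HasFDerivAt (fun z : CSpace N => g (‖z‖ ^ 2)) ((2 * g') • innerSL ℝ p) p := by
  have h := hg.comp_hasFDerivAt p (hasFDerivAt_id p).norm_sq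
  refine h.congr_fderiv ?_
  ext v
  simp
  ring

lemma fderiv_radial {g : ℝ → ℝ} {g' : ℝ} (hg : HasDerivAt g g' (‖p‖ ^ 2)) :
    fderiv ℝ (fun z : CSpace N => (g (‖z‖ ^ 2) : ℂ)) p = (2 * g') • innerC N p := by
  have h := (Complex.ofRealCLM.hasFDerivAt.comp p (hasFDerivAt_comp_norm_sq hg)).fderiv
  have h1 : fderiv ℝ (fun z : CSpace N => (g (‖z‖ ^ 2) : ℂ)) p = _ := h
  rw [h1]
  ext v
  simp

lemma fderiv_fderiv_radial {g g₁ : ℝ → ℝ} {g₂ : ℝ} (hg : ∀ s, 0 < s → HasDerivAt g (g₁ s) s)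
    (hp : p ≠ 0) (hg₁ : HasDerivAt g₁ g₂ (‖p‖ ^ 2)) (v w : CSpace N) :
    fderiv ℝ (fderiv ℝ fun z : CSpace N => (g (‖z‖ ^ 2) : ℂ)) p v w
      = 2 * g₁ (‖p‖ ^ 2) * inner ℝ v w + 4 * g₂ * inner ℝ p v * inner ℝ p w := by
  have h1 : (fderiv ℝ fun z : CSpace N => (g (‖z‖ ^ 2) : ℂ))
      =ᶠ[𝓝 p] fun z => (2 * g₁ (‖z‖ ^ 2)) • innerC N z := by
    filter_upwards [isOpen_ne.mem_nhds hp] with z hz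
    have : 0 < ‖z‖ := norm_pos_iff.2 hz
    exact fderiv_radial (hg _ (by positivity))
  have h2 : HasFDerivAt (fun z : CSpace N => (2 * g₁ (‖z‖ ^ 2)) • innerC N z) _ p :=
    ((hasFDerivAt_comp_norm_sq hg₁).const_mul 2).smul (innerC N).hasFDerivAt
  rw [h1.fderiv_eq, h2.fderiv]
  simp only [add_apply, smul_apply, ContinuousLinearMap.smulRight_apply, innerC_apply,
    innerSL_apply_apply, smul_eq_mul, Complex.real_smul]
  push_cast
  ring

lemma contDiffAt_radial {g : ℝ → ℝ} (hg : ContDiffAt ℝ ∞ g (‖p‖ ^ 2)) :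
    ContDiffAt ℝ ∞ (fun z : CSpace N => (g (‖z‖ ^ 2) : ℂ)) p :=
  Complex.ofRealCLM.contDiff.contDiffAt.comp p
    (hg.comp p (contDiff_norm_sq ℝ).contDiffAt)

/-- The stability operator on `k(log |z|²) J`: the first order terms cancel, because `J` has
homogeneity `1 - n`. -/
lemma IsHomogeneousFun.jacobiOp_radial (hh : IsHomogeneousFun n F) (hF : IsRegular F)
    (hd : 2 * n + 2 = 2 * N) {M U : Set (CSpace N)} (hU : IsOpen U)
    (hM : M ∩ U = zeroCone F ∩ U) (hp : p ∈ M ∩ U) {k : ℝ → ℝ} (hk : ContDiff ℝ ∞ k)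
    {V : CSpace N → CSpace N}
    (hV : ∀ q ∈ M ∩ U, V q = (k (Real.log (‖q‖ ^ 2)) : ℂ) • normalFrame F q) :
    ConeGeometry.jacobiOp M V p
      = (4 * deriv (deriv k) (Real.log (‖p‖ ^ 2)) * (‖p‖ ^ 2)⁻¹ : ℝ) • normalFrame F p := by
  obtain ⟨m, c, hc⟩ := exists_complex_orthonormalBasis (fderiv ℂ F p)
  have hpC := mem_cone_of_inter_eq hM hp
  have hp0 := hpC.1
  have hs : 0 < ‖p‖ ^ 2 := by
    have : 0 < ‖p‖ := norm_pos_iff.2 hp0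
    positivity
  set g : ℝ → ℝ := fun s => k (Real.log s) with hg
  have hg1 : ∀ s, 0 < s → HasDerivAt g (deriv k (Real.log s) * s⁻¹) s := fun s hs =>
    ((hk.differentiable (by simp)) (Real.log s)).hasDerivAt.comp s (Real.hasDerivAt_log hs.ne')
  have hk' : ContDiff ℝ ∞ (deriv k) := hk.deriv'
  have hg2 : HasDerivAt (fun s => deriv k (Real.log s) * s⁻¹) _ (‖p‖ ^ 2) :=
    (((hk'.differentiable (by simp)) (Real.log (‖p‖ ^ 2))).hasDerivAt.comp (‖p‖ ^ 2)
      (Real.hasDerivAt_log hs.ne')).mul (hasDerivAt_inv hs.ne')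
  have hΦ : ∀ q ∈ M ∩ U, ContDiffAt ℝ ∞ (fun z : CSpace N => (g (‖z‖ ^ 2) : ℂ)) q := by
    intro q hq
    have hq0 : ‖q‖ ^ 2 ≠ 0 := by simpa using (mem_cone_of_inter_eq hM hq).1
    exact contDiffAt_radial (hk.contDiffAt.comp _ (Real.contDiffAt_log.2 hq0))
  rw [hF.jacobiOp_eq hU hM hp hc hΦ hV, real_smul_eq]
  congr 1
  have hpT : p ∈ kerReal (fderiv ℂ F p) := by
    rw [mem_kerReal, hh.fderiv_self hF, hpC.2, mul_zero]
  -- the radial vector is tangent to the cone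
  have h1 : ∑ k, inner ℝ p (c k : CSpace N) * inner ℝ p (c k : CSpace N) = ‖p‖ ^ 2 := by
    have h2 : ∑ k, ‖(inner ℝ p (c k : CSpace N) : ℝ)‖ ^ 2 = ‖p‖ ^ 2 :=
      c.sum_sq_norm_inner_left ⟨p, hpT⟩
    rw [← h2]
    exact Finset.sum_congr rfl fun k _ => by rw [Real.norm_eq_abs, sq_abs, sq]
  have h3 : ∑ k, (inner ℝ p (c k : CSpace N) : ℂ) * connForm F p (c k) = n - 1 := by
    rw [← hh.connForm_self hF hp0]
    have h4 := congrArg (fun x : kerReal (fderiv ℂ F p) => (x : CSpace N)) (c.sum_repr' ⟨p, hpT⟩)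
    simp only [Submodule.coe_sum, Submodule.coe_smul] at h4
    have h5 : connForm F p p = connForm F p (∑ k, inner ℝ (c k) (⟨p, hpT⟩ : kerReal (fderiv ℂ F p))
      • (c k : CSpace N)) := by rw [h4]
    rw [h5]
    simp only [connForm]
    rw [map_sum, sum_apply]
    refine Finset.sum_congr rfl fun k _ => ?_
    rw [hess_real_smul_left, real_inner_comm]
    rfl
  have hcard : ∑ k, (inner ℝ (c k : CSpace N) (c k : CSpace N) : ℝ) = 2 * n := by
    have h4 : ∀ k, inner ℝ (c k : CSpace N) (c k : CSpace N) = (1 : ℝ) := by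
      intro k
      rw [real_inner_self_eq_norm_sq, ← Submodule.coe_norm, c.norm_eq_one, one_pow]
    have h5 := finrank_kerReal (hF.fderiv_ne_zero p hp0)
    rw [Module.finrank_eq_card_basis c.toBasis] at h5
    rw [Finset.sum_congr rfl fun k _ => h4 k, Finset.sum_const, Finset.card_univ, nsmul_eq_mul,
      mul_one]
    have h6 : Fintype.card (Fin m ⊕ Fin m) = 2 * n := by omega
    exact_mod_cast h6
  have h6 : ∀ j, fderiv ℝ (fderiv ℝ fun z : CSpace N => (g (‖z‖ ^ 2) : ℂ)) p (c j) (c j)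
      - 2 * fderiv ℝ (fun z : CSpace N => (g (‖z‖ ^ 2) : ℂ)) p (c j) * connForm F p (c j)
      = 2 * (deriv k (Real.log (‖p‖ ^ 2)) * (‖p‖ ^ 2)⁻¹)
          * (inner ℝ (c j : CSpace N) (c j : CSpace N) : ℝ)
        + 4 * (deriv (deriv k) (Real.log (‖p‖ ^ 2)) * (‖p‖ ^ 2)⁻¹ * (‖p‖ ^ 2)⁻¹
          + deriv k (Real.log (‖p‖ ^ 2)) * -((‖p‖ ^ 2) ^ 2)⁻¹)
            * (inner ℝ p (c j : CSpace N) * inner ℝ p (c j : CSpace N) : ℝ)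
        - 4 * (deriv k (Real.log (‖p‖ ^ 2)) * (‖p‖ ^ 2)⁻¹)
          * ((inner ℝ p (c j : CSpace N) : ℂ) * connForm F p (c j)) := by
    intro j
    rw [fderiv_fderiv_radial hg1 hp0 hg2, fderiv_radial (hg1 _ hs)]
    simp only [smul_apply, innerC_apply, Complex.real_smul, Function.comp]
    push_cast
    ring
  rw [Finset.sum_congr rfl fun j _ => h6 j, Finset.sum_sub_distrib, Finset.sum_add_distrib,
    ← Finset.mul_sum, ← Finset.mul_sum, ← Finset.mul_sum, h3, ← Complex.ofReal_sum,
    ← Complex.ofReal_sum, hcard, h1]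
  have hs' : (‖p‖ : ℂ) ≠ 0 := by exact_mod_cast (norm_ne_zero_iff.2 hp0)
  push_cast
  field_simp
  ring

/-- Integration of radial functions over the truncated cone. -/
lemma IsRegular.setIntegral_radial (hF : IsRegular F) {a : ℝ≥0}
    (ha : radialMeasure F (2 * n) = a • (volume : Measure ℝ)) {G : ℝ → ℝ} (hG : Continuous G)
    (hG0 : ∀ t, 0 ≤ t → G t = 0) :
    ∫ z in ConeGeometry.truncation (zeroCone F),
      ‖normalFrame F z‖ ^ 2 * (‖z‖ ^ 2)⁻¹ * G (Real.log (‖z‖ ^ 2)) ∂μHE[2 * n]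
      = a * ∫ t, G t := by
  have h1 : AEMeasurable (radialDensity F)
      ((μHE[2 * n] : Measure (CSpace N)).restrict (zeroCone F)) := by
    rw [← aemeasurable_indicator_iff (measurableSet_zeroCone hF)]
    exact (hF.measurable_indicator fun z hz => hF.continuousAt_radialDensity hz).aemeasurable
  have h2 : ∫ t, G t ∂(radialMeasure F (2 * n)) = a * ∫ t, G t := by
    rw [ha, integral_smul_nnreal_measure]
    rfl
  rw [← h2, radialMeasure, integral_map measurable_log_norm_sq.aemeasurable
    hG.aestronglyMeasurable, integral_withDensity_eq_integral_toReal_smul₀ h1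
      (Eventually.of_forall fun z => ENNReal.ofReal_lt_top)]
  have h3 : ∀ z, (radialDensity F z).toReal • G (Real.log (‖z‖ ^ 2))
      = ‖normalFrame F z‖ ^ 2 * (‖z‖ ^ 2)⁻¹ * G (Real.log (‖z‖ ^ 2)) := by
    intro z
    rw [radialDensity, ENNReal.toReal_ofReal (by positivity), smul_eq_mul]
  simp_rw [h3]
  symm
  refine setIntegral_eq_of_subset_of_forall_sdiff_eq_zero (measurableSet_zeroCone hF)
    inter_subset_left fun z hz => ?_
  have h4 : 1 < ‖z‖ := by
    by_contra h
    exact hz.2 ⟨hz.1, mem_closedBall_zero_iff.2 (not_lt.1 h)⟩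
  rw [hG0 _ (Real.log_nonneg (by nlinarith)), mul_zero]

end ComplexCone

namespace ComplexCone

open Set Filter Topology MeasureTheory
open scoped NNReal

variable {N n : ℕ} {F : CSpace N → ℂ} {p : CSpace N}

/-- The field `k(log |z|²) J`. -/
def radialField (F : CSpace N → ℂ) (k : ℝ → ℝ) (z : CSpace N) : CSpace N :=
  (k (Real.log (‖z‖ ^ 2)) : ℂ) • normalFrame F z

lemma measurableSet_truncation (hF : IsRegular F) :
    MeasurableSet (ConeGeometry.truncation (zeroCone F)) :=
  (measurableSet_zeroCone hF).inter Metric.isClosed_closedBall.measurableSet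

lemma log_norm_sq_of_mem_sphere {z : CSpace N} (hz : ‖z‖ = 1) : Real.log (‖z‖ ^ 2) = 0 := by
  simp [hz]

lemma IsRegular.isTestField_radialField (hF : IsRegular F) (h0 : F 0 = 0) {k : ℝ → ℝ}
    (hk : ContDiff ℝ ∞ k) {b : ℝ} (hkb : ∀ t, t < b → k t = 0) (hk0 : k 0 = 0) :
    ConeGeometry.IsTestField (zeroCone F) (radialField F k) := by
  have hsphere : ∀ z ∈ zeroCone F ∩ Metric.sphere 0 1, radialField F k z = 0 := by
    intro z hz
    rw [radialField, log_norm_sq_of_mem_sphere (mem_sphere_zero_iff_norm.1 hz.2), hk0]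
    simp
  refine ⟨⟨fun p hp => ⟨{0}ᶜ, radialField F k, isOpen_compl_singleton, hp.1.1, ?_,
    fun q _ => rfl⟩, fun p hp => ?_⟩, ⟨ConeGeometry.truncation (zeroCone F) ∩
      {z | Real.exp b ≤ ‖z‖ ^ 2}, inter_subset_left, ?_, ?_⟩, hsphere⟩
  · intro z hz
    have hz0 : ‖z‖ ^ 2 ≠ 0 := by simpa using hz
    have h1 : ContDiffAt ℝ ∞ (fun z : CSpace N => (k (Real.log (‖z‖ ^ 2)) : ℂ)) z :=
      contDiffAt_radial (g := fun s => k (Real.log s))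
        (hk.contDiffAt.comp _ (Real.contDiffAt_log.2 hz0))
    exact (h1.smul (hF.contDiffAt_normalFrame hz)).contDiffWithinAt
  · rcases lt_or_eq_of_le (mem_closedBall_zero_iff.1 hp.2) with h1 | h1
    · rw [hF.tangentSpace_eq Metric.isOpen_ball (truncation_inter_ball F)
        ⟨hp, mem_ball_zero_iff.2 h1⟩]
      exact smul_dualVec_mem_orthogonal _ _
    · rw [hsphere p ⟨hp.1, mem_sphere_zero_iff_norm.2 h1⟩]
      exact Submodule.zero_mem _
  · have h1 : ConeGeometry.truncation (zeroCone F) ∩ {z | Real.exp b ≤ ‖z‖ ^ 2}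
        = (ConeGeometry.truncation (zeroCone F) ∪ {0}) ∩ {z | Real.exp b ≤ ‖z‖ ^ 2} := by
      rw [union_inter_distrib_right, eq_comm, union_eq_left]
      rintro z ⟨rfl, hz⟩
      change Real.exp b ≤ ‖(0 : CSpace N)‖ ^ 2 at hz
      rw [norm_zero] at hz
      have := Real.exp_pos b
      linarith
    refine (isCompact_closedBall (0 : CSpace N) 1).of_isClosed_subset ?_ fun z hz => hz.1.2
    rw [h1]
    have h2 : Continuous fun z : CSpace N => ‖z‖ ^ 2 := by fun_prop
    exact (hF.isClosed_truncation_union h0).inter (isClosed_le continuous_const h2)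
  · rintro z ⟨hz, hzK⟩
    have h1 : ‖z‖ ^ 2 < Real.exp b := by
      by_contra h
      exact hzK ⟨hz, not_lt.1 h⟩
    have h2 : 0 < ‖z‖ := norm_pos_iff.2 hz.1.1
    rw [radialField, hkb _ ((Real.log_lt_iff_lt_exp (by positivity)).2 h1)]
    simp

/-- In the coordinate `log |z|²` the Rayleigh quotient of a radial field is the one-dimensional
quotient of `-4 k''`. -/
lemma IsHomogeneousFun.rayleighQuotient_radialField (hh : IsHomogeneousFun n F) (hF : IsRegular F)
    (hd : 2 * n + 2 = 2 * N) (hne : (zeroCone F).Nonempty)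
    {k : ℝ → ℝ} (hk : ContDiff ℝ ∞ k) (hk0 : ∀ t, 0 ≤ t → k t = 0) :
    ConeGeometry.rayleighQuotient (2 * n) (zeroCone F) (radialField F k)
      = -(4 * ∫ t, k t * deriv (deriv k) t) / ∫ t, k t ^ 2 := by
  obtain ⟨a, ha⟩ := hh.exists_radialMeasure_eq hF hd
  have ha0 : (a : ℝ) ≠ 0 := by
    rw [NNReal.coe_ne_zero]
    rintro rfl
    exact hF.radialMeasure_ne_zero hd hne (by rw [ha, zero_smul])
  rw [← mul_div_mul_left _ _ ha0, mul_neg]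
  have hk' : ContDiff ℝ ∞ (deriv k) := hk.deriv'
  have hk2 : Continuous (deriv (deriv k)) := hk'.continuous_deriv (by simp)
  have hkc := hk.continuous
  rw [ConeGeometry.rayleighQuotient, ConeGeometry.areaIntegral, ConeGeometry.areaIntegral,
    ← integral_const_mul, ← hF.setIntegral_radial ha (G := fun t => 4 * (k t * deriv (deriv k) t))
      (by fun_prop) (fun t ht => by simp [hk0 t ht]),
    ← hF.setIntegral_radial ha (G := fun t => k t ^ 2) (by fun_prop)
      (fun t ht => by simp [hk0 t ht])]
  congr 2
  · refine setIntegral_congr_fun (measurableSet_truncation hF) fun z hz => ?_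
    rcases lt_or_eq_of_le (mem_closedBall_zero_iff.1 hz.2) with h1 | h1
    · have hL := hh.jacobiOp_radial hF hd Metric.isOpen_ball (truncation_inter_ball F)
        ⟨hz, mem_ball_zero_iff.2 h1⟩ hk (V := radialField F k) (fun q _ => rfl)
      rw [hL, real_inner_smul_right, radialField,
        ← real_smul_eq, real_inner_smul_left, real_inner_self_eq_norm_sq]
      ring
    · rw [radialField, log_norm_sq_of_mem_sphere h1, hk0 0 le_rfl]
      simp
  · ext z
    rw [radialField, norm_smul, Complex.norm_real, mul_pow, Real.norm_eq_abs, sq_abs]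
    ring

/-- A bump function supported on the negative half line. -/
def negBump : ContDiffBump (-3 : ℝ) := ⟨1, 2, by norm_num, by norm_num⟩

/-- The rescaled bump function `t ↦ negBump (c t)`. -/
def scaledBump (c t : ℝ) : ℝ := negBump (c * t)

lemma contDiff_scaledBump (c : ℝ) : ContDiff ℝ ∞ (scaledBump c) :=
  negBump.contDiff.comp (contDiff_const.mul contDiff_id)

lemma negBump_eq_zero {t : ℝ} (h : t ≤ -5 ∨ -1 ≤ t) : negBump t = 0 := by
  refine negBump.zero_of_le_dist ?_
  rw [Real.dist_eq]
  change 2 ≤ |t - -3|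
  rcases h with h | h
  · rw [abs_of_nonpos (by linarith)]
    linarith
  · rw [abs_of_nonneg (by linarith)]
    linarith

lemma integral_scaledBump_sq {c : ℝ} :
    ∫ t, scaledBump c t ^ 2 = |c⁻¹| * ∫ t, negBump t ^ 2 :=
  Measure.integral_comp_mul_left (fun t => negBump t ^ 2) c

lemma integral_scaledBump_mul {c : ℝ} :
    ∫ t, scaledBump c t * deriv (deriv (scaledBump c)) t
      = |c⁻¹| * (c ^ 2 * ∫ t, negBump t * deriv (deriv negBump) t) := by
  have h1 : deriv (scaledBump c) = fun t => c * deriv negBump (c * t) :=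
    funext fun t => deriv_comp_mul_left c negBump t
  have h2 : deriv (deriv (scaledBump c)) = fun t => c ^ 2 * deriv (deriv negBump) (c * t) := by
    rw [h1]
    ext t
    rw [deriv_const_mul_field, deriv_comp_mul_left c (deriv negBump) t, smul_eq_mul, sq, mul_assoc]
  rw [h2, ← integral_const_mul]
  refine Eq.trans ?_ (Measure.integral_comp_mul_left
    (fun t => c ^ 2 * (negBump t * deriv (deriv negBump) t)) c)
  refine integral_congr_ae (Eventually.of_forall fun t => ?_)
  simp only [scaledBump]
  ring

/-- The Rayleigh quotients of logarithmically spread radial fields tend to zero. -/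
theorem IsHomogeneousFun.not_isStrictlyStable (hh : IsHomogeneousFun n F) (hF : IsRegular F)
    (hd : 2 * n + 2 = 2 * N) (h0 : F 0 = 0) (hne : (zeroCone F).Nonempty) :
    ¬ ConeGeometry.IsStrictlyStable (2 * n) (zeroCone F) := by
  intro hst
  obtain ⟨σ, hσ⟩ := id hne
  set R : ℝ := -(4 * ∫ t, negBump t * deriv (deriv negBump) t) / ∫ t, negBump t ^ 2
    with hR
  have hle : ∀ j : ℕ, (⨅ V ∈ {V : CSpace N → CSpace N | ConeGeometry.IsTestField (zeroCone F) V ∧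
      ∃ p ∈ ConeGeometry.truncation (zeroCone F), V p ≠ 0},
      (ConeGeometry.rayleighQuotient (2 * n) (zeroCone F) V : EReal))
      ≤ ((((j : ℝ) + 1)⁻¹ ^ 2 * R : ℝ) : EReal) := by
    intro j
    set c : ℝ := ((j : ℝ) + 1)⁻¹ with hc
    have hc0 : 0 < c := by positivity
    have hkpos : ∀ t, 0 ≤ t → scaledBump c t = 0 := fun t ht =>
      negBump_eq_zero (Or.inr (by nlinarith [mul_nonneg hc0.le ht]))
    have htest : ConeGeometry.IsTestField (zeroCone F) (radialField F (scaledBump c)) := by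
      refine hF.isTestField_radialField h0 (contDiff_scaledBump c) (b := -5 / c) (fun t ht => ?_)
        (hkpos 0 le_rfl)
      refine negBump_eq_zero (Or.inl ?_)
      rw [lt_div_iff₀ hc0] at ht
      linarith
    have hray : ConeGeometry.rayleighQuotient (2 * n) (zeroCone F) (radialField F (scaledBump c))
        = c ^ 2 * R := by
      rw [hh.rayleighQuotient_radialField hF hd hne (contDiff_scaledBump c) hkpos,
        integral_scaledBump_sq, integral_scaledBump_mul, hR, ← mul_div_assoc]
      have hs : |c⁻¹| ≠ 0 := abs_ne_zero.2 (inv_ne_zero hc0.ne')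
      rw [eq_comm, ← mul_div_mul_left _ _ hs]
      congr 1
      ring
    refine (iInf₂_le (radialField F (scaledBump c)) ⟨htest, ?_⟩).trans (by rw [hray])
    -- a point of the cone at which the bump function is equal to one
    have hσ0 : 0 < ‖σ‖ := norm_pos_iff.2 hσ.1
    set t : ℝ := Real.exp (-3 / c / 2) / ‖σ‖ with ht
    have ht0 : 0 < t := by positivity
    have hnorm : ‖t • σ‖ = Real.exp (-3 / c / 2) := by
      rw [norm_smul, Real.norm_of_nonneg ht0.le, ht, div_mul_cancel₀ _ hσ0.ne']
    have hmem : t • σ ∈ zeroCone F := (hh.smul_mem ht0.ne').2 hσ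
    refine ⟨t • σ, ⟨hmem, ?_⟩, ?_⟩
    · rw [mem_closedBall_zero_iff, hnorm, Real.exp_le_one_iff]
      have : 0 < 3 / c := by positivity
      have h3 : -3 / c = -(3 / c) := neg_div _ _
      linarith
    · have h1 : scaledBump c (Real.log (‖t • σ‖ ^ 2)) = 1 := by
        rw [hnorm, ← Real.exp_nat_mul, Real.log_exp, scaledBump]
        have : c * (((2 : ℕ) : ℝ) * (-3 / c / 2)) = -3 := by
          push_cast
          field_simp
        rw [this]
        exact negBump.one_of_mem_closedBall (by simp [negBump])
      rw [radialField, h1]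
      simp only [Complex.ofReal_one, one_smul]
      exact dualVec_ne_zero (hF.fderiv_ne_zero _ hmem.1)
  have hlim : Tendsto (fun j : ℕ => ((((j : ℝ) + 1)⁻¹ ^ 2 * R : ℝ) : EReal)) atTop
      (𝓝 ((0 : ℝ) : EReal)) := by
    refine (continuous_coe_real_ereal.tendsto 0).comp ?_
    have h1 : Tendsto (fun j : ℕ => ((j : ℝ) + 1)⁻¹) atTop (𝓝 0) := by
      simpa [one_div] using tendsto_one_div_add_atTop_nhds_zero_nat (𝕜 := ℝ)
    simpa using (h1.pow 2).mul_const R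
  have h1 := ge_of_tendsto' hlim hle
  exact absurd hst (not_lt.2 (by simpa using h1))

end ComplexCone

/-! ### The link and the Jacobi field -/

namespace ComplexCone

open Set Filter Topology

variable {N n : ℕ} {F : CSpace N → ℂ} {p : CSpace N}

/-- A chart of the ambient space at a point `p` of the link, flattening the link to a linear
subspace: the coordinate along the normal direction `J(p)` is `F`, and the one along `p` is
`(|z|² - 1) / 2`. -/
def sphericalFlattening (F : CSpace N → ℂ) (p z : CSpace N) : CSpace N :=
  ((z - p) - fderiv ℂ F p (z - p) • normalFrame F p - (inner ℝ p (z - p) : ℝ) • p)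
    + F z • normalFrame F p + ((‖z‖ ^ 2 - 1) / 2 : ℝ) • p

lemma IsRegular.contDiff_sphericalFlattening (hF : IsRegular F) (p : CSpace N) :
    ContDiff ℝ ∞ (sphericalFlattening F p) := by
  have h := hF.contDiff_real
  have h1 : ContDiff ℝ ∞ (fun z : CSpace N => z - p) := contDiff_id.sub contDiff_const
  have h2 : ContDiff ℝ ∞ (fun z => fderiv ℂ F p (z - p)) :=
    ((fderiv ℂ F p).restrictScalars ℝ).contDiff.comp h1
  have h3 : ContDiff ℝ ∞ (fun z : CSpace N => (‖z‖ ^ 2 - 1) / 2) :=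
    ((contDiff_id.norm_sq ℝ).sub contDiff_const).div_const 2
  unfold sphericalFlattening
  exact (((h1.sub (h2.smul contDiff_const)).sub
    ((contDiff_const.inner ℝ h1).smul contDiff_const)).add (h.smul contDiff_const)).add
    (h3.smul contDiff_const)

lemma IsRegular.hasFDerivAt_sphericalFlattening (hF : IsRegular F) (p : CSpace N) :
    HasFDerivAt (sphericalFlattening F p) (ContinuousLinearMap.id ℝ (CSpace N)) p := by
  have h1 : HasFDerivAt (fun z : CSpace N => z - p) (ContinuousLinearMap.id ℝ (CSpace N)) p :=
    (hasFDerivAt_id p).sub_const p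
  have h2 : HasFDerivAt (fun z => fderiv ℂ F p (z - p)) ((fderiv ℂ F p).restrictScalars ℝ) p :=
    (((fderiv ℂ F p).restrictScalars ℝ).hasFDerivAt).comp p h1
  have h3 : HasFDerivAt (fun z => (inner ℝ p (z - p) : ℝ)) (innerSL ℝ p) p :=
    ((innerSL ℝ p).hasFDerivAt).comp p h1
  have h4 : HasFDerivAt (fun z : CSpace N => (‖z‖ ^ 2 - 1) * 2⁻¹) _ p :=
    (((hasStrictFDerivAt_norm_sq p).hasFDerivAt).sub_const 1).mul_const (2⁻¹ : ℝ)
  have h5 := (((h1.sub (h2.smul_const (normalFrame F p))).sub (h3.smul_const p)).add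
    ((hF.hasFDerivAt p).smul_const (normalFrame F p))).add (h4.smul_const p)
  refine h5.congr_fderiv ?_
  ext1 v
  simp
  abel

/-- The tangent space of the link at `p`. -/
def linkTangent (F : CSpace N → ℂ) (p : CSpace N) : Submodule ℝ (CSpace N) :=
  (Submodule.span ℝ {p})ᗮ ⊓ kerReal (fderiv ℂ F p)

lemma mem_linkTangent {w : CSpace N} :
    w ∈ linkTangent F p ↔ inner ℝ p w = 0 ∧ fderiv ℂ F p w = 0 := by
  rw [linkTangent, Submodule.mem_inf, Submodule.mem_orthogonal_singleton_iff_inner_right,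
    mem_kerReal]

/-- The link `F = 0`, `|z| = 1` of the cone. -/
def link (F : CSpace N → ℂ) : Set (CSpace N) := zeroCone F ∩ Metric.sphere 0 1

lemma mem_link {z : CSpace N} : z ∈ link F ↔ F z = 0 ∧ ‖z‖ = 1 := by
  rw [link, mem_inter_iff, mem_sphere_zero_iff_norm]
  refine ⟨fun h => ⟨h.1.2, h.2⟩, fun h => ⟨⟨?_, h.1⟩, h.2⟩⟩
  exact norm_ne_zero_iff.1 (by rw [h.2]; exact one_ne_zero)

/-- By Euler's relation the radial direction `p` is tangent to the cone. -/
lemma IsHomogeneousFun.fderiv_self_of_mem (hh : IsHomogeneousFun n F) (hF : IsRegular F)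
    (hp : p ∈ zeroCone F) : fderiv ℂ F p p = 0 := by
  rw [hh.fderiv_self hF, hp.2, mul_zero]

lemma IsHomogeneousFun.sphericalFlattening_mem_iff (hh : IsHomogeneousFun n F) (hF : IsRegular F)
    (hp : p ∈ link F) (z : CSpace N) :
    sphericalFlattening F p z ∈ linkTangent F p ↔ z ∈ link F := by
  have hD := hh.fderiv_self_of_mem hF hp.1
  have hJ : fderiv ℂ F p (normalFrame F p) = 1 := apply_dualVec (hF.fderiv_ne_zero p hp.1.1)
  have hpJ (c : ℂ) : inner ℝ p (c • normalFrame F p) = 0 :=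
    (Submodule.mem_orthogonal _ _).1 (smul_dualVec_mem_orthogonal (fderiv ℂ F p) c) p
      (mem_kerReal.2 hD)
  have hpp : inner ℝ p p = (1 : ℝ) := by
    rw [real_inner_self_eq_norm_sq, (mem_link.1 hp).2, one_pow]
  have h1 : inner ℝ p (sphericalFlattening F p z) = (‖z‖ ^ 2 - 1) / 2 := by
    simp only [sphericalFlattening, inner_add_right, inner_sub_right, hpJ, real_inner_smul_right,
      hpp]
    ring
  have h2 : fderiv ℂ F p (sphericalFlattening F p z) = F z := by
    have h3 (r : ℝ) : fderiv ℂ F p (r • p) = 0 := by rw [real_smul_eq, map_smul, hD, smul_zero]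
    simp only [sphericalFlattening, map_add, map_sub, h3, map_smul, hJ, hD]
    simp
  rw [mem_linkTangent, h1, h2, mem_link, and_comm]
  refine and_congr_right fun _ => ⟨fun h => ?_, fun h => by rw [h]; norm_num⟩
  have h3 : ‖z‖ ^ 2 = 1 ^ 2 := by linarith
  exact (pow_left_inj₀ (norm_nonneg z) zero_le_one two_ne_zero).1 h3

lemma IsHomogeneousFun.finrank_linkTangent (hh : IsHomogeneousFun n F) (hF : IsRegular F)
    (hp : p ∈ zeroCone F) : Module.finrank ℝ (linkTangent F p) + 3 = 2 * N := by
  have h1 : Submodule.span ℝ {p} ≤ kerReal (fderiv ℂ F p) := by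
    rw [Submodule.span_singleton_le_iff_mem, mem_kerReal]
    exact hh.fderiv_self_of_mem hF hp
  have h2 := Submodule.finrank_add_inf_finrank_orthogonal h1
  have h3 := finrank_kerReal (hF.fderiv_ne_zero p hp.1)
  rw [finrank_span_singleton hp.1] at h2
  rw [linkTangent]
  omega

lemma IsHomogeneousFun.isSmoothSubmanifold_link (hh : IsHomogeneousFun n F) (hF : IsRegular F)
    {l : ℕ} (hl : l + 3 = 2 * N) : ConeGeometry.IsSmoothSubmanifold l (link F) := by
  intro p hp
  obtain ⟨e, hpe, -, he, hsymm, -, -⟩ := exists_biLipschitz_chart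
    (hF.contDiff_sphericalFlattening p) (hF.hasFDerivAt_sphericalFlattening p) (K := 2)
    (by norm_num) univ_mem
  have h1 := hh.finrank_linkTangent hF hp.1
  refine ⟨e, linkTangent F p, hpe, ?_, hsymm, by omega, fun q _ => ?_⟩
  · rw [show (e : CSpace N → CSpace N) = sphericalFlattening F p from funext he]
    exact (hF.contDiff_sphericalFlattening p).contDiffOn
  · rw [he, hh.sphericalFlattening_mem_iff hF hp]

lemma IsRegular.isCompact_link (hF : IsRegular F) : IsCompact (link F) := by
  have h1 : link F = F ⁻¹' {0} ∩ Metric.sphere 0 1 := by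
    ext z
    rw [mem_link, mem_inter_iff, mem_sphere_zero_iff_norm, mem_preimage, mem_singleton_iff]
  rw [h1]
  exact (isCompact_sphere 0 1).inter_left (isClosed_singleton.preimage hF.contDiff.continuous)

lemma IsHomogeneousFun.zeroCone_eq (hh : IsHomogeneousFun n F) :
    zeroCone F = {x | ∃ σ ∈ link F, ∃ r : ℝ, 0 < r ∧ x = r • σ} := by
  ext x
  constructor
  · intro hx
    have h1 : 0 < ‖x‖ := norm_pos_iff.2 hx.1
    refine ⟨‖x‖⁻¹ • x, ⟨(hh.smul_mem (inv_ne_zero h1.ne')).2 hx, ?_⟩, ‖x‖, h1, ?_⟩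
    · rw [mem_sphere_zero_iff_norm, norm_smul, norm_inv, norm_norm, inv_mul_cancel₀ h1.ne']
    · rw [smul_smul, mul_inv_cancel₀ h1.ne', one_smul]
  · rintro ⟨σ, hσ, r, hr, rfl⟩
    exact (hh.smul_mem hr.ne').2 hσ.1

theorem IsHomogeneousFun.isMinimalCone (hh : IsHomogeneousFun n F) (hF : IsRegular F)
    (hn : 1 ≤ n) (hd : 2 * n + 2 = 2 * N) :
    ConeGeometry.IsMinimalCone (2 * n) (zeroCone F) := by
  refine ⟨⟨link F, 2 * n - 1, by omega, inter_subset_right, hF.isCompact_link,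
    hh.isSmoothSubmanifold_link hF (by omega), hh.zeroCone_eq⟩, fun p hp => ?_⟩
  exact hF.meanCurvature_eq_zero isOpen_univ rfl ⟨hp, mem_univ p⟩

/-- The field `J` satisfies `L J = 0`: it is the radial field `k(log |z|²) J` with `k = 1`. -/
theorem IsHomogeneousFun.isJacobiField (hh : IsHomogeneousFun n F) (hF : IsRegular F)
    (hd : 2 * n + 2 = 2 * N) :
    ConeGeometry.IsJacobiField (zeroCone F) (normalFrame F) := by
  refine ⟨⟨fun p hp => ⟨{0}ᶜ, normalFrame F, isOpen_compl_singleton, hp.1, fun q hq =>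
    (hF.contDiffAt_normalFrame hq).contDiffWithinAt, fun _ _ => rfl⟩, fun p hp => ?_⟩,
    fun p hp => ?_⟩
  · rw [hF.tangentSpace_eq isOpen_univ rfl ⟨hp, mem_univ p⟩]
    have h := smul_dualVec_mem_orthogonal (fderiv ℂ F p) 1
    rwa [one_smul] at h
  · rw [hh.jacobiOp_radial hF hd isOpen_univ rfl ⟨hp, mem_univ p⟩ (k := fun _ => 1)
      contDiff_const (fun q _ => by simp)]
    simp

theorem IsHomogeneousFun.isHomogeneousField (hh : IsHomogeneousFun n F) (hF : IsRegular F) :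
    ConeGeometry.IsHomogeneousField (zeroCone F) (1 - (n : ℝ)) (normalFrame F) := by
  intro p _ t ht
  rw [hh.normalFrame_smul hF ht, Real.rpow_sub ht, Real.rpow_one, Real.rpow_natCast]

end ComplexCone

/-! ### Homogeneous polynomials -/

namespace ComplexCone

open Set Filter Topology

variable {N n : ℕ}

/-- The function on `ℂ^N` defined by a polynomial. -/
def polyFun (f : MvPolynomial (Fin N) ℂ) (z : CSpace N) : ℂ := MvPolynomial.eval z.ofLp f

lemma contDiff_polyFun (f : MvPolynomial (Fin N) ℂ) : ContDiff ℂ ∞ (polyFun f) := by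
  unfold polyFun
  simp only [MvPolynomial.eval_eq]
  refine ContDiff.sum fun d _ => contDiff_const.mul (contDiff_prod fun i _ => ContDiff.pow ?_ _)
  exact (EuclideanSpace.proj i : CSpace N →L[ℂ] ℂ).contDiff

lemma fderiv_polyFun_single (f : MvPolynomial (Fin N) ℂ) (z : CSpace N) (j : Fin N) :
    fderiv ℂ (polyFun f) z (EuclideanSpace.single j 1) = polyFun (MvPolynomial.pderiv j f) z := by
  have hd (g : MvPolynomial (Fin N) ℂ) : DifferentiableAt ℂ (polyFun g) z :=
    (contDiff_polyFun g).differentiable (by simp) z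
  induction f using MvPolynomial.induction_on with
  | C a =>
    have h : polyFun (MvPolynomial.C a : MvPolynomial (Fin N) ℂ) = fun _ => a :=
      funext fun z => by simp [polyFun]
    rw [h]
    simp [polyFun]
  | add p q hp hq =>
    have h : polyFun (p + q) = fun z => polyFun p z + polyFun q z :=
      funext fun z => by simp [polyFun]
    rw [h, fderiv_fun_add (hd p) (hd q), add_apply, hp, hq]
    simp [polyFun]
  | mul_X p i hp =>
    have hX : polyFun (MvPolynomial.X i : MvPolynomial (Fin N) ℂ)
        = (EuclideanSpace.proj i : CSpace N →L[ℂ] ℂ) :=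
      funext fun z => by simp [polyFun]
    have h : polyFun (p * MvPolynomial.X i)
        = fun z => polyFun p z * polyFun (MvPolynomial.X i) z :=
      funext fun z => by simp [polyFun]
    rw [h, fderiv_fun_mul (hd p) (hd _), hX, ContinuousLinearMap.fderiv, add_apply,
      smul_apply, smul_apply, hp, Derivation.leibniz,
      MvPolynomial.pderiv_X]
    by_cases hij : i = j
    · subst hij
      simp [polyFun]
    · simp [polyFun, hij]

lemma isHomogeneousFun_polyFun {f : MvPolynomial (Fin N) ℂ} (hf : f.IsHomogeneous n) :
    IsHomogeneousFun n (polyFun f) := by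
  intro t z
  simp only [polyFun, MvPolynomial.eval_eq, Finset.mul_sum]
  refine Finset.sum_congr rfl fun d hd => ?_
  have h1 : ∑ i ∈ d.support, d i = n := by
    rw [← hf (MvPolynomial.mem_support_iff.1 hd), Finsupp.weight_apply]
    simp [Finsupp.sum]
  simp only [PiLp.smul_apply, smul_eq_mul, mul_pow, Finset.prod_mul_distrib,
    Finset.prod_pow_eq_pow_sum, h1]
  ring

lemma isRegular_polyFun {f : MvPolynomial (Fin N) ℂ}
    (hdf : ∀ z : Fin N → ℂ, (∀ j, MvPolynomial.eval z (MvPolynomial.pderiv j f) = 0) → z = 0) :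
    IsRegular (polyFun f) where
  contDiff := contDiff_polyFun f
  fderiv_ne_zero z hz h := by
    refine hz (WithLp.ofLp_injective 2 (hdf z.ofLp fun j => ?_))
    have h1 := fderiv_polyFun_single f z j
    rw [h] at h1
    exact h1.symm

lemma gradField_eq_normalFrame (f : MvPolynomial (Fin N) ℂ) :
    gradField f = normalFrame (polyFun f) := by
  ext1 z
  have h1 : HasFDerivAt (polyRe f)
      (Complex.reCLM ∘L (fderiv ℂ (polyFun f) z).restrictScalars ℝ) z :=
    Complex.reCLM.hasFDerivAt.comp z
      (((contDiff_polyFun f).differentiable (by simp) z).hasFDerivAt.restrictScalars ℝ)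
  have h2 : gradient (polyRe f) z = rieszRe (fderiv ℂ (polyFun f) z) := by
    rw [gradient, h1.fderiv]
    rfl
  rw [gradField, h2]
  rfl

/-- A constant has everywhere vanishing differential. -/
lemma one_le_degree {f : MvPolynomial (Fin (N + 1)) ℂ} (hf : f.IsHomogeneous n)
    (hdf : ∀ z : Fin (N + 1) → ℂ,
      (∀ j, MvPolynomial.eval z (MvPolynomial.pderiv j f) = 0) → z = 0) : 1 ≤ n := by
  by_contra hn
  have hn0 : n = 0 := by omega
  subst hn0
  have h1 : f.totalDegree = 0 := by
    by_cases h : f = 0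
    · simp [h]
    · exact hf.totalDegree h
  rw [MvPolynomial.totalDegree_eq_zero_iff_eq_C] at h1
  have h2 := hdf (fun _ => 1) fun j => by rw [h1]; simp
  exact one_ne_zero (congrFun h2 0)

/-- In at least two variables a homogeneous polynomial of positive degree has a zero off the
origin. -/
lemma zeroCone_polyFun_nonempty {f : MvPolynomial (Fin N) ℂ} (hf : f.IsHomogeneous n)
    (hn : 1 ≤ n) {i j : Fin N} (hij : i ≠ j) : (zeroCone (polyFun f)).Nonempty := by
  have hh := isHomogeneousFun_polyFun hf
  have hi : (EuclideanSpace.single i 1 : CSpace N) i = 1 := by simp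
  have hj : (EuclideanSpace.single j 1 : CSpace N) i = 0 := by simp [hij]
  have hjj : (EuclideanSpace.single j 1 : CSpace N) j = 1 := by simp
  set a : CSpace N := EuclideanSpace.single i 1
  set b : CSpace N := EuclideanSpace.single j 1
  let P : Polynomial ℂ := MvPolynomial.aeval
    (fun k => Polynomial.C (a k) + Polynomial.C (b k) * Polynomial.X) f
  have hP (t : ℂ) : P.eval t = polyFun f (a + t • b) := by
    have h := MvPolynomial.eval₂_comp_left (Polynomial.evalRingHom t) (algebraMap ℂ (Polynomial ℂ))
      (fun k => Polynomial.C (a k) + Polynomial.C (b k) * Polynomial.X) f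
    have h1 : (Polynomial.evalRingHom t).comp (algebraMap ℂ (Polynomial ℂ)) = RingHom.id ℂ := by
      ext
      simp
    have h2 : (Polynomial.evalRingHom t) ∘
        (fun k => Polynomial.C (a k) + Polynomial.C (b k) * Polynomial.X) = (a + t • b).ofLp := by
      ext k
      change Polynomial.eval t (Polynomial.C (a k) + Polynomial.C (b k) * Polynomial.X)
        = a k + t * b k
      rw [Polynomial.eval_add, Polynomial.eval_mul, Polynomial.eval_C, Polynomial.eval_C,
        Polynomial.eval_X, mul_comm]
    rw [h1, h2] at h
    exact h
  by_cases hdeg : P.degree = 0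
  · -- on the line `a + ℂ b` the polynomial is constant, so by homogeneity it vanishes at the
    -- point `b` at infinity of that line
    refine ⟨b, ?_, ?_⟩
    · intro h
      rw [h] at hjj
      exact zero_ne_one hjj
    · obtain ⟨c, hc⟩ : ∃ c, P = Polynomial.C c := ⟨_, Polynomial.eq_C_of_degree_eq_zero hdeg⟩
      have h1 (s : ℂ) (hs : s ≠ 0) : polyFun f (s • a + b) = s ^ n * c := by
        have h2 := hP s⁻¹
        rw [hc, Polynomial.eval_C] at h2
        rw [h2, ← hh, smul_add, smul_smul, mul_inv_cancel₀ hs, one_smul]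
      have h2 : (fun s : ℂ => polyFun f (s • a + b)) = fun s => s ^ n * c := by
        refine Continuous.ext_on (dense_compl_singleton (0 : ℂ)) ?_ (by fun_prop) h1
        exact (contDiff_polyFun f).continuous.comp (by fun_prop)
      have h3 := congrFun h2 0
      simpa [zero_pow (show n ≠ 0 by omega)] using h3
  · obtain ⟨t, ht⟩ := IsAlgClosed.exists_root P hdeg
    refine ⟨a + t • b, fun h => ?_, (hP t).symm.trans ht⟩
    have h1 := congrArg (fun z : CSpace N => z i) h
    simp [hi, hj] at h1

end ComplexCone

end

theorem mainTheorem3 (n : ℕ) (f : MvPolynomial (Fin (n + 1)) ℂ) (hf : f.IsHomogeneous n)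
    (hdf : ∀ z : Fin (n + 1) → ℂ,
      (∀ j, MvPolynomial.eval z (MvPolynomial.pderiv j f) = 0) → z = 0) :
    ConeGeometry.IsMinimalCone (2 * n) (complexCone f) ∧
    ConeGeometry.IsJacobiField (complexCone f) (gradField f) ∧
    ConeGeometry.IsHomogeneousField (complexCone f) (1 - (n : ℝ)) (gradField f) ∧
    (∃ p ∈ complexCone f, gradField f p ≠ 0) ∧
    ConeGeometry.IsStable (2 * n) (complexCone f) ∧
    ¬ ConeGeometry.IsStrictlyStable (2 * n) (complexCone f) := by
  have hn : 1 ≤ n := ComplexCone.one_le_degree hf hdf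
  have hh := ComplexCone.isHomogeneousFun_polyFun hf
  have hF := ComplexCone.isRegular_polyFun hdf
  have h0 : ComplexCone.polyFun f 0 = 0 := by
    have h := hh 0 0
    rwa [smul_zero, zero_pow (by omega), zero_mul] at h
  have hd : 2 * n + 2 = 2 * (n + 1) := by omega
  have hne := ComplexCone.zeroCone_polyFun_nonempty hf hn
    (i := ⟨0, by omega⟩) (j := ⟨1, by omega⟩) (by simp)
  rw [show complexCone f = ComplexCone.zeroCone (ComplexCone.polyFun f) from rfl,
    ComplexCone.gradField_eq_normalFrame]
  obtain ⟨p, hp⟩ := hne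
  exact ⟨hh.isMinimalCone hF hn hd, hh.isJacobiField hF hd, hh.isHomogeneousField hF,
    ⟨p, hp, ComplexCone.dualVec_ne_zero (hF.fderiv_ne_zero p hp.1)⟩, hh.isStable hF hd h0,
    hh.not_isStrictlyStable hF hd h0 ⟨p, hp⟩⟩
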